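/- **Language.** Types are generated from $0$ by $\sigma\to\tau$ and $\sigma^*$ (finite sequences). Terms are built by application from typed variables and the constants $0$, $\mathrm S$, the combinators $\Pi,\Sigma$, the recursors $\mathrm R_\sigma:\sigma\to(\sigma\to0\to\sigma)\to0\to\sigma$, the empty sequences $\langle\rangle_\sigma:\sigma^*$, the prepending operators $C:\sigma\to\sigma^*\to\sigma^*$ and the list recursors $\mathrm L_{\sigma,\tau}:\sigma\to(\sigma\to\tau\to\sigma)\to\tau^*\to\sigma$. Formulas are built from $\bot$, $a=_\sigma b$ and $\mathrm{st}_\sigma(a)$ by $\land,\lor,\to$, the quantifiers $\forall x{:}\sigma$, $\exists x{:}\sigma$ and the external quantifiers $\forall^{\mathrm{st}}x{:}\sigma$, $\exists^{\mathrm{st}}x{:}\sigma$. A formula is *internal* if it contains neither $\mathrm{st}$ nor an external quantifier. With $|s|$ and $s_i$ the length and the $i$-th entry of a sequence (defined by list recursion), $x\in s$ abbreviates $\exists i<|s|\,(x=s_i)$. **The system $\mathrm H$** has intuitionistic many-sorted predicate logic and the following axioms, where $\varphi$ ranges over internal formulas without $\lor$ and $\Phi,\Psi$ over all formulas (further free variables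 allowed): 1. Extensional arithmetic in all finite types: the equality axioms; $f=g\leftrightarrow\forall x\,(fx=gx)$; $\neg\,\mathrm Sn=0$; $\mathrm Sm=\mathrm Sn\to m=n$; the defining equations $\Pi ab=a$, $\Sigma fga=fa(ga)$, $\mathrm Raf0=a$, $\mathrm Raf(\mathrm Sn)=f(\mathrm Rafn)n$, $\mathrm Laf\langle\rangle=a$, $\mathrm Laf(Ccs)=f(\mathrm Lafs)c$; the sequence axiom $\exists z{:}0\,\big((z=0\to s=\langle\rangle)\land(\neg z=0\to\exists x\,\exists s'\,(s=Cxs'))\big)$; and induction $\varphi(0)\land\forall n\,(\varphi(n)\to\varphi(\mathrm Sn))\to\forall n\,\varphi(n)$. 2. $\forall^{\mathrm{st}}x\,\Phi(x)\leftrightarrow\forall x\,(\mathrm{st}(x)\to\Phi(x))$; $\exists^{\mathrm{st}}x\,\Phi(x)\leftrightarrow\exists x\,(\mathrm{st}(x)\land\Phi(x))$; $\mathrm{st}(x)\land x=y\to\mathrm{st}(y)$; $\mathrm{st}(a)$ for closed terms $a$; $\mathrm{st}(f)\land\mathrm{st}(x)\to\mathrm{st}(fx)$; and external induction $\Phi(0)\land\forall^{\mathrm{st}}n\,(\Phi(n)\to\Phi(\mathrm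 Sn))\to\forall^{\mathrm{st}}n\,\Phi(n)$. 3. For all types $\sigma,\tau$: - $\mathsf{OS}^*_\lor$: $\forall^{\mathrm{st}}s{:}\sigma^*\,\varphi(s)\to\exists s{:}\sigma^*\,(\forall^{\mathrm{st}}x\,(x\in s)\land\varphi(s))$; - $\mathsf{US}^*_\lor$: $\forall s{:}\sigma^*\,(\forall^{\mathrm{st}}x\,(x\in s)\to\varphi(s))\to\exists^{\mathrm{st}}s{:}\sigma^*\,\varphi(s)$; - $\mathsf{NU}$: $\forall y{:}\tau\,\exists^{\mathrm{st}}x{:}\sigma\,\Phi(x,y)\to\exists^{\mathrm{st}}x{:}\sigma\,\forall y{:}\tau\,\Phi(x,y)$; - $\mathsf{AC}^{\mathrm{st}}$: $\forall^{\mathrm{st}}x{:}\sigma\,\exists^{\mathrm{st}}y{:}\tau\,\Phi(x,y)\to\exists^{\mathrm{st}}f{:}\sigma\to\tau\;\forall^{\mathrm{st}}x{:}\sigma\,\Phi(x,fx)$; - $\mathsf{IP}^{\mathrm{st}}_{\forall\lor}$: $(\forall^{\mathrm{st}}x{:}\sigma\,\varphi(x)\to\exists^{\mathrm{st}}y{:}\tau\,\Psi(y))\to\exists^{\mathrm{st}}y{:}\tau\,(\forall^{\mathrm{st}}x{:}\sigma\,\varphi(x)\to\Psi(y))$.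 **Proposition (existence property).** For every type $\sigma$ and every formula $\Phi(x)$ with $x:\sigma$ (possibly with further free variables), if $\mathrm H\vdash\exists^{\mathrm{st}}x{:}\sigma\,\Phi(x)$, then there is a closed term $t:\sigma$ such that $\mathrm H\vdash\Phi(t)$. **Corollary (disjunction property).** For all formulas $\Phi,\Psi$ (possibly with free variables), if $\mathrm H\vdash\Phi\lor\Psi$, then $\mathrm H\vdash\Phi$ or $\mathrm H\vdash\Psi$. -/

import Mathlib

/-! The theory `H` of nonstandard arithmetic in all finite types (with finite sequences) that
characterises the uniform Diller-Nahm interpretation: language, calculus, axioms. -/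

namespace UDN

/-- The finite types `T*`: `0`, `σ → τ`, and the type `σ*` of finite sequences over `σ`. -/
inductive Ty : Type
  | nat : Ty
  | arrow : Ty → Ty → Ty
  | seq : Ty → Ty

/-- A context: the types of the free variables that may occur, innermost first. -/
abbrev Ctx : Type := List Ty

/-- Variables of a given type in a given context (typed de Bruijn indices). -/
inductive Var : Ctx → Ty → Type
  | here {Γ : Ctx} {σ : Ty} : Var (σ :: Γ) σ
  | there {Γ : Ctx} {σ τ : Ty} : Var Γ σ → Var (τ :: Γ) σ

/-- The constants. -/
inductive Const : Ty → Type
  | zero : Const .nat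
  | succ : Const (.arrow .nat .nat)
  /-- the projector `Π` -/
  | proj (σ τ : Ty) : Const (.arrow σ (.arrow τ σ))
  /-- the combinator `Σ` -/
  | comb (ρ σ τ : Ty) :
      Const (.arrow (.arrow ρ (.arrow σ τ)) (.arrow (.arrow ρ σ) (.arrow ρ τ)))
  /-- the recursor `R` -/
  | natRec (σ : Ty) : Const (.arrow σ (.arrow (.arrow σ (.arrow .nat σ)) (.arrow .nat σ)))
  /-- the empty sequence -/
  | nil (σ : Ty) : Const (.seq σ)
  /-- the prepending operator `C` -/
  | cons (σ : Ty) : Const (.arrow σ (.arrow (.seq σ) (.seq σ)))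
  /-- the list recursor `L` -/
  | listRec (σ τ : Ty) :
      Const (.arrow σ (.arrow (.arrow σ (.arrow τ σ)) (.arrow (.seq τ) σ)))

/-- Terms of type `σ` with free variables from `Γ`. Terms over `[]` are the closed terms. -/
inductive Tm (Γ : Ctx) : Ty → Type
  | var {σ : Ty} : Var Γ σ → Tm Γ σ
  | const {σ : Ty} : Const σ → Tm Γ σ
  | app {σ τ : Ty} : Tm Γ (.arrow σ τ) → Tm Γ σ → Tm Γ τ

/-- Formulas with free variables from `Γ`: equality at every type, the standardness predicate at
every type, the connectives, the internal quantifiers `all`, `ex`, and the external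
quantifiers `allSt`, `exSt`. -/
inductive Formula : Ctx → Type
  | bot {Γ : Ctx} : Formula Γ
  | eq {Γ : Ctx} {σ : Ty} : Tm Γ σ → Tm Γ σ → Formula Γ
  | st {Γ : Ctx} {σ : Ty} : Tm Γ σ → Formula Γ
  | and {Γ : Ctx} : Formula Γ → Formula Γ → Formula Γ
  | or {Γ : Ctx} : Formula Γ → Formula Γ → Formula Γ
  | imp {Γ : Ctx} : Formula Γ → Formula Γ → Formula Γ
  | all {Γ : Ctx} (σ : Ty) : Formula (σ :: Γ) → Formula Γ
  | ex {Γ : Ctx} (σ : Ty) : Formula (σ :: Γ) → Formula Γ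
  | allSt {Γ : Ctx} (σ : Ty) : Formula (σ :: Γ) → Formula Γ
  | exSt {Γ : Ctx} (σ : Ty) : Formula (σ :: Γ) → Formula Γ

infix:70 " ≐ " => UDN.Formula.eq
infixr:66 " ∧ᶠ " => UDN.Formula.and
infixr:60 " →ᶠ " => UDN.Formula.imp

/-- Negation. -/
abbrev Formula.neg {Γ : Ctx} (A : Formula Γ) : Formula Γ := A →ᶠ .bot

/-- Bi-implication. -/
abbrev Formula.iff {Γ : Ctx} (A B : Formula Γ) : Formula Γ := (A →ᶠ B) ∧ᶠ (B →ᶠ A)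

/-! ### Renaming and substitution -/

/-- A renaming of the variables of `Γ` by variables of `Δ`. -/
abbrev Ren (Γ Δ : Ctx) : Type := ∀ σ : Ty, Var Γ σ → Var Δ σ

/-- A substitution of terms over `Δ` for the variables of `Γ`. -/
abbrev Sub (Γ Δ : Ctx) : Type := ∀ σ : Ty, Var Γ σ → Tm Δ σ

/-- Renaming under a binder. -/
def Ren.lift {Γ Δ : Ctx} (r : Ren Γ Δ) (τ : Ty) : Ren (τ :: Γ) (τ :: Δ)
  | _, .here => .here
  | _, .there x => .there (r _ x)

def Tm.rename {Γ Δ : Ctx} (r : Ren Γ Δ) : {σ : Ty} → Tm Γ σ → Tm Δ σ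
  | _, .var x => .var (r _ x)
  | _, .const c => .const c
  | _, .app f a => .app (f.rename r) (a.rename r)

def Formula.rename : {Γ Δ : Ctx} → Ren Γ Δ → Formula Γ → Formula Δ
  | _, _, _, .bot => .bot
  | _, _, r, .eq a b => .eq (a.rename r) (b.rename r)
  | _, _, r, .st a => .st (a.rename r)
  | _, _, r, .and A B => .and (A.rename r) (B.rename r)
  | _, _, r, .or A B => .or (A.rename r) (B.rename r)
  | _, _, r, .imp A B => .imp (A.rename r) (B.rename r)
  | _, _, r, .all σ A => .all σ (A.rename (r.lift σ))
  | _, _, r, .ex σ A => .ex σ (A.rename (r.lift σ))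
  | _, _, r, .allSt σ A => .allSt σ (A.rename (r.lift σ))
  | _, _, r, .exSt σ A => .exSt σ (A.rename (r.lift σ))

/-- Adding a fresh variable to the context. -/
def Ren.shift (Γ : Ctx) (τ : Ty) : Ren Γ (τ :: Γ) := fun _ x => .there x

abbrev Tm.weaken {Γ : Ctx} {σ : Ty} (τ : Ty) (a : Tm Γ σ) : Tm (τ :: Γ) σ :=
  a.rename (Ren.shift Γ τ)

abbrev Formula.weaken {Γ : Ctx} (τ : Ty) (A : Formula Γ) : Formula (τ :: Γ) :=
  A.rename (Ren.shift Γ τ)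

/-- The renaming from the empty context. -/
def Ren.ofNil (Γ : Ctx) : Ren [] Γ := nofun

/-- A closed term, regarded as a term over an arbitrary context. -/
def Tm.ofClosed {σ : Ty} (Γ : Ctx) (a : Tm [] σ) : Tm Γ σ := a.rename (Ren.ofNil Γ)

/-- Substitution under a binder. -/
def Sub.lift {Γ Δ : Ctx} (s : Sub Γ Δ) (τ : Ty) : Sub (τ :: Γ) (τ :: Δ)
  | _, .here => .var .here
  | _, .there x => (s _ x).weaken τ

def Tm.subst {Γ Δ : Ctx} (s : Sub Γ Δ) : {σ : Ty} → Tm Γ σ → Tm Δ σ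
  | _, .var x => s _ x
  | _, .const c => .const c
  | _, .app f a => .app (f.subst s) (a.subst s)

def Formula.subst : {Γ Δ : Ctx} → Sub Γ Δ → Formula Γ → Formula Δ
  | _, _, _, .bot => .bot
  | _, _, s, .eq a b => .eq (a.subst s) (b.subst s)
  | _, _, s, .st a => .st (a.subst s)
  | _, _, s, .and A B => .and (A.subst s) (B.subst s)
  | _, _, s, .or A B => .or (A.subst s) (B.subst s)
  | _, _, s, .imp A B => .imp (A.subst s) (B.subst s)
  | _, _, s, .all σ A => .all σ (A.subst (s.lift σ))
  | _, _, s, .ex σ A => .ex σ (A.subst (s.lift σ))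
  | _, _, s, .allSt σ A => .allSt σ (A.subst (s.lift σ))
  | _, _, s, .exSt σ A => .exSt σ (A.subst (s.lift σ))

/-- The substitution of `a` for the innermost variable. -/
def Sub.single {Γ : Ctx} {τ : Ty} (a : Tm Γ τ) : Sub (τ :: Γ) Γ
  | _, .here => a
  | _, .there x => .var x

/-- `A(a)`, for a formula `A(x)` with `x` the innermost variable. -/
def Formula.inst {Γ : Ctx} {τ : Ty} (A : Formula (τ :: Γ)) (a : Tm Γ τ) : Formula Γ :=
  A.subst (Sub.single a)

/-! ### Some terms -/

namespace Tm

def zero {Γ : Ctx} : Tm Γ .nat := .const .zero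

def succ {Γ : Ctx} (n : Tm Γ .nat) : Tm Γ .nat := .app (.const .succ) n

def nil {Γ : Ctx} (σ : Ty) : Tm Γ (.seq σ) := .const (.nil σ)

def cons {Γ : Ctx} {σ : Ty} (a : Tm Γ σ) (s : Tm Γ (.seq σ)) : Tm Γ (.seq σ) :=
  .app (.app (.const (.cons σ)) a) s

def natRec {Γ : Ctx} {σ : Ty} (a : Tm Γ σ) (f : Tm Γ (.arrow σ (.arrow .nat σ)))
    (n : Tm Γ .nat) : Tm Γ σ :=
  .app (.app (.app (.const (.natRec σ)) a) f) n

def listRec {Γ : Ctx} {σ τ : Ty} (a : Tm Γ σ) (f : Tm Γ (.arrow σ (.arrow τ σ)))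
    (s : Tm Γ (.seq τ)) : Tm Γ σ :=
  .app (.app (.app (.const (.listRec σ τ)) a) f) s

/-- Defined abstraction `λ x. a`, where `x` is the innermost variable. -/
def lam {Γ : Ctx} {σ : Ty} : {τ : Ty} → Tm (σ :: Γ) τ → Tm Γ (.arrow σ τ)
  | _, .var .here =>
      .app (.app (.const (.comb σ (.arrow σ σ) σ)) (.const (.proj σ (.arrow σ σ))))
        (.const (.proj σ σ))
  | τ, .var (.there x) => .app (.const (.proj τ σ)) (.var x)
  | τ, .const c => .app (.const (.proj τ σ)) (.const c)
  | τ, .app (σ := ρ) f a => .app (.app (.const (.comb σ ρ τ)) f.lam) a.lam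

/-- The canonical closed term `∅_σ`. -/
def empty {Γ : Ctx} : (σ : Ty) → Tm Γ σ
  | .nat => zero
  | .arrow σ τ => .app (.const (.proj τ σ)) (empty τ)
  | .seq σ => nil σ

/-- Variables `x₀`, `x₁`, `x₂` (innermost first). -/
abbrev v0 {Γ : Ctx} {σ : Ty} : Tm (σ :: Γ) σ := .var .here
abbrev v1 {Γ : Ctx} {σ τ : Ty} : Tm (τ :: σ :: Γ) σ := .var (.there .here)
abbrev v2 {Γ : Ctx} {σ τ ρ : Ty} : Tm (ρ :: τ :: σ :: Γ) σ := .var (.there (.there .here))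

/-- `m + n`, by recursion on `n`. -/
def add {Γ : Ctx} (m n : Tm Γ .nat) : Tm Γ .nat :=
  natRec m (lam (lam (succ v1))) n

/-- The length `|s|`: `|⟨⟩| = 0` and `|C a s| = S |s|`. -/
def len {Γ : Ctx} {σ : Ty} (s : Tm Γ (.seq σ)) : Tm Γ .nat :=
  listRec zero (lam (lam (succ v1))) s

/-- The projection `s_i`: `⟨⟩_i = ∅`, `(C a s)_0 = a` and `(C a s)_{S i} = s_i`. The list recursion
is `L (λ i. ∅) (λ f a i. R a (λ _ k. f k) i) s i`. -/
def get {Γ : Ctx} {σ : Ty} (s : Tm Γ (.seq σ)) (i : Tm Γ .nat) : Tm Γ σ :=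
  .app (listRec (σ := .arrow .nat σ) (lam (empty σ))
    (lam (lam (lam (natRec v1 (lam (lam (.app (.var (.there (.there (.there (.there .here))))) v0)))
      v0)))) s) i

end Tm

open Tm

/-- `m < n`, i.e. `∃ k, m + S k = n`. -/
def Formula.lt {Γ : Ctx} (m n : Tm Γ .nat) : Formula Γ :=
  .ex .nat (add (m.weaken .nat) (succ v0) ≐ n.weaken .nat)

/-- Membership `a ∈ s`, i.e. `∃ i < |s|, a = s_i`. -/
def Formula.mem {Γ : Ctx} {σ : Ty} (a : Tm Γ σ) (s : Tm Γ (.seq σ)) : Formula Γ :=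
  .ex .nat (Formula.lt v0 (len (s.weaken .nat)) ∧ᶠ (a.weaken .nat ≐ get (s.weaken .nat) v0))

/-- `s` is a hyperfinite enumeration of its type: `∀ˢᵗ x, x ∈ s`. -/
def Formula.hyper {Γ : Ctx} {σ : Ty} (s : Tm Γ (.seq σ)) : Formula Γ :=
  .allSt σ (Formula.mem v0 (s.weaken σ))

/-- Internal formulas: neither `st` nor an external quantifier occurs. -/
def Formula.Internal : {Γ : Ctx} → Formula Γ → Prop
  | _, .bot => True
  | _, .eq _ _ => True
  | _, .st _ => False
  | _, .and A B => A.Internal ∧ B.Internal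
  | _, .or A B => A.Internal ∧ B.Internal
  | _, .imp A B => A.Internal ∧ B.Internal
  | _, .all _ A => A.Internal
  | _, .ex _ A => A.Internal
  | _, .allSt _ _ => False
  | _, .exSt _ _ => False

/-- Formulas in which `∨` does not occur. -/
def Formula.OrFree : {Γ : Ctx} → Formula Γ → Prop
  | _, .bot => True
  | _, .eq _ _ => True
  | _, .st _ => True
  | _, .and A B => A.OrFree ∧ B.OrFree
  | _, .or _ _ => False
  | _, .imp A B => A.OrFree ∧ B.OrFree
  | _, .all _ A => A.OrFree
  | _, .ex _ A => A.OrFree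
  | _, .allSt _ A => A.OrFree
  | _, .exSt _ A => A.OrFree

/-! ### Axioms -/

/-- The substitution of `S x` for the innermost variable `x`. -/
def Sub.succ (Γ : Ctx) : Sub (.nat :: Γ) (.nat :: Γ)
  | _, .here => Tm.succ v0
  | _, .there x => .var (.there x)

/-- For `A(x, y)` with `y` innermost, the substitution that yields `A(x, f x)`, where now `x` is
innermost and `f` is the next variable. -/
def Sub.choice (Γ : Ctx) (σ τ : Ty) : Sub (τ :: σ :: Γ) (σ :: .arrow σ τ :: Γ)
  | _, .here => .app v1 v0
  | _, .there .here => v0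
  | _, .there (.there x) => .var (.there (.there x))

/-- The exchange of the two innermost variables. -/
def Ren.swap (Γ : Ctx) (σ τ : Ty) : Ren (σ :: τ :: Γ) (τ :: σ :: Γ)
  | _, .here => .there .here
  | _, .there .here => .here
  | _, .there (.there x) => .there (.there x)

/-- The non-logical axioms of extensional intuitionistic arithmetic in all finite types with finite
sequences, with internal induction restricted to internal `∨`-free formulas. -/
inductive AxEHA : {Γ : Ctx} → Formula Γ → Prop
  | eq_refl {Γ : Ctx} {σ : Ty} (a : Tm Γ σ) : AxEHA (a ≐ a)
  | eq_symm {Γ : Ctx} {σ : Ty} (a b : Tm Γ σ) : AxEHA (a ≐ b →ᶠ b ≐ a)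
  | eq_trans {Γ : Ctx} {σ : Ty} (a b c : Tm Γ σ) : AxEHA (a ≐ b ∧ᶠ b ≐ c →ᶠ a ≐ c)
  | eq_app {Γ : Ctx} {σ τ : Ty} (f g : Tm Γ (.arrow σ τ)) (a b : Tm Γ σ) :
      AxEHA (f ≐ g ∧ᶠ a ≐ b →ᶠ f.app a ≐ g.app b)
  | extensionality {Γ : Ctx} {σ τ : Ty} (f g : Tm Γ (.arrow σ τ)) :
      AxEHA (Formula.iff (f ≐ g) (.all σ ((f.weaken σ).app v0 ≐ (g.weaken σ).app v0)))
  | succ_ne_zero {Γ : Ctx} (n : Tm Γ .nat) : AxEHA (succ n ≐ zero).neg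
  | succ_inj {Γ : Ctx} (m n : Tm Γ .nat) : AxEHA (succ m ≐ succ n →ᶠ m ≐ n)
  | proj {Γ : Ctx} {σ τ : Ty} (a : Tm Γ σ) (b : Tm Γ τ) :
      AxEHA (((Tm.const (.proj σ τ)).app a).app b ≐ a)
  | comb {Γ : Ctx} {ρ σ τ : Ty} (f : Tm Γ (.arrow ρ (.arrow σ τ))) (g : Tm Γ (.arrow ρ σ))
      (a : Tm Γ ρ) :
      AxEHA ((((Tm.const (.comb ρ σ τ)).app f).app g).app a ≐ (f.app a).app (g.app a))
  | natRec_zero {Γ : Ctx} {σ : Ty} (a : Tm Γ σ) (f : Tm Γ (.arrow σ (.arrow .nat σ))) :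
      AxEHA (natRec a f zero ≐ a)
  | natRec_succ {Γ : Ctx} {σ : Ty} (a : Tm Γ σ) (f : Tm Γ (.arrow σ (.arrow .nat σ)))
      (n : Tm Γ .nat) :
      AxEHA (natRec a f (succ n) ≐ (f.app (natRec a f n)).app n)
  | listRec_nil {Γ : Ctx} {σ τ : Ty} (a : Tm Γ σ) (f : Tm Γ (.arrow σ (.arrow τ σ))) :
      AxEHA (listRec a f (nil τ) ≐ a)
  | listRec_cons {Γ : Ctx} {σ τ : Ty} (a : Tm Γ σ) (f : Tm Γ (.arrow σ (.arrow τ σ)))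
      (c : Tm Γ τ) (s : Tm Γ (.seq τ)) :
      AxEHA (listRec a f (cons c s) ≐ (f.app (listRec a f s)).app c)
  /-- The sequence axiom `s = ⟨⟩ ∨ ∃ x s', s = C x s'`, with the disjunction of internal formulas
  `A ∨ B` expressed without `∨`, as `∃ z : 0, (z = 0 → A) ∧ (¬ z = 0 → B)`. -/
  | seq {Γ : Ctx} {σ : Ty} (s : Tm Γ (.seq σ)) :
      AxEHA (Formula.ex .nat
        ((v0 ≐ zero →ᶠ s.weaken .nat ≐ nil σ) ∧ᶠ
          ((v0 ≐ zero).neg →ᶠ .ex σ (.ex (.seq σ)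
            (((s.weaken .nat).weaken σ).weaken (.seq σ) ≐ cons v1 v0)))))
  | induction {Γ : Ctx} (φ : Formula (.nat :: Γ)) (hi : φ.Internal) (ho : φ.OrFree) :
      AxEHA (φ.inst zero ∧ᶠ .all .nat (φ →ᶠ φ.subst (Sub.succ Γ)) →ᶠ .all .nat φ)

/-- The axioms for the standardness predicate and the external quantifiers, and external
induction. -/
inductive AxSt : {Γ : Ctx} → Formula Γ → Prop
  | allSt_def {Γ : Ctx} {σ : Ty} (Φ : Formula (σ :: Γ)) :
      AxSt (Formula.iff (.allSt σ Φ) (.all σ (.st v0 →ᶠ Φ)))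
  | exSt_def {Γ : Ctx} {σ : Ty} (Φ : Formula (σ :: Γ)) :
      AxSt (Formula.iff (.exSt σ Φ) (.ex σ (.st v0 ∧ᶠ Φ)))
  | st_eq {Γ : Ctx} {σ : Ty} (a b : Tm Γ σ) : AxSt (.st a ∧ᶠ a ≐ b →ᶠ .st b)
  | st_closed {Γ : Ctx} {σ : Ty} (a : Tm [] σ) : AxSt (.st (a.ofClosed Γ))
  | st_app {Γ : Ctx} {σ τ : Ty} (f : Tm Γ (.arrow σ τ)) (a : Tm Γ σ) :
      AxSt (.st f ∧ᶠ .st a →ᶠ .st (f.app a))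
  | induction {Γ : Ctx} (Φ : Formula (.nat :: Γ)) :
      AxSt (Φ.inst zero ∧ᶠ .allSt .nat (Φ →ᶠ Φ.subst (Sub.succ Γ)) →ᶠ .allSt .nat Φ)

/-- The characteristic principles. -/
inductive AxChar : {Γ : Ctx} → Formula Γ → Prop
  /-- Sequence overspill, for internal `∨`-free formulas. -/
  | overspill {Γ : Ctx} {σ : Ty} (φ : Formula (.seq σ :: Γ)) (hi : φ.Internal) (ho : φ.OrFree) :
      AxChar (.allSt (.seq σ) φ →ᶠ .ex (.seq σ) (Formula.hyper v0 ∧ᶠ φ))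
  /-- Sequence underspill, for internal `∨`-free formulas. -/
  | underspill {Γ : Ctx} {σ : Ty} (φ : Formula (.seq σ :: Γ)) (hi : φ.Internal) (ho : φ.OrFree) :
      AxChar (.all (.seq σ) (Formula.hyper v0 →ᶠ φ) →ᶠ .exSt (.seq σ) φ)
  /-- Nonstandard uniformity `∀ y ∃ˢᵗ x Φ(x, y) → ∃ˢᵗ x ∀ y Φ(x, y)`. -/
  | uniformity {Γ : Ctx} {σ τ : Ty} (Φ : Formula (σ :: τ :: Γ)) :
      AxChar (.all τ (.exSt σ Φ) →ᶠ .exSt σ (.all τ (Φ.rename (Ren.swap Γ σ τ))))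
  /-- Choice `∀ˢᵗ x ∃ˢᵗ y Φ(x, y) → ∃ˢᵗ f ∀ˢᵗ x Φ(x, f x)`. -/
  | choice {Γ : Ctx} {σ τ : Ty} (Φ : Formula (τ :: σ :: Γ)) :
      AxChar (.allSt σ (.exSt τ Φ) →ᶠ
        .exSt (.arrow σ τ) (.allSt σ (Φ.subst (Sub.choice Γ σ τ))))
  /-- Independence of premise
  `(∀ˢᵗ x φ(x) → ∃ˢᵗ y Ψ(y)) → ∃ˢᵗ y (∀ˢᵗ x φ(x) → Ψ(y))`, for `φ` internal and `∨`-free. -/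
  | independence {Γ : Ctx} {σ τ : Ty} (φ : Formula (σ :: Γ)) (hi : φ.Internal) (ho : φ.OrFree)
      (Ψ : Formula (τ :: Γ)) :
      AxChar ((.allSt σ φ →ᶠ .exSt τ Ψ) →ᶠ .exSt τ ((Formula.allSt σ φ).weaken τ →ᶠ Ψ))

/-! ### Derivability -/

/-- A system of (non-logical) axioms, formulas with free variables from any context. -/
abbrev System : Type := (Γ : Ctx) → Set (Formula Γ)

/-- Derivability in intuitionistic many-sorted predicate logic from the axioms `T`. -/
inductive Provable (T : System) : {Γ : Ctx} → Formula Γ → Prop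
  | ax {Γ : Ctx} {A : Formula Γ} : A ∈ T Γ → Provable T A
  | mp {Γ : Ctx} {A B : Formula Γ} : Provable T (A →ᶠ B) → Provable T A → Provable T B
  | imp_k {Γ : Ctx} (A B : Formula Γ) : Provable T (A →ᶠ B →ᶠ A)
  | imp_s {Γ : Ctx} (A B C : Formula Γ) :
      Provable T ((A →ᶠ B →ᶠ C) →ᶠ (A →ᶠ B) →ᶠ A →ᶠ C)
  | bot_elim {Γ : Ctx} (A : Formula Γ) : Provable T (.bot →ᶠ A)
  | and_intro {Γ : Ctx} (A B : Formula Γ) : Provable T (A →ᶠ B →ᶠ A ∧ᶠ B)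
  | and_left {Γ : Ctx} (A B : Formula Γ) : Provable T (A ∧ᶠ B →ᶠ A)
  | and_right {Γ : Ctx} (A B : Formula Γ) : Provable T (A ∧ᶠ B →ᶠ B)
  | or_left {Γ : Ctx} (A B : Formula Γ) : Provable T (A →ᶠ A.or B)
  | or_right {Γ : Ctx} (A B : Formula Γ) : Provable T (B →ᶠ A.or B)
  | or_elim {Γ : Ctx} (A B C : Formula Γ) :
      Provable T ((A →ᶠ C) →ᶠ (B →ᶠ C) →ᶠ A.or B →ᶠ C)
  | all_elim {Γ : Ctx} {σ : Ty} (A : Formula (σ :: Γ)) (a : Tm Γ σ) :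
      Provable T (.all σ A →ᶠ A.inst a)
  | ex_intro {Γ : Ctx} {σ : Ty} (A : Formula (σ :: Γ)) (a : Tm Γ σ) :
      Provable T (A.inst a →ᶠ .ex σ A)
  | all_rule {Γ : Ctx} {σ : Ty} {A : Formula (σ :: Γ)} {B : Formula Γ} :
      Provable T (B.weaken σ →ᶠ A) → Provable T (B →ᶠ .all σ A)
  | ex_rule {Γ : Ctx} {σ : Ty} {A : Formula (σ :: Γ)} {B : Formula Γ} :
      Provable T (A →ᶠ B.weaken σ) → Provable T (.ex σ A →ᶠ B)

/-- The system `H`. -/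
def H : System := fun _ => {A | AxEHA A ∨ AxSt A ∨ AxChar A}

end UDN

/-! Both properties come from the uniform Diller–Nahm interpretation. It assigns to every formula
`A` a form `∃ˢᵗ x ∀ˢᵗ y φ(x, y)` whose matrix `φ` is internal and `∨`-free. Two facts carry the
proof.

Soundness (`Provable.realized`): if `H` proves `A`, some closed term `t` makes `φ(t, y)` derivable
for every `y`, standard or not. Internal quantifiers carry no information, so realizers ignore them;
the premise of an implication is tested on a finite sequence of counterexamples, which replaces a
decision procedure for `φ`. Internal `∨`-free axioms are realized by dummies, and each
characteristic principle has an explicit realizer.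

Characterisation (`Interp.formula_interp`): `H` proves that `A` is equivalent to its interpretation.
This is what overspill, underspill, uniformity, choice and independence of premise are for. At the
end only the passage from interpretation to formula is used, but implication makes the induction
need both directions.

For `∃ˢᵗ x Φ(x)` the witness type is a product, and a closed realizer `t` gives the closed term `fst
t`, while `snd t` witnesses the interpretation of `Φ(fst t)`; hence `H` proves `Φ(fst t)`. For a
disjunction the first component of the realizer is a closed term of type `0`. A computability
argument (`isCanonical_eval`) shows that `H` proves it equal to a numeral, and whether the numeral
is zero selects the disjunct.

Formal derivations in `H` are avoided by a generic model. Its worlds are formulas, `w` forces `A`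
when `H` proves `w → A`, and its elements are terms modulo provable equality, all over an increasing
chain of contexts in which every type receives fresh variables forever. The forcing clauses turn
derivations into ordinary reasoning: `∧`, `→`, `∀` are characterised outright, while `∨` and `∃` can
be eliminated into any forced formula. Provable equations become equalities of elements. Validity at
the trivial world gives derivability (`provable_of_forces`). -/

namespace UDN
open Tm

/-! ### Substitution calculus -/

/-- A renaming, regarded as a substitution. -/
def Sub.ofRen {Γ Δ : Ctx} (r : Ren Γ Δ) : Sub Γ Δ := fun σ x => .var (r σ x)

/-- Composition of substitutions. -/
def Sub.comp {Γ Δ Θ : Ctx} (s : Sub Γ Δ) (t : Sub Δ Θ) : Sub Γ Θ := fun σ x => (s σ x).subst t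

/-- Extension of a substitution by a term for the innermost variable. -/
def Sub.cons {Γ Δ : Ctx} {τ : Ty} (a : Tm Δ τ) (s : Sub Γ Δ) : Sub (τ :: Γ) Δ
  | _, .here => a
  | _, .there x => s _ x

theorem Sub.ext_cons {Γ Δ : Ctx} {τ : Ty} {s t : Sub (τ :: Γ) Δ} (h : s τ .here = t τ .here)
    (h' : ∀ σ (x : Var Γ σ), s σ (.there x) = t σ (.there x)) : s = t := by
  funext σ x
  cases x with
  | here => exact h
  | there x => exact h' _ x

theorem Sub.ext_cons₂ {Γ Δ : Ctx} {τ ρ : Ty} {s t : Sub (τ :: ρ :: Γ) Δ}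
    (h : s τ .here = t τ .here) (h' : s ρ (.there .here) = t ρ (.there .here))
    (h'' : ∀ σ (x : Var Γ σ), s σ (.there (.there x)) = t σ (.there (.there x))) : s = t :=
  Sub.ext_cons h fun _ x => match x with
    | .here => h'
    | .there x => h'' _ x

theorem Tm.rename_eq_subst {Γ Δ : Ctx} (r : Ren Γ Δ) {σ : Ty} (a : Tm Γ σ) :
    a.rename r = a.subst (Sub.ofRen r) := by
  induction a with
  | var x => rfl
  | const c => rfl
  | app f a hf ha => simp only [Tm.rename, Tm.subst, hf, ha]

theorem Tm.subst_subst {Γ Δ Θ : Ctx} (s : Sub Γ Δ) (t : Sub Δ Θ) {σ : Ty} (a : Tm Γ σ) :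
    (a.subst s).subst t = a.subst (s.comp t) := by
  induction a with
  | var x => rfl
  | const c => rfl
  | app f a hf ha => simp only [Tm.subst, hf, ha]

theorem Tm.subst_var {Γ : Ctx} {σ : Ty} (a : Tm Γ σ) : a.subst (fun _ x => .var x) = a := by
  induction a with
  | var x => rfl
  | const c => rfl
  | app f a hf ha => simp only [Tm.subst, hf, ha]

theorem Tm.weaken_subst_lift {Γ Δ : Ctx} (s : Sub Γ Δ) (τ : Ty) {σ : Ty} (a : Tm Γ σ) :
    (a.weaken τ).subst (s.lift τ) = (a.subst s).weaken τ := by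
  simp only [Tm.weaken, Tm.rename_eq_subst, Tm.subst_subst]
  congr 1
  funext ρ x
  exact Tm.rename_eq_subst _ _

theorem Tm.weaken_subst_cons {Γ Δ : Ctx} (s : Sub Γ Δ) {τ : Ty} (b : Tm Δ τ) {σ : Ty}
    (a : Tm Γ σ) : (a.weaken τ).subst (Sub.cons b s) = a.subst s := by
  simp only [Tm.weaken, Tm.rename_eq_subst, Tm.subst_subst]
  rfl

theorem Tm.weaken_subst_single {Γ : Ctx} {τ : Ty} (b : Tm Γ τ) {σ : Ty}
    (a : Tm Γ σ) : (a.weaken τ).subst (Sub.single b) = a := by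
  simp only [Tm.weaken, Tm.rename_eq_subst, Tm.subst_subst]
  exact Tm.subst_var a

theorem Sub.lift_ofRen {Γ Δ : Ctx} (r : Ren Γ Δ) (τ : Ty) :
    (Sub.ofRen r).lift τ = Sub.ofRen (r.lift τ) :=
  Sub.ext_cons rfl fun _ _ => rfl

theorem Sub.lift_comp {Γ Δ Θ : Ctx} (s : Sub Γ Δ) (t : Sub Δ Θ) (τ : Ty) :
    (s.lift τ).comp (t.lift τ) = (s.comp t).lift τ :=
  Sub.ext_cons rfl fun _ x => Tm.weaken_subst_lift t τ (s _ x)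

theorem Sub.lift_var {Γ : Ctx} (τ : Ty) :
    Sub.lift (Γ := Γ) (Δ := Γ) (fun _ x => .var x) τ = fun _ x => .var x :=
  Sub.ext_cons rfl fun _ _ => rfl

theorem Formula.rename_eq_subst {Γ Δ : Ctx} (r : Ren Γ Δ) (A : Formula Γ) :
    A.rename r = A.subst (Sub.ofRen r) := by
  induction A generalizing Δ with
  | bot => rfl
  | eq a b => simp only [Formula.rename, Formula.subst, Tm.rename_eq_subst]
  | st a => simp only [Formula.rename, Formula.subst, Tm.rename_eq_subst]
  | and A B hA hB => simp only [Formula.rename, Formula.subst, hA, hB]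
  | or A B hA hB => simp only [Formula.rename, Formula.subst, hA, hB]
  | imp A B hA hB => simp only [Formula.rename, Formula.subst, hA, hB]
  | all σ A hA => simp only [Formula.rename, Formula.subst, hA, Sub.lift_ofRen]
  | ex σ A hA => simp only [Formula.rename, Formula.subst, hA, Sub.lift_ofRen]
  | allSt σ A hA => simp only [Formula.rename, Formula.subst, hA, Sub.lift_ofRen]
  | exSt σ A hA => simp only [Formula.rename, Formula.subst, hA, Sub.lift_ofRen]

theorem Formula.subst_subst {Γ Δ Θ : Ctx} (s : Sub Γ Δ) (t : Sub Δ Θ) (A : Formula Γ) :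
    (A.subst s).subst t = A.subst (s.comp t) := by
  induction A generalizing Δ Θ with
  | bot => rfl
  | eq a b => simp only [Formula.subst, Tm.subst_subst]
  | st a => simp only [Formula.subst, Tm.subst_subst]
  | and A B hA hB => simp only [Formula.subst, hA, hB]
  | or A B hA hB => simp only [Formula.subst, hA, hB]
  | imp A B hA hB => simp only [Formula.subst, hA, hB]
  | all σ A hA => simp only [Formula.subst, hA, Sub.lift_comp]
  | ex σ A hA => simp only [Formula.subst, hA, Sub.lift_comp]
  | allSt σ A hA => simp only [Formula.subst, hA, Sub.lift_comp]
  | exSt σ A hA => simp only [Formula.subst, hA, Sub.lift_comp]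

theorem Formula.subst_var {Γ : Ctx} (A : Formula Γ) : A.subst (fun _ x => .var x) = A := by
  induction A with
  | bot => rfl
  | eq a b => simp only [Formula.subst, Tm.subst_var]
  | st a => simp only [Formula.subst, Tm.subst_var]
  | and A B hA hB => simp only [Formula.subst, hA, hB]
  | or A B hA hB => simp only [Formula.subst, hA, hB]
  | imp A B hA hB => simp only [Formula.subst, hA, hB]
  | all σ A hA => simp only [Formula.subst, Sub.lift_var, hA]
  | ex σ A hA => simp only [Formula.subst, Sub.lift_var, hA]
  | allSt σ A hA => simp only [Formula.subst, Sub.lift_var, hA]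
  | exSt σ A hA => simp only [Formula.subst, Sub.lift_var, hA]

theorem Formula.weaken_subst_lift {Γ Δ : Ctx} (s : Sub Γ Δ) (τ : Ty) (A : Formula Γ) :
    (A.weaken τ).subst (s.lift τ) = (A.subst s).weaken τ := by
  simp only [Formula.weaken, Formula.rename_eq_subst, Formula.subst_subst]
  congr 1
  funext ρ x
  exact Tm.rename_eq_subst _ _

theorem Formula.weaken_subst_single {Γ : Ctx} {τ : Ty} (b : Tm Γ τ) (A : Formula Γ) :
    (A.weaken τ).subst (Sub.single b) = A := by
  simp only [Formula.weaken, Formula.rename_eq_subst, Formula.subst_subst]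
  exact Formula.subst_var A

theorem Sub.lift_comp_single {Γ Δ : Ctx} (s : Sub Γ Δ) {τ : Ty} (a : Tm Δ τ) :
    (s.lift τ).comp (Sub.single a) = Sub.cons a s :=
  Sub.ext_cons rfl fun _ x => Tm.weaken_subst_single a (s _ x)

theorem Formula.inst_subst {Γ Δ : Ctx} (s : Sub Γ Δ) {τ : Ty} (A : Formula (τ :: Γ))
    (a : Tm Γ τ) : (A.inst a).subst s = (A.subst (s.lift τ)).inst (a.subst s) := by
  simp only [Formula.inst, Formula.subst_subst]
  congr 1
  refine Sub.ext_cons rfl fun _ x => ?_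
  exact (Tm.weaken_subst_single _ _).symm

/-! Substitution in the defined terms and formulas -/

theorem Tm.len_subst {Γ Δ : Ctx} (s : Sub Γ Δ) {σ : Ty} (a : Tm Γ (.seq σ)) :
    (len a).subst s = len (a.subst s) := rfl

theorem Tm.add_subst {Γ Δ : Ctx} (s : Sub Γ Δ) (a b : Tm Γ .nat) :
    (add a b).subst s = add (a.subst s) (b.subst s) := rfl

theorem Tm.empty_subst {Γ Δ : Ctx} (s : Sub Γ Δ) (σ : Ty) : (empty σ).subst s = empty σ := by
  induction σ with
  | nat => rfl
  | arrow σ τ _ ih => simp only [empty, Tm.subst, ih]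
  | seq σ => rfl

/-- Defined abstraction does not commute with substitution syntactically: a variable is abstracted
by one projector, whereas an application put in its place is abstracted componentwise. Here only
constants occur, so the identity survives; `get` depends on it. -/
theorem Tm.lam_empty_subst {Γ Δ : Ctx} (s : Sub Γ Δ) (τ σ : Ty) :
    (lam (σ := τ) (empty σ)).subst s = lam (empty σ) := by
  induction σ with
  | nat => rfl
  | arrow σ τ _ ih => simp only [empty, Tm.lam, Tm.subst, ih]
  | seq σ => rfl

theorem Tm.get_subst {Γ Δ : Ctx} (s : Sub Γ Δ) {σ : Ty} (a : Tm Γ (.seq σ)) (i : Tm Γ .nat) :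
    (get a i).subst s = get (a.subst s) (i.subst s) := by
  simp only [get, listRec, Tm.subst, Tm.lam_empty_subst]
  rfl

theorem Formula.lt_subst {Γ Δ : Ctx} (s : Sub Γ Δ) (m n : Tm Γ .nat) :
    (Formula.lt m n).subst s = Formula.lt (m.subst s) (n.subst s) := by
  simp only [Formula.lt, Formula.subst, Tm.add_subst, Tm.weaken_subst_lift]
  rfl

theorem Formula.mem_subst {Γ Δ : Ctx} (s : Sub Γ Δ) {σ : Ty} (a : Tm Γ σ) (b : Tm Γ (.seq σ)) :
    (Formula.mem a b).subst s = Formula.mem (a.subst s) (b.subst s) := by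
  simp only [Formula.mem, Formula.subst, Formula.lt_subst, Tm.len_subst, Tm.get_subst,
    Tm.weaken_subst_lift]
  rfl

theorem Formula.hyper_subst {Γ Δ : Ctx} (s : Sub Γ Δ) {σ : Ty} (b : Tm Γ (.seq σ)) :
    (Formula.hyper b).subst s = Formula.hyper (b.subst s) := by
  simp only [Formula.hyper, Formula.subst, Formula.mem_subst, Tm.weaken_subst_lift]
  rfl

theorem Formula.Internal.subst {Γ Δ : Ctx} {A : Formula Γ} (h : A.Internal) (s : Sub Γ Δ) :
    (A.subst s).Internal := by
  induction A generalizing Δ with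
  | bot => trivial
  | eq a b => trivial
  | st a => exact h
  | and A B hA hB => exact ⟨hA h.1 s, hB h.2 s⟩
  | or A B hA hB => exact ⟨hA h.1 s, hB h.2 s⟩
  | imp A B hA hB => exact ⟨hA h.1 s, hB h.2 s⟩
  | all σ A hA => exact hA h _
  | ex σ A hA => exact hA h _
  | allSt σ A hA => exact h
  | exSt σ A hA => exact h

theorem Formula.OrFree.subst {Γ Δ : Ctx} {A : Formula Γ} (h : A.OrFree) (s : Sub Γ Δ) :
    (A.subst s).OrFree := by
  induction A generalizing Δ with
  | bot => trivial
  | eq a b => trivial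
  | st a => trivial
  | and A B hA hB => exact ⟨hA h.1 s, hB h.2 s⟩
  | or A B hA hB => exact h
  | imp A B hA hB => exact ⟨hA h.1 s, hB h.2 s⟩
  | all σ A hA => exact hA h _
  | ex σ A hA => exact hA h _
  | allSt σ A hA => exact hA h _
  | exSt σ A hA => exact hA h _

theorem Tm.ofClosed_subst {Γ Δ : Ctx} (s : Sub Γ Δ) {σ : Ty} (a : Tm [] σ) :
    (a.ofClosed Γ).subst s = a.ofClosed Δ := by
  simp only [Tm.ofClosed, Tm.rename_eq_subst, Tm.subst_subst]
  congr 1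
  funext ρ x
  cases x

/-! ### The axioms are closed under substitution -/

theorem Formula.subst_succ_subst {Γ Δ : Ctx} (s : Sub Γ Δ) (A : Formula (.nat :: Γ)) :
    (A.subst (Sub.succ Γ)).subst (s.lift .nat) = (A.subst (s.lift .nat)).subst (Sub.succ Δ) := by
  simp only [Formula.subst_subst]
  congr 1
  refine Sub.ext_cons rfl fun _ x => ?_
  simp only [Sub.comp, Sub.succ, Sub.lift, Tm.subst, Tm.weaken, Tm.rename_eq_subst,
    Tm.subst_subst]
  rfl

theorem Formula.subst_choice_subst {Γ Δ : Ctx} (s : Sub Γ Δ) {σ τ : Ty}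
    (A : Formula (τ :: σ :: Γ)) :
    (A.subst (Sub.choice Γ σ τ)).subst ((s.lift (.arrow σ τ)).lift σ) =
      (A.subst ((s.lift σ).lift τ)).subst (Sub.choice Δ σ τ) := by
  simp only [Formula.subst_subst]
  congr 1
  refine Sub.ext_cons₂ rfl rfl fun _ x => ?_
  simp only [Sub.comp, Sub.choice, Sub.lift, Tm.subst, Tm.weaken, Tm.rename_eq_subst,
    Tm.subst_subst]
  rfl

theorem Formula.rename_swap_subst {Γ Δ : Ctx} (s : Sub Γ Δ) {σ τ : Ty}
    (A : Formula (σ :: τ :: Γ)) :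
    (A.rename (Ren.swap Γ σ τ)).subst ((s.lift σ).lift τ) =
      (A.subst ((s.lift τ).lift σ)).rename (Ren.swap Δ σ τ) := by
  simp only [Formula.rename_eq_subst, Formula.subst_subst]
  congr 1
  refine Sub.ext_cons₂ rfl rfl fun _ x => ?_
  simp only [Sub.comp, Sub.ofRen, Ren.swap, Sub.lift, Tm.subst, Tm.weaken, Tm.rename_eq_subst,
    Tm.subst_subst]
  rfl

theorem AxEHA.subst {Γ Δ : Ctx} {A : Formula Γ} (h : AxEHA A) (s : Sub Γ Δ) :
    AxEHA (A.subst s) := by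
  cases h with
  | eq_refl a => exact .eq_refl _
  | eq_symm a b => exact .eq_symm _ _
  | eq_trans a b c => exact .eq_trans _ _ _
  | eq_app f g a b => exact .eq_app _ _ _ _
  | extensionality f g =>
    simp only [Formula.subst, Tm.subst, Tm.weaken_subst_lift]
    exact .extensionality _ _
  | succ_ne_zero n => exact .succ_ne_zero _
  | succ_inj m n => exact .succ_inj _ _
  | proj a b => exact .proj _ _
  | comb f g a => exact .comb _ _ _
  | natRec_zero a f => exact .natRec_zero _ _
  | natRec_succ a f n => exact .natRec_succ _ _ _
  | listRec_nil a f => exact .listRec_nil _ _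
  | listRec_cons a f c l => exact .listRec_cons _ _ _ _
  | seq l =>
    simp only [Formula.subst, Tm.weaken_subst_lift]
    exact .seq _
  | induction φ hi ho =>
    simp only [Formula.subst, Formula.inst_subst, Formula.subst_succ_subst]
    exact .induction _ (hi.subst _) (ho.subst _)

theorem AxSt.subst {Γ Δ : Ctx} {A : Formula Γ} (h : AxSt A) (s : Sub Γ Δ) :
    AxSt (A.subst s) := by
  cases h with
  | allSt_def Φ => exact .allSt_def _
  | exSt_def Φ => exact .exSt_def _
  | st_eq a b => exact .st_eq _ _
  | st_closed a =>
    simp only [Formula.subst, Tm.ofClosed_subst]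
    exact .st_closed _
  | st_app f a => exact .st_app _ _
  | induction Φ =>
    simp only [Formula.subst, Formula.inst_subst, Formula.subst_succ_subst]
    exact .induction _

theorem AxChar.subst {Γ Δ : Ctx} {A : Formula Γ} (h : AxChar A) (s : Sub Γ Δ) :
    AxChar (A.subst s) := by
  cases h with
  | overspill φ hi ho =>
    simp only [Formula.subst, Formula.hyper_subst]
    exact .overspill _ (hi.subst _) (ho.subst _)
  | underspill φ hi ho =>
    simp only [Formula.subst, Formula.hyper_subst]
    exact .underspill _ (hi.subst _) (ho.subst _)
  | uniformity Φ =>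
    simp only [Formula.subst, Formula.rename_swap_subst]
    exact .uniformity _
  | choice Φ =>
    simp only [Formula.subst, Formula.subst_choice_subst]
    exact .choice _
  | independence φ hi ho Ψ =>
    simp only [Formula.subst, Formula.weaken_subst_lift]
    exact .independence _ (hi.subst _) (ho.subst _) _

theorem H_subst {Γ Δ : Ctx} {A : Formula Γ} (h : A ∈ H Γ) (s : Sub Γ Δ) :
    A.subst s ∈ H Δ :=
  h.imp (fun h => h.subst s) (Or.imp (fun h => h.subst s) fun h => h.subst s)

/-! ### Propositional derivations -/

namespace Provable

variable {Γ : Ctx} {A B C E : Formula Γ}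

theorem imp_intro (A : Formula Γ) (h : Provable H B) : Provable H (A →ᶠ B) :=
  mp (imp_k _ _) h

theorem mp_under (h : Provable H (A →ᶠ B →ᶠ C)) (h' : Provable H (A →ᶠ B)) :
    Provable H (A →ᶠ C) :=
  mp (mp (imp_s _ _ _) h) h'

theorem imp_refl (A : Formula Γ) : Provable H (A →ᶠ A) :=
  mp_under (imp_k A (A →ᶠ A)) (imp_k A A)

theorem imp_trans (h : Provable H (A →ᶠ B)) (h' : Provable H (B →ᶠ C)) : Provable H (A →ᶠ C) :=
  mp_under (imp_intro A h') h

theorem and_intro_under (h : Provable H (A →ᶠ B)) (h' : Provable H (A →ᶠ C)) :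
    Provable H (A →ᶠ B ∧ᶠ C) :=
  mp_under (imp_trans h (and_intro B C)) h'

theorem curry (h : Provable H (A ∧ᶠ B →ᶠ C)) : Provable H (A →ᶠ B →ᶠ C) := by
  have h1 : Provable H (A →ᶠ (B →ᶠ A ∧ᶠ B) →ᶠ B →ᶠ C) :=
    imp_intro A (mp (imp_s _ _ _) (imp_intro B h))
  exact mp_under h1 (and_intro A B)

theorem swap (h : Provable H (A →ᶠ B →ᶠ C)) : Provable H (B →ᶠ A →ᶠ C) :=
  curry (mp_under (imp_trans (and_right B A) h) (and_left B A))

/-- A formula not depending on the innermost variable may be detached from it. -/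
theorem of_weaken {σ : Ty} (h : Provable H (A.weaken σ)) : Provable H A := by
  -- The rule for `∀` needs an antecedent, so a trivially provable one is supplied. The vacuous
  -- quantifier is then removed at the closed term `empty σ`, which exists because every type is
  -- inhabited.
  have h1 : Provable H ((Formula.bot →ᶠ .bot : Formula Γ) →ᶠ .all σ (A.weaken σ)) :=
    all_rule (imp_intro _ h)
  have h2 := mp (all_elim (A.weaken σ) (Tm.empty σ)) (mp h1 (imp_refl _))
  rwa [Formula.inst, Formula.weaken_subst_single] at h2

end Provable

/-- Used whenever a quantifier is opened at a fresh variable: the instance obtained is the original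
open formula. -/
theorem Formula.subst_var_lift_inst {Γ : Ctx} {σ : Ty} (A : Formula (σ :: Γ)) :
    (A.subst ((Sub.ofRen (Ren.shift Γ σ)).lift σ)).inst v0 = A := by
  rw [Formula.inst, Formula.subst_subst]
  conv_rhs => rw [← Formula.subst_var A]
  congr 1
  exact Sub.ext_cons rfl fun _ _ => rfl

/-- The axioms are schematic in open terms, and the quantifier rules are respected because the
substitution is lifted over the eigenvariable. -/
theorem Provable.subst {Γ Δ : Ctx} {A : Formula Γ} (h : Provable H A) (s : Sub Γ Δ) :
    Provable H (A.subst s) := by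
  induction h generalizing Δ with
  | ax h => exact .ax (H_subst h s)
  | mp _ _ ih ih' => exact .mp (ih s) (ih' s)
  | imp_k A B => exact .imp_k _ _
  | imp_s A B C => exact .imp_s _ _ _
  | bot_elim A => exact .bot_elim _
  | and_intro A B => exact .and_intro _ _
  | and_left A B => exact .and_left _ _
  | and_right A B => exact .and_right _ _
  | or_left A B => exact .or_left _ _
  | or_right A B => exact .or_right _ _
  | or_elim A B C => exact .or_elim _ _ _
  | all_elim A a =>
    simp only [Formula.subst, Formula.inst_subst]
    exact .all_elim _ _
  | ex_intro A a =>
    simp only [Formula.subst, Formula.inst_subst]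
    exact .ex_intro _ _
  | all_rule _ ih =>
    have h1 := ih (s.lift _)
    simp only [Formula.subst, Formula.weaken_subst_lift] at h1
    exact .all_rule h1
  | ex_rule _ ih =>
    have h1 := ih (s.lift _)
    simp only [Formula.subst, Formula.weaken_subst_lift] at h1
    exact .ex_rule h1

theorem Provable.of_all {Γ : Ctx} {σ : Ty} {A : Formula (σ :: Γ)}
    (h : Provable H (Formula.all σ A)) : Provable H A := by
  have h1 := Provable.mp (.all_elim _ v0) (h.subst (Sub.ofRen (Ren.shift Γ σ)))
  rwa [Formula.subst_var_lift_inst] at h1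

end UDN

/-! ### The generic model: stages, forcing by provability, elements modulo provable equality. -/

namespace UDN
open Tm Filter

/-! ### Stages: an exhausting sequence of contexts -/

/-- An injective coding of the types by natural numbers. -/
def Ty.code : Ty → ℕ
  | .nat => 0
  | .arrow σ τ => 2 * Nat.pair σ.code τ.code + 1
  | .seq σ => 2 * σ.code + 2

theorem Ty.code_injective : Function.Injective Ty.code := by
  intro σ
  induction σ with
  | nat => intro τ h; cases τ <;> simp only [Ty.code] at h <;> first | rfl | omega
  | arrow σ τ hσ hτ =>
    intro ρ h
    cases ρ with
    | nat => simp only [Ty.code] at h; omega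
    | arrow a b =>
      simp only [Ty.code] at h
      obtain ⟨h1, h2⟩ := Nat.pair_eq_pair.1
        (show Nat.pair σ.code τ.code = Nat.pair a.code b.code by omega)
      rw [hσ h1, hτ h2]
    | seq a => simp only [Ty.code] at h; omega
  | seq σ hσ =>
    intro ρ h
    cases ρ with
    | nat => simp only [Ty.code] at h; omega
    | arrow a b => simp only [Ty.code] at h; omega
    | seq a => simp only [Ty.code] at h; rw [hσ (show σ.code = a.code by omega)]

instance : Nonempty Ty := ⟨.nat⟩

theorem exists_stageTy : ∃ e : ℕ → Ty, ∀ σ n, ∃ m, n ≤ m ∧ e m = σ := by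
  -- Decode the second component of `m`: the index `Nat.pair n σ.code` is at least `n` and decodes
  -- to `σ`.
  refine ⟨fun m => Function.invFun Ty.code m.unpair.2, fun σ n => ⟨Nat.pair n σ.code, ?_, ?_⟩⟩
  · exact Nat.left_le_pair _ _
  · simp only [Nat.unpair_pair]
    exact Function.leftInverse_invFun Ty.code_injective σ

/-- The type of the variable that is added at stage `n`; every type is added infinitely often. -/
noncomputable def stageTy : ℕ → Ty := exists_stageTy.choose

theorem exists_stageTy_eq (σ : Ty) (n : ℕ) : ∃ m, n ≤ m ∧ stageTy m = σ :=
  exists_stageTy.choose_spec σ n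

/-- The context of stage `n`. -/
noncomputable def stage : ℕ → Ctx
  | 0 => []
  | n + 1 => stageTy n :: stage n

/-- The inclusion of a stage into the next one. -/
noncomputable def Tm.up {n : ℕ} {σ : Ty} (a : Tm (stage n) σ) : Tm (stage (n + 1)) σ :=
  a.weaken (stageTy n)

noncomputable def Formula.up {n : ℕ} (A : Formula (stage n)) : Formula (stage (n + 1)) :=
  A.weaken (stageTy n)

/-- The variable added at stage `n`. -/
noncomputable def stageVar (n : ℕ) : Tm (stage (n + 1)) (stageTy n) :=
  (v0 : Tm (stageTy n :: stage n) _)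

noncomputable def Sub.up (n : ℕ) : Sub (stage n) (stage (n + 1)) :=
  Sub.ofRen (Ren.shift (stage n) (stageTy n))

theorem Tm.up_eq_subst {n : ℕ} {σ : Ty} (a : Tm (stage n) σ) : a.up = a.subst (Sub.up n) :=
  Tm.rename_eq_subst _ _

theorem Formula.up_eq_subst {n : ℕ} (A : Formula (stage n)) : A.up = A.subst (Sub.up n) :=
  Formula.rename_eq_subst _ _

/-- Terms in the variables of all stages: families that are eventually constant up to weakening. -/
structure RawTm (σ : Ty) where
  val : ∀ n, Tm (stage n) σ
  compat : ∀ᶠ n in atTop, val (n + 1) = (val n).up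

/-- Worlds: formulas in the variables of all stages. -/
structure World where
  val : ∀ n, Formula (stage n)
  compat : ∀ᶠ n in atTop, val (n + 1) = (val n).up

abbrev RawEnv (Γ : Ctx) : Type := ∀ σ : Ty, Var Γ σ → RawTm σ

def RawEnv.at {Γ : Ctx} (r : RawEnv Γ) (n : ℕ) : Sub Γ (stage n) := fun σ x => (r σ x).val n

def RawEnv.cons {Γ : Ctx} {τ : Ty} (d : RawTm τ) (r : RawEnv Γ) : RawEnv (τ :: Γ)
  | _, .here => d
  | _, .there x => r _ x

theorem RawEnv.cons_at {Γ : Ctx} {τ : Ty} (d : RawTm τ) (r : RawEnv Γ) (n : ℕ) :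
    (RawEnv.cons d r).at n = Sub.cons (d.val n) (r.at n) :=
  Sub.ext_cons rfl fun _ _ => rfl

/-- A context is finite, so the thresholds beyond which the individual families are constant have a
common bound. -/
theorem RawEnv.compat {Γ : Ctx} (r : RawEnv Γ) : ∀ᶠ n in atTop,
    r.at (n + 1) = (r.at n).comp (Sub.up n) := by
  induction Γ with
  | nil => exact .of_forall fun n => by funext σ x; cases x
  | cons τ Γ ih =>
    filter_upwards [ih fun σ x => r σ (.there x), (r τ .here).compat] with n h1 h2
    exact Sub.ext_cons (h2.trans (Tm.up_eq_subst _)) fun σ x => congrFun (congrFun h1 σ) x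

theorem Formula.subst_at_succ {Γ : Ctx} (A : Formula Γ) (r : RawEnv Γ) : ∀ᶠ n in atTop,
    A.subst (r.at (n + 1)) = (A.subst (r.at n)).up := by
  filter_upwards [r.compat] with n h
  rw [h, Formula.up_eq_subst, Formula.subst_subst]

theorem Formula.subst_lift_at_succ {Γ : Ctx} {τ : Ty} (A : Formula (τ :: Γ)) (r : RawEnv Γ) :
    ∀ᶠ n in atTop,
      A.subst ((r.at (n + 1)).lift τ) = (A.subst ((r.at n).lift τ)).subst ((Sub.up n).lift τ) := by
  filter_upwards [r.compat] with n h
  rw [h, Formula.subst_subst, Sub.lift_comp]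

/-- The value of a term. -/
noncomputable def RawTm.eval {Γ : Ctx} {σ : Ty} (t : Tm Γ σ) (r : RawEnv Γ) : RawTm σ where
  val n := t.subst (r.at n)
  compat := by
    filter_upwards [r.compat] with n h
    rw [h, Tm.up_eq_subst, Tm.subst_subst]

/-- The family of a variable added at stage `m`. -/
noncomputable def freshVal (m : ℕ) : ∀ n, Tm (stage n) (stageTy m)
  | 0 => Tm.empty _
  | n + 1 => if h : n = m then h ▸ stageVar n else (freshVal m n).up

theorem freshVal_self (m : ℕ) : freshVal m (m + 1) = stageVar m := by
  simp [freshVal]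

theorem freshVal_succ {m n : ℕ} (h : n ≠ m) : freshVal m (n + 1) = (freshVal m n).up := by
  rw [freshVal, dif_neg h]

noncomputable def fresh (m : ℕ) : RawTm (stageTy m) where
  val := freshVal m
  compat := by
    filter_upwards [eventually_gt_atTop m] with n h
    exact freshVal_succ (Nat.ne_of_gt h)

/-- Each later formula is a weakening of the previous one, so the added variables can be discharged
one at a time. This brings a derivation found at a late stage back to an earlier one. -/
theorem provable_of_le {G : ∀ n, Formula (stage n)} {m n : ℕ} (hmn : m ≤ n)
    (hc : ∀ k, m ≤ k → G (k + 1) = (G k).up) (h : Provable H (G n)) :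
    Provable H (G m) := by
  induction n, hmn using Nat.le_induction with
  | base => exact h
  | succ n hn ih =>
    rw [hc n hn] at h
    exact ih h.of_weaken

theorem Formula.inst_up {n : ℕ} {τ : Ty} (A : Formula (τ :: stage n)) (a : Tm (stage n) τ) :
    (A.inst a).up = (A.subst ((Sub.up n).lift τ)).inst a.up := by
  rw [Formula.up_eq_subst, Formula.inst_subst, Tm.up_eq_subst]

/-- Generalisation over a variable of a later stage. -/
theorem eventually_provable_all {σ : Ty} (w : World) {B : ∀ n, Formula (σ :: stage n)}
    (hB : ∀ᶠ n in atTop, B (n + 1) = (B n).subst ((Sub.up n).lift σ))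
    (h : ∀ d : RawTm σ, ∀ᶠ n in atTop, Provable H (w.val n →ᶠ (B n).inst (d.val n))) :
    ∀ᶠ n in atTop, Provable H (w.val n →ᶠ .all σ (B n)) := by
  obtain ⟨N, hN⟩ := eventually_atTop.1 (w.compat.and hB)
  refine eventually_atTop.2 ⟨N, fun n hn => ?_⟩
  obtain ⟨m, hm, rfl⟩ := exists_stageTy_eq σ n
  refine provable_of_le (G := fun n => w.val n →ᶠ .all _ (B n)) hm
    (fun k hk => ?_) (Provable.all_rule ?_)
  · obtain ⟨h1, h2⟩ := hN k (hn.trans hk)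
    rw [h1, h2, Formula.up_eq_subst, Formula.up_eq_subst]
    rfl
  · obtain ⟨M, hM⟩ := eventually_atTop.1 (h (fresh m))
    have hc := provable_of_le (G := fun n => w.val n →ᶠ (B n).inst ((fresh m).val n))
      (m := m + 1) (n := max M (m + 1)) (le_max_right _ _) (fun k hk => ?_)
      (hM _ (le_max_left _ _))
    · obtain ⟨h1, h2⟩ := hN m (hn.trans hm)
      simp only [h1, h2] at hc
      have h3 : ((B m).subst ((Sub.up m).lift (stageTy m))).inst ((fresh m).val (m + 1)) = B m := by
        change Formula.inst _ (freshVal m (m + 1)) = _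
        rw [freshVal_self]
        exact Formula.subst_var_lift_inst _
      rw [h3] at hc
      exact hc
    · obtain ⟨h1, h2⟩ := hN k (by omega)
      have h3 : (fresh m).val (k + 1) = ((fresh m).val k).up := freshVal_succ (by omega)
      change _ = Formula.up (w.val k) →ᶠ Formula.up _
      rw [h1, h2, h3, Formula.inst_up]

/-! ### Forcing, for environments of representatives -/

/-- Only the tail in `n` counts, since worlds and elements are coherent only from some stage on. -/
def RawForces {Γ : Ctx} (w : World) (A : Formula Γ) (r : RawEnv Γ) : Prop :=
  ∀ᶠ n in atTop, Provable H (w.val n →ᶠ A.subst (r.at n))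

instance : Preorder World where
  le v w := ∀ᶠ n in atTop, Provable H (v.val n →ᶠ w.val n)
  le_refl w := .of_forall fun _ => Provable.imp_refl _
  le_trans u v w huv hvw := by
    filter_upwards [huv, hvw] with n h1 h2
    exact h1.imp_trans h2

/-- The conjunction of a world and a formula. -/
noncomputable def World.extend {Γ : Ctx} (w : World) (A : Formula Γ) (r : RawEnv Γ) : World where
  val n := w.val n ∧ᶠ A.subst (r.at n)
  compat := by
    filter_upwards [w.compat, A.subst_at_succ r] with n h1 h2
    rw [h1, h2]
    rfl

theorem World.extend_le {Γ : Ctx} (w : World) (A : Formula Γ) (r : RawEnv Γ) :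
    w.extend A r ≤ w :=
  .of_forall fun _ => .and_left _ _

namespace RawForces

variable {Γ Δ : Ctx} {w v : World} {r : RawEnv Γ} {r' : RawEnv Δ} {A B : Formula Γ}
  {C : Formula Δ}

theorem extend (w : World) (A : Formula Γ) (r : RawEnv Γ) : RawForces (w.extend A r) A r :=
  .of_forall fun _ => .and_right _ _

theorem mono (h : RawForces w A r) (hv : v ≤ w) : RawForces v A r := by
  filter_upwards [h, hv] with n h1 h2
  exact h2.imp_trans h1

theorem of_provable (h : ∀ {Θ : Ctx} (s : Sub Γ Θ), Provable H (A.subst s)) : RawForces w A r :=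
  .of_forall fun _ => (h _).imp_intro _

theorem of_mem (h : A ∈ H Γ) : RawForces w A r :=
  of_provable fun s => .ax (H_subst h s)

theorem mp (h : RawForces w (A →ᶠ B) r) (h' : RawForces w A r) : RawForces w B r := by
  filter_upwards [h, h'] with n h1 h2
  exact h1.mp_under h2

/-- The world `w ∧ A` is the generic extension forcing `A`; from it the implication is recovered by
currying. -/
theorem imp_iff : RawForces w (A →ᶠ B) r ↔
    ∀ v, v ≤ w → RawForces v A r → RawForces v B r := by
  refine ⟨fun h v hv hA => (h.mono hv).mp hA, fun h => ?_⟩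
  filter_upwards [h _ (w.extend_le A r) (extend w A r)] with n h1
  exact h1.curry

theorem and_iff : RawForces w (A ∧ᶠ B) r ↔ RawForces w A r ∧ RawForces w B r := by
  refine ⟨fun h => ⟨?_, ?_⟩, fun h => ?_⟩
  · filter_upwards [h] with n h1
    exact h1.imp_trans (.and_left _ _)
  · filter_upwards [h] with n h1
    exact h1.imp_trans (.and_right _ _)
  · filter_upwards [h.1, h.2] with n h1 h2
    exact h1.and_intro_under h2

theorem bot_elim (h : RawForces w (.bot : Formula Γ) r) : RawForces w C r' := by
  filter_upwards [h] with n h1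
  exact h1.imp_trans (.bot_elim _)

theorem or_left (B : Formula Γ) (h : RawForces w A r) : RawForces w (A.or B) r := by
  filter_upwards [h] with n h1
  exact h1.imp_trans (.or_left _ _)

theorem or_right (A : Formula Γ) (h : RawForces w B r) : RawForces w (A.or B) r := by
  filter_upwards [h] with n h1
  exact h1.imp_trans (.or_right _ _)

/-- A world that forces a disjunction need not force a disjunct, so only elimination into a forced
conclusion is available. Testing the two branches at `w ∧ A` and `w ∧ B` suffices. -/
theorem or_elim (h : RawForces w (A.or B) r)
    (hA : ∀ v, v ≤ w → RawForces v A r → RawForces v C r')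
    (hB : ∀ v, v ≤ w → RawForces v B r → RawForces v C r') : RawForces w C r' := by
  filter_upwards [h, hA _ (w.extend_le A r) (extend w A r),
    hB _ (w.extend_le B r) (extend w B r)] with n h1 h2 h3
  have h4 := Provable.mp (.mp (.or_elim _ _ _) h2.curry.swap) h3.curry.swap
  exact Provable.mp_under (h1.imp_trans h4) (.imp_refl _)

theorem all_iff {σ : Ty} {A : Formula (σ :: Γ)} : RawForces w (.all σ A) r ↔
    ∀ d, RawForces w A (RawEnv.cons d r) := by
  refine ⟨fun h d => ?_, fun h => ?_⟩
  · filter_upwards [h] with n h1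
    have h2 := h1.imp_trans (.all_elim _ (d.val n))
    rwa [Formula.inst, Formula.subst_subst, Sub.lift_comp_single, ← RawEnv.cons_at] at h2
  · refine eventually_provable_all w (A.subst_lift_at_succ r) fun d => ?_
    filter_upwards [h d] with n h1
    rwa [Formula.inst, Formula.subst_subst, Sub.lift_comp_single, ← RawEnv.cons_at]

theorem ex_intro {σ : Ty} {A : Formula (σ :: Γ)} (d : RawTm σ)
    (h : RawForces w A (RawEnv.cons d r)) : RawForces w (.ex σ A) r := by
  filter_upwards [h] with n h1
  refine h1.imp_trans ?_
  have h2 := Provable.ex_intro (T := H) (A.subst ((r.at n).lift σ)) (d.val n)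
  rwa [Formula.inst, Formula.subst_subst, Sub.lift_comp_single, ← RawEnv.cons_at] at h2

theorem ex_elim {σ : Ty} {A : Formula (σ :: Γ)} (h : RawForces w (.ex σ A) r)
    (h' : ∀ v, v ≤ w → ∀ d, RawForces v A (RawEnv.cons d r) → RawForces v C r') :
    RawForces w C r' := by
  -- No witness can be read off from `w → ∃ x A`. Instead `A(d) → C` is derived for every element
  -- `d`, adding `A(d)` to the world, and is generalised through a fresh variable before the rule
  -- for `∃` applies.
  have h1 : ∀ᶠ n in atTop, Provable H (w.val n →ᶠ
      .all σ (A.subst ((r.at n).lift σ) →ᶠ (C.subst (r'.at n)).weaken σ)) := by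
    refine eventually_provable_all w ?_ fun d => ?_
    · filter_upwards [A.subst_lift_at_succ r, C.subst_at_succ r'] with n h1 h2
      rw [h1, h2, Formula.up_eq_subst, ← Formula.weaken_subst_lift]
      rfl
    · filter_upwards [h' _ (w.extend_le A (RawEnv.cons d r)) d (extend w A _)] with n h1
      change Provable H (_ →ᶠ Formula.inst _ _ →ᶠ Formula.inst _ _)
      rw [Formula.inst, Formula.subst_subst, Sub.lift_comp_single, ← RawEnv.cons_at,
        Formula.inst, Formula.weaken_subst_single]
      exact h1.curry
  filter_upwards [h, h1] with n h1 h2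
  refine Provable.mp_under (h2.imp_trans ?_) h1
  refine Provable.swap (Provable.ex_rule (Provable.swap ?_))
  have h3 := Provable.all_elim (T := H) ((A.subst ((r.at n).lift σ) →ᶠ
    (C.subst (r'.at n)).weaken σ).subst ((Sub.ofRen (Ren.shift (stage n) σ)).lift σ)) v0
  rw [Formula.subst_var_lift_inst] at h3
  change Provable H (Formula.weaken σ (.all σ _) →ᶠ _)
  rwa [Formula.weaken, Formula.rename_eq_subst]

theorem iff_mp (h : RawForces w (Formula.iff A B) r) : RawForces w A r ↔ RawForces w B r :=
  ⟨(and_iff.1 h).1.mp, (and_iff.1 h).2.mp⟩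

theorem allSt_iff {σ : Ty} {A : Formula (σ :: Γ)} : RawForces w (.allSt σ A) r ↔
    RawForces w (.all σ (.st v0 →ᶠ A)) r :=
  iff_mp (of_mem (.inr (.inl (.allSt_def A))))

theorem exSt_iff {σ : Ty} {A : Formula (σ :: Γ)} : RawForces w (.exSt σ A) r ↔
    RawForces w (.ex σ (.st v0 ∧ᶠ A)) r :=
  iff_mp (of_mem (.inr (.inl (.exSt_def A))))

end RawForces

/-! ### Provable equality of families -/

/-- Equality is provable without assumptions, not relative to a world, so all worlds share one
domain. Equality at a world remains a separate predicate, `RawTm.EqAt`. -/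
instance RawTm.setoid (σ : Ty) : Setoid (RawTm σ) where
  r a b := ∀ᶠ n in atTop, Provable H (a.val n ≐ b.val n)
  iseqv := by
    refine ⟨fun a => .of_forall fun n => .ax (.inl (.eq_refl _)), fun {a b} h => ?_,
      fun {a b c} h h' => ?_⟩
    · filter_upwards [h] with n h1
      exact .mp (.ax (.inl (.eq_symm _ _))) h1
    · filter_upwards [h, h'] with n h1 h2
      exact .mp (.ax (.inl (.eq_trans _ _ _))) (.mp (.mp (.and_intro _ _) h1) h2)

theorem RawTm.equiv_def {σ : Ty} {a b : RawTm σ} :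
    a ≈ b ↔ ∀ᶠ n in atTop, Provable H (a.val n ≐ b.val n) := Iff.rfl

/-- Equality of families at a world. -/
def RawTm.EqAt {σ : Ty} (w : World) (a b : RawTm σ) : Prop :=
  ∀ᶠ n in atTop, Provable H (w.val n →ᶠ a.val n ≐ b.val n)

namespace RawTm.EqAt

variable {σ τ : Ty} {w v : World} {a b c : RawTm σ}

theorem of_equiv (h : a ≈ b) (w : World) : EqAt w a b := by
  filter_upwards [RawTm.equiv_def.1 h] with n h1
  exact h1.imp_intro _

theorem symm (h : EqAt w a b) : EqAt w b a := by
  filter_upwards [h] with n h1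
  exact h1.imp_trans (.ax (.inl (.eq_symm _ _)))

theorem trans (h : EqAt w a b) (h' : EqAt w b c) : EqAt w a c := by
  filter_upwards [h, h'] with n h1 h2
  exact (h1.and_intro_under h2).imp_trans (.ax (.inl (.eq_trans _ _ _)))

theorem mono (h : EqAt w a b) (hv : v ≤ w) : EqAt v a b := by
  filter_upwards [h, hv] with n h1 h2
  exact h2.imp_trans h1

theorem eval {Γ : Ctx} {r r' : RawEnv Γ} (h : ∀ σ x, EqAt w (r σ x) (r' σ x)) {σ : Ty}
    (t : Tm Γ σ) : EqAt w (RawTm.eval t r) (RawTm.eval t r') := by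
  induction t with
  | var x => exact h _ x
  | const c => exact of_equiv (Setoid.refl _) w
  | app f a hf ha =>
    filter_upwards [hf, ha] with n h1 h2
    exact (h1.and_intro_under h2).imp_trans (.ax (.inl (.eq_app _ _ _ _)))

theorem cons {Γ : Ctx} {r r' : RawEnv Γ} (h : ∀ σ x, EqAt w (r σ x) (r' σ x)) {τ : Ty}
    (d : RawTm τ) (σ : Ty) (x : Var (τ :: Γ) σ) :
    EqAt w (RawEnv.cons d r σ x) (RawEnv.cons d r' σ x) :=
  match x with
  | .here => of_equiv (Setoid.refl d) w
  | .there x => h _ x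

end RawTm.EqAt

namespace RawForces

variable {Γ : Ctx} {w : World} {r r' : RawEnv Γ}

theorem eq_congr (h : ∀ σ x, (r σ x).EqAt w (r' σ x)) {σ : Ty} {a b : Tm Γ σ}
    (hab : RawForces w (a ≐ b) r) : RawForces w (a ≐ b) r' :=
  ((RawTm.EqAt.eval h a).symm.trans (show RawTm.EqAt w (RawTm.eval a r) (RawTm.eval b r) from
    hab)).trans (RawTm.EqAt.eval h b)

theorem st_congr (h : ∀ σ x, (r σ x).EqAt w (r' σ x)) {σ : Ty} {a : Tm Γ σ}
    (ha : RawForces w (.st a) r) : RawForces w (.st a) r' := by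
  filter_upwards [RawTm.EqAt.eval h a, ha] with n h1 h2
  exact (h2.and_intro_under h1).imp_trans (.ax (.inr (.inl (.st_eq _ _))))

/-- Induction on the formula; atoms use the equality axioms and the invariance of `st` under
equality. In particular forcing does not depend on the representatives of the elements. -/
theorem congr {A : Formula Γ} (h : ∀ σ x, (r σ x).EqAt w (r' σ x)) (hA : RawForces w A r) :
    RawForces w A r' := by
  induction A generalizing w with
  | bot => exact bot_elim hA
  | eq a b => exact eq_congr h hA
  | st a => exact st_congr h hA
  | and A B ihA ihB => exact and_iff.2 ((and_iff.1 hA).imp (ihA h) (ihB h))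
  | or A B ihA ihB =>
    exact or_elim hA (fun v hv hA' => or_left _ (ihA (fun σ x => (h σ x).mono hv) hA'))
      fun v hv hB' => or_right _ (ihB (fun σ x => (h σ x).mono hv) hB')
  | imp A B ihA ihB =>
    refine imp_iff.2 fun v hv hA' => ?_
    have h' := fun σ x => (h σ x).mono hv
    exact ihB h' (imp_iff.1 hA v hv (ihA (fun σ x => (h' σ x).symm) hA'))
  | all σ A ih => exact all_iff.2 fun d => ih (.cons h d) (all_iff.1 hA d)
  | ex σ A ih =>
    exact ex_elim hA fun v hv d hd => ex_intro d (ih (.cons (fun σ x => (h σ x).mono hv) d) hd)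
  | allSt σ A ih =>
    rw [allSt_iff, all_iff] at hA ⊢
    refine fun d => imp_iff.2 fun v hv hd => ?_
    have h' := fun σ x => (h σ x).mono hv
    exact ih (.cons h' d) (imp_iff.1 (hA d) v hv (st_congr (.cons (fun σ x => (h' σ x).symm) d) hd))
  | exSt σ A ih =>
    rw [exSt_iff] at hA ⊢
    refine ex_elim hA fun v hv d hd => ex_intro d (and_iff.2 ?_)
    have h' := RawTm.EqAt.cons (fun σ x => (h σ x).mono hv) d
    exact (and_iff.1 hd).imp (st_congr h') (ih h')

end RawForces

theorem RawTm.eval_congr {Γ : Ctx} {r r' : RawEnv Γ} (h : ∀ σ x, r σ x ≈ r' σ x) {σ : Ty}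
    (t : Tm Γ σ) : RawTm.eval t r ≈ RawTm.eval t r' := by
  induction t with
  | var x => exact h _ x
  | const c => exact Setoid.refl _
  | app f a hf ha =>
    rw [RawTm.equiv_def] at *
    filter_upwards [hf, ha] with n h1 h2
    exact .mp (.ax (.inl (.eq_app _ _ _ _))) (.mp (.mp (.and_intro _ _) h1) h2)

/-! ### The generic model -/

/-- The elements of type `σ` of the generic model. -/
def Elt (σ : Ty) : Type := Quotient (RawTm.setoid σ)

/-- Assignments of elements to variables. -/
abbrev Env (Γ : Ctx) : Type := ∀ σ : Ty, Var Γ σ → Elt σ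

def Env.nil : Env [] := nofun

def Env.cons {Γ : Ctx} {τ : Ty} (d : Elt τ) (ρ : Env Γ) : Env (τ :: Γ)
  | _, .here => d
  | _, .there x => ρ _ x

noncomputable def Env.out {Γ : Ctx} (ρ : Env Γ) : RawEnv Γ := fun σ x => (ρ σ x).out

/-- `r` represents `ρ`. -/
def RawEnv.Reps {Γ : Ctx} (r : RawEnv Γ) (ρ : Env Γ) : Prop :=
  ∀ σ x, (Quotient.mk _ (r σ x) : Elt σ) = ρ σ x

theorem Env.out_reps {Γ : Ctx} (ρ : Env Γ) : ρ.out.Reps ρ := fun _ _ => Quotient.out_eq _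

theorem RawEnv.Reps.cons {Γ : Ctx} {r : RawEnv Γ} {ρ : Env Γ} (h : r.Reps ρ) {τ : Ty}
    (d : RawTm τ) : (RawEnv.cons d r).Reps (Env.cons (Quotient.mk _ d) ρ) :=
  fun _ x => match x with
  | .here => rfl
  | .there x => h _ x

/-- The value of a term in the generic model. -/
noncomputable def eval {Γ : Ctx} {σ : Ty} (t : Tm Γ σ) (ρ : Env Γ) : Elt σ :=
  Quotient.mk _ (RawTm.eval t ρ.out)

/-- The formula `A` holds at `w` under the assignment `ρ`. -/
def Forces {Γ : Ctx} (w : World) (A : Formula Γ) (ρ : Env Γ) : Prop := RawForces w A ρ.out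

theorem RawEnv.Reps.equiv {Γ : Ctx} {r : RawEnv Γ} {ρ : Env Γ} (h : r.Reps ρ) (σ : Ty)
    (x : Var Γ σ) : r σ x ≈ ρ.out σ x :=
  Quotient.exact ((h σ x).trans (ρ.out_reps σ x).symm)

theorem RawEnv.Reps.eval {Γ : Ctx} {r : RawEnv Γ} {ρ : Env Γ} (h : r.Reps ρ) {σ : Ty}
    (t : Tm Γ σ) : eval t ρ = Quotient.mk _ (RawTm.eval t r) :=
  (Quotient.sound (RawTm.eval_congr h.equiv t)).symm

theorem RawEnv.Reps.forces {Γ : Ctx} {r : RawEnv Γ} {ρ : Env Γ} (h : r.Reps ρ) {w : World}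
    {A : Formula Γ} : Forces w A ρ ↔ RawForces w A r :=
  ⟨RawForces.congr fun σ x => .of_equiv (Setoid.symm (h.equiv σ x)) w,
    RawForces.congr fun σ x => .of_equiv (h.equiv σ x) w⟩

theorem eval_subst {Γ Δ : Ctx} {σ : Ty} (t : Tm Γ σ) (s : Sub Γ Δ) (ρ : Env Δ) :
    eval (t.subst s) ρ = eval t fun σ x => eval (s σ x) ρ := by
  rw [RawEnv.Reps.eval (r := fun σ x => RawTm.eval (s σ x) ρ.out) (ρ := fun σ x => eval (s σ x) ρ)
    (fun σ x => rfl) t]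
  simp only [eval, RawTm.eval, Tm.subst_subst]
  rfl

theorem forces_subst {Γ Δ : Ctx} {w : World} {A : Formula Γ} {s : Sub Γ Δ} {ρ : Env Δ} :
    Forces w (A.subst s) ρ ↔ Forces w A fun σ x => eval (s σ x) ρ := by
  rw [RawEnv.Reps.forces (r := fun σ x => RawTm.eval (s σ x) ρ.out)
    (ρ := fun σ x => eval (s σ x) ρ) (fun σ x => rfl)]
  simp only [Forces, RawForces, Formula.subst_subst]
  rfl

theorem eval_var {Γ : Ctx} {σ : Ty} (x : Var Γ σ) (ρ : Env Γ) : eval (.var x) ρ = ρ σ x :=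
  ρ.out_reps σ x

theorem forces_rename {Γ Δ : Ctx} {w : World} {A : Formula Γ} {s : Ren Γ Δ} {ρ : Env Δ} :
    Forces w (A.rename s) ρ ↔ Forces w A fun σ x => ρ σ (s σ x) := by
  rw [Formula.rename_eq_subst, forces_subst]
  simp only [Sub.ofRen, eval_var]

theorem eval_rename {Γ Δ : Ctx} {σ : Ty} (t : Tm Γ σ) (s : Ren Γ Δ) (ρ : Env Δ) :
    eval (t.rename s) ρ = eval t fun σ x => ρ σ (s σ x) := by
  rw [Tm.rename_eq_subst, eval_subst]
  simp only [Sub.ofRen, eval_var]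

theorem eval_eq_iff {Γ : Ctx} {σ : Ty} {a b : Tm Γ σ} {ρ : Env Γ} : eval a ρ = eval b ρ ↔
    ∀ᶠ n in atTop, Provable H (a.subst (ρ.out.at n) ≐ b.subst (ρ.out.at n)) :=
  ⟨fun h => Quotient.exact h, fun h => Quotient.sound h⟩

/-- Provable equations hold in the generic model. -/
theorem eval_eq_of_axiom {Γ : Ctx} {σ : Ty} {a b : Tm Γ σ} (h : (a ≐ b) ∈ H Γ) (ρ : Env Γ) :
    eval a ρ = eval b ρ :=
  eval_eq_iff.2 (.of_forall fun _ => .ax (H_subst h _))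

/-- Application in the generic model. -/
noncomputable def Elt.app {σ τ : Ty} (f : Elt (.arrow σ τ)) (a : Elt σ) : Elt τ :=
  eval (.app v1 v0) (Env.cons a (Env.cons f Env.nil))

infixl:80 " ⬝ " => UDN.Elt.app

theorem eval_app {Γ : Ctx} {σ τ : Ty} (f : Tm Γ (.arrow σ τ)) (a : Tm Γ σ) (ρ : Env Γ) :
    eval (.app f a) ρ = eval f ρ ⬝ eval a ρ := by
  have := eval_subst (.app v1 v0) (Sub.cons a (Sub.cons f (Sub.ofRen (Ren.ofNil Γ)))) ρ
  refine this.trans (congrArg (eval _) ?_)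
  funext σ x
  match σ, x with
  | _, .here => rfl
  | _, .there .here => rfl

/-- The value of a constant. -/
noncomputable def Const.elt {σ : Ty} (c : Const σ) : Elt σ := eval (.const c) Env.nil

theorem eval_const {Γ : Ctx} {σ : Ty} (c : Const σ) (ρ : Env Γ) : eval (.const c) ρ = c.elt :=
  rfl

theorem eval_ofClosed {Γ : Ctx} {σ : Ty} (t : Tm [] σ) (ρ : Env Γ) :
    eval (t.ofClosed Γ) ρ = eval t Env.nil := by
  rw [Tm.ofClosed, eval_rename]
  congr 1
  funext σ x
  cases x

theorem Elt.exists_eq_mk {σ : Ty} (d : Elt σ) : ∃ a : RawTm σ, Quotient.mk _ a = d :=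
  Quotient.exists_rep d

namespace Forces

variable {Γ Δ : Ctx} {w v : World} {ρ : Env Γ} {ρ' : Env Δ} {A B : Formula Γ} {C : Formula Δ}

theorem mono (h : Forces w A ρ) (hv : v ≤ w) : Forces v A ρ := RawForces.mono h hv

theorem of_mem (h : A ∈ H Γ) : Forces w A ρ := RawForces.of_mem h

theorem mp (h : Forces w (A →ᶠ B) ρ) (h' : Forces w A ρ) : Forces w B ρ := RawForces.mp h h'

theorem imp_iff : Forces w (A →ᶠ B) ρ ↔ ∀ v, v ≤ w → Forces v A ρ → Forces v B ρ :=
  RawForces.imp_iff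

theorem and_iff : Forces w (A ∧ᶠ B) ρ ↔ Forces w A ρ ∧ Forces w B ρ := RawForces.and_iff

theorem bot_elim (h : Forces w (.bot : Formula Γ) ρ) : Forces w C ρ' := RawForces.bot_elim h

theorem or_left (B : Formula Γ) (h : Forces w A ρ) : Forces w (A.or B) ρ := RawForces.or_left B h

theorem or_right (A : Formula Γ) (h : Forces w B ρ) : Forces w (A.or B) ρ :=
  RawForces.or_right A h

theorem or_elim (h : Forces w (A.or B) ρ)
    (hA : ∀ v, v ≤ w → Forces v A ρ → Forces v C ρ')
    (hB : ∀ v, v ≤ w → Forces v B ρ → Forces v C ρ') : Forces w C ρ' :=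
  RawForces.or_elim h hA hB

theorem all_iff {σ : Ty} {A : Formula (σ :: Γ)} : Forces w (.all σ A) ρ ↔
    ∀ d, Forces w A (Env.cons d ρ) := by
  refine RawForces.all_iff.trans ⟨fun h d => ?_, fun h d => ?_⟩
  · obtain ⟨a, rfl⟩ := d.exists_eq_mk
    exact (ρ.out_reps.cons a).forces.2 (h a)
  · exact (ρ.out_reps.cons d).forces.1 (h _)

theorem ex_intro {σ : Ty} {A : Formula (σ :: Γ)} (d : Elt σ) (h : Forces w A (Env.cons d ρ)) :
    Forces w (.ex σ A) ρ := by
  obtain ⟨a, rfl⟩ := d.exists_eq_mk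
  exact RawForces.ex_intro a ((ρ.out_reps.cons a).forces.1 h)

theorem ex_elim {σ : Ty} {A : Formula (σ :: Γ)} (h : Forces w (.ex σ A) ρ)
    (h' : ∀ v, v ≤ w → ∀ d, Forces v A (Env.cons d ρ) → Forces v C ρ') : Forces w C ρ' :=
  RawForces.ex_elim h fun v hv d hd => h' v hv _ ((ρ.out_reps.cons d).forces.2 hd)

theorem allSt_iff {σ : Ty} {A : Formula (σ :: Γ)} : Forces w (.allSt σ A) ρ ↔
    ∀ d v, v ≤ w → Forces v (.st v0) (Env.cons d ρ) → Forces v A (Env.cons d ρ) := by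
  refine RawForces.allSt_iff.trans (all_iff.trans ?_)
  exact forall_congr' fun d => imp_iff

theorem exSt_intro {σ : Ty} {A : Formula (σ :: Γ)} (d : Elt σ)
    (hd : Forces w (.st v0) (Env.cons d ρ)) (h : Forces w A (Env.cons d ρ)) :
    Forces w (.exSt σ A) ρ :=
  RawForces.exSt_iff.2 (ex_intro d (and_iff.2 ⟨hd, h⟩))

theorem exSt_elim {σ : Ty} {A : Formula (σ :: Γ)} (h : Forces w (.exSt σ A) ρ)
    (h' : ∀ v, v ≤ w → ∀ d, Forces v (.st v0) (Env.cons d ρ) → Forces v A (Env.cons d ρ) →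
      Forces v C ρ') : Forces w C ρ' :=
  ex_elim (RawForces.exSt_iff.1 h) fun v hv d hd => h' v hv d (and_iff.1 hd).1 (and_iff.1 hd).2

theorem congr {ρ' : Env Γ}
    (h : ∀ σ x, Forces w (v0 ≐ v1) (Env.cons (ρ σ x) (Env.cons (ρ' σ x) Env.nil)))
    (hA : Forces w A ρ) : Forces w A ρ' :=
  RawForces.congr (fun σ x => h σ x) hA

end Forces

/-- The trivial world. -/
noncomputable def World.top : World where
  val _ := .bot →ᶠ .bot
  compat := .of_forall fun _ => rfl

/-- Validity in the generic model implies derivability. -/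
theorem provable_of_forces {Γ : Ctx} {A : Formula Γ} (h : ∀ ρ, Forces World.top A ρ) :
    Provable H A := by
  induction Γ with
  | nil =>
    obtain ⟨n, hn⟩ := (h Env.nil).exists
    have h1 := Provable.mp hn (Provable.imp_refl _)
    -- Any one stage at which the closed formula is provable suffices: all its variables are
    -- superfluous, and stage `0` is the empty context.
    have h2 := provable_of_le (G := fun k => A.subst (Sub.ofRen (Ren.ofNil (stage k))))
      (m := 0) (n := n) (Nat.zero_le n) (fun k _ => ?_) ?_
    · have h3 : A.subst (Sub.ofRen (Ren.ofNil [])) = A := by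
        conv_rhs => rw [← Formula.subst_var A]
        congr 1
        funext σ x
        cases x
      rw [← h3]
      exact h2
    · rw [Formula.up_eq_subst, Formula.subst_subst]
      congr 1
      funext σ x
      cases x
    · convert h1 using 2
      funext σ x
      cases x
  | cons σ Γ ih =>
    exact Provable.of_all (ih fun ρ => Forces.all_iff.2 fun d => h _)

end UDN

/-! ### Calculating in the generic model: substitutions, predicates, combinators, arithmetic. -/

namespace UDN
open Tm Filter

/-! ### Evaluation of substitutions -/

section Val

variable {Γ Δ Θ : Ctx} {σ τ υ : Ty}

theorem Env.ext_cons {ρ ρ' : Env (τ :: Γ)} (h : ρ τ .here = ρ' τ .here)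
    (h' : ∀ σ x, ρ σ (.there x) = ρ' σ (.there x)) : ρ = ρ' := by
  funext σ x
  cases x with
  | here => exact h
  | there x => exact h' _ x

@[simp] theorem Env.cons_here (d : Elt τ) (ρ : Env Γ) : Env.cons d ρ τ .here = d := rfl

@[simp] theorem Env.cons_there (d : Elt τ) (ρ : Env Γ) (x : Var Γ σ) :
    Env.cons d ρ σ (.there x) = ρ σ x := rfl

/-- The assignment obtained by evaluating a substitution. -/
noncomputable def Sub.val (s : Sub Γ Δ) (ρ : Env Δ) : Env Γ := fun σ x => eval (s σ x) ρ

/-- The assignment obtained by composition with a renaming. -/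
def Ren.val (r : Ren Γ Δ) (ρ : Env Δ) : Env Γ := fun σ x => ρ σ (r σ x)

theorem forces_subst_val {w : World} {A : Formula Γ} {s : Sub Γ Δ} {ρ : Env Δ} :
    Forces w (A.subst s) ρ ↔ Forces w A (s.val ρ) := forces_subst

theorem forces_rename_val {w : World} {A : Formula Γ} {r : Ren Γ Δ} {ρ : Env Δ} :
    Forces w (A.rename r) ρ ↔ Forces w A (r.val ρ) := forces_rename

theorem eval_subst_val (t : Tm Γ σ) (s : Sub Γ Δ) (ρ : Env Δ) :
    eval (t.subst s) ρ = eval t (s.val ρ) := eval_subst t s ρ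

theorem eval_rename_val (t : Tm Γ σ) (r : Ren Γ Δ) (ρ : Env Δ) :
    eval (t.rename r) ρ = eval t (r.val ρ) := eval_rename t r ρ

@[simp] theorem Sub.val_cons (a : Tm Δ τ) (s : Sub Γ Δ) (ρ : Env Δ) :
    (Sub.cons a s).val ρ = Env.cons (eval a ρ) (s.val ρ) :=
  Env.ext_cons rfl fun _ _ => rfl

@[simp] theorem Sub.val_ofRen (r : Ren Γ Δ) (ρ : Env Δ) : (Sub.ofRen r).val ρ = r.val ρ := by
  funext σ x
  exact eval_var _ _

@[simp] theorem Ren.val_shift (d : Elt τ) (ρ : Env Γ) :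
    (Ren.shift Γ τ).val (Env.cons d ρ) = ρ := rfl

@[simp] theorem Sub.val_lift (s : Sub Γ Δ) (d : Elt τ) (ρ : Env Δ) :
    (s.lift τ).val (Env.cons d ρ) = Env.cons d (s.val ρ) := by
  refine Env.ext_cons (eval_var _ _) fun σ x => ?_
  exact eval_rename_val _ _ _

@[simp] theorem Sub.val_single (a : Tm Γ τ) (ρ : Env Γ) :
    (Sub.single a).val ρ = Env.cons (eval a ρ) ρ :=
  Env.ext_cons rfl fun _ _ => eval_var _ _

@[simp] theorem Ren.val_swap (a : Elt σ) (b : Elt τ) (ρ : Env Γ) :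
    (Ren.swap Γ τ σ).val (Env.cons a (Env.cons b ρ)) = Env.cons b (Env.cons a ρ) := by
  refine Env.ext_cons rfl fun σ x => ?_
  cases x <;> rfl

@[simp] theorem forces_inst {w : World} {A : Formula (τ :: Γ)} {a : Tm Γ τ} {ρ : Env Γ} :
    Forces w (A.inst a) ρ ↔ Forces w A (Env.cons (eval a ρ) ρ) := by
  rw [Formula.inst, forces_subst_val, Sub.val_single]

theorem forces_weaken {w : World} {A : Formula Γ} {d : Elt τ} {ρ : Env Γ} :
    Forces w (A.weaken τ) (Env.cons d ρ) ↔ Forces w A ρ := by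
  rw [Formula.weaken, forces_rename_val, Ren.val_shift]

theorem eval_weaken (a : Tm Γ σ) (d : Elt τ) (ρ : Env Γ) :
    eval (a.weaken τ) (Env.cons d ρ) = eval a ρ := by
  rw [Tm.weaken, eval_rename_val, Ren.val_shift]

end Val

attribute [simp] eval_var eval_app eval_ofClosed forces_subst_val forces_rename_val
  eval_subst_val eval_rename_val eval_const

/-! ### Predicates of the generic model -/

section Predicates

variable {Γ : Ctx} {σ τ υ : Ty} {w v : World} {ρ : Env Γ}

def EqAt (w : World) (a b : Elt σ) : Prop :=
  Forces w (v0 ≐ v1) (Env.cons a (Env.cons b Env.nil))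

def StAt (w : World) (a : Elt σ) : Prop := Forces w (.st v0) (Env.cons a Env.nil)

def LtAt (w : World) (m n : Elt .nat) : Prop :=
  Forces w (.lt v0 v1) (Env.cons m (Env.cons n Env.nil))

def MemAt (w : World) (a : Elt σ) (s : Elt (.seq σ)) : Prop :=
  Forces w (.mem v0 v1) (Env.cons a (Env.cons s Env.nil))

/-- The substitution from the empty context. -/
def Sub.nil {Γ : Ctx} : Sub [] Γ := nofun

@[simp] theorem Sub.val_nil : (Sub.nil (Γ := Γ)).val ρ = Env.nil := by
  funext σ x
  cases x

theorem EqAt.mono {a b : Elt σ} (h : EqAt w a b) (hv : v ≤ w) : EqAt v a b := Forces.mono h hv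
theorem StAt.mono {a : Elt σ} (h : StAt w a) (hv : v ≤ w) : StAt v a := Forces.mono h hv
theorem MemAt.mono {a : Elt σ} {s : Elt (.seq σ)} (h : MemAt w a s) (hv : v ≤ w) :
    MemAt v a s := Forces.mono h hv

@[simp] theorem forces_eq {a b : Tm Γ σ} :
    Forces w (a ≐ b) ρ ↔ EqAt w (eval a ρ) (eval b ρ) := by
  have : (a ≐ b) = (v0 ≐ v1 : Formula [σ, σ]).subst (Sub.cons a (Sub.cons b Sub.nil)) := rfl
  rw [this, forces_subst_val]
  simp [EqAt]

@[simp] theorem forces_st {a : Tm Γ σ} : Forces w (.st a) ρ ↔ StAt w (eval a ρ) := by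
  have : (Formula.st a) = (.st v0 : Formula [σ]).subst (Sub.cons a Sub.nil) := rfl
  rw [this, forces_subst_val]
  simp [StAt]

@[simp] theorem forces_lt {m n : Tm Γ .nat} :
    Forces w (.lt m n) ρ ↔ LtAt w (eval m ρ) (eval n ρ) := by
  have : (Formula.lt m n) =
      (.lt v0 v1 : Formula [.nat, .nat]).subst (Sub.cons m (Sub.cons n Sub.nil)) := by
    rw [Formula.lt_subst]; rfl
  rw [this, forces_subst_val]
  simp [LtAt]

@[simp] theorem forces_mem {a : Tm Γ σ} {s : Tm Γ (.seq σ)} :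
    Forces w (.mem a s) ρ ↔ MemAt w (eval a ρ) (eval s ρ) := by
  have : (Formula.mem a s) =
      (.mem v0 v1 : Formula [σ, .seq σ]).subst (Sub.cons a (Sub.cons s Sub.nil)) := by
    rw [Formula.mem_subst]; rfl
  rw [this, forces_subst_val]
  simp [MemAt]

@[simp] theorem forces_and {A B : Formula Γ} :
    Forces w (A ∧ᶠ B) ρ ↔ Forces w A ρ ∧ Forces w B ρ := Forces.and_iff

@[simp] theorem forces_imp {A B : Formula Γ} :
    Forces w (A →ᶠ B) ρ ↔ ∀ v, v ≤ w → Forces v A ρ → Forces v B ρ := Forces.imp_iff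

@[simp] theorem forces_all {A : Formula (σ :: Γ)} :
    Forces w (.all σ A) ρ ↔ ∀ d, Forces w A (Env.cons d ρ) := Forces.all_iff

@[simp] theorem forces_allSt {A : Formula (σ :: Γ)} : Forces w (.allSt σ A) ρ ↔
    ∀ d v, v ≤ w → StAt v d → Forces v A (Env.cons d ρ) := by
  rw [Forces.allSt_iff]
  simp

theorem Forces.exSt_intro' {A : Formula (σ :: Γ)} (d : Elt σ) (hd : StAt w d)
    (h : Forces w A (Env.cons d ρ)) : Forces w (.exSt σ A) ρ :=
  Forces.exSt_intro d (forces_st.2 (by simpa using hd)) h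

theorem Forces.exSt_elim' {Δ : Ctx} {ρ' : Env Δ} {C : Formula Δ} {A : Formula (σ :: Γ)}
    (h : Forces w (.exSt σ A) ρ)
    (h' : ∀ v, v ≤ w → ∀ d, StAt v d → Forces v A (Env.cons d ρ) → Forces v C ρ') :
    Forces w C ρ' :=
  Forces.exSt_elim h fun v hv d hd => h' v hv d (by simpa using hd)

/-- The way back from internal reasoning to equality of elements: an equation forced by internal
induction at the trivial world becomes an equation usable for rewriting. -/
theorem eqAt_top_iff {a b : Elt σ} : EqAt World.top a b ↔ a = b := by
  have h : EqAt World.top a b ↔ ∀ᶠ n in atTop, Provable H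
      (World.top.val n →ᶠ a.out.val n ≐ b.out.val n) := Iff.rfl
  rw [h]
  constructor
  · intro h
    rw [← Quotient.out_eq a, ← Quotient.out_eq b]
    refine Quotient.sound ?_
    change ∀ᶠ n in atTop, _
    filter_upwards [h] with n h1
    exact .mp h1 (.imp_refl _)
  · rintro rfl
    exact .of_forall fun n => .imp_intro _ (.ax (.inl (.eq_refl _)))

theorem World.le_top (w : World) : w ≤ World.top :=
  .of_forall fun _ => .imp_intro _ (.imp_refl _)

theorem EqAt.of_eq {a b : Elt σ} (h : a = b) : EqAt w a b :=
  (eqAt_top_iff.2 h).mono w.le_top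

theorem EqAt.refl (a : Elt σ) : EqAt w a a := .of_eq rfl

/-- Indiscernibility of equal elements. -/
theorem EqAt.forces {a b : Elt σ} (h : EqAt w a b) {A : Formula (σ :: Γ)}
    (hA : Forces w A (Env.cons a ρ)) : Forces w A (Env.cons b ρ) := by
  refine Forces.congr (fun σ x => ?_) hA
  cases x with
  | here => exact h
  | there x => exact EqAt.refl _

theorem EqAt.symm {a b : Elt σ} (h : EqAt w a b) : EqAt w b a := by
  have := h.forces (A := v0 ≐ v1) (ρ := Env.cons a Env.nil) (EqAt.refl a)
  exact this

theorem EqAt.trans {a b c : Elt σ} (h : EqAt w a b) (h' : EqAt w b c) : EqAt w a c := by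
  have := h.symm.forces (A := v0 ≐ v1) (ρ := Env.cons c Env.nil) h'
  exact this

theorem EqAt.app_right (f : Elt (.arrow σ τ)) {a b : Elt σ} (h : EqAt w a b) :
    EqAt w (f ⬝ a) (f ⬝ b) := by
  have := h.forces (A := .app v2 v1 ≐ .app v2 v0)
    (ρ := Env.cons a (Env.cons f Env.nil)) (by simpa using EqAt.refl (f ⬝ a))
  simpa using this

theorem EqAt.app_left {f g : Elt (.arrow σ τ)} (h : EqAt w f g) (a : Elt σ) :
    EqAt w (f ⬝ a) (g ⬝ a) := by
  have := h.forces (A := .app v1 v2 ≐ .app v0 v2)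
    (ρ := Env.cons f (Env.cons a Env.nil)) (by simpa using EqAt.refl (f ⬝ a))
  simpa using this

theorem EqAt.memAt {a b : Elt σ} {s : Elt (.seq σ)} (h : EqAt w a b) (ha : MemAt w a s) :
    MemAt w b s :=
  h.forces (A := .mem v0 v1) (ρ := Env.cons s Env.nil) ha

theorem StAt.app {f : Elt (.arrow σ τ)} {a : Elt σ} (hf : StAt w f) (ha : StAt w a) :
    StAt w (f ⬝ a) := by
  have h : Forces w (.st (v1 : Tm [σ, .arrow σ τ] _) ∧ᶠ .st v0 →ᶠ .st (.app v1 v0))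
      (Env.cons a (Env.cons f Env.nil)) := .of_mem (.inr (.inl (.st_app _ _)))
  simp only [forces_imp, forces_and, forces_st] at h
  simpa using h w le_rfl ⟨by simpa using hf, by simpa using ha⟩

theorem StAt.closed (t : Tm [] σ) : StAt w (eval t Env.nil) := by
  have h : Forces w (.st (t.ofClosed [])) Env.nil := .of_mem (.inr (.inl (.st_closed _)))
  simpa using h

theorem StAt.const (c : Const σ) : StAt w c.elt := StAt.closed (.const c)

end Predicates

/-! ### Combinators and abstraction -/

section Lam

variable {Γ : Ctx} {σ τ υ : Ty}

theorem Elt.proj_app (a : Elt σ) (b : Elt τ) : (Const.proj σ τ).elt ⬝ a ⬝ b = a := by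
  have := eval_eq_of_axiom (.inl (.proj (v0 : Tm [σ, τ] σ) (v1 : Tm [σ, τ] τ)))
    (Env.cons a (Env.cons b Env.nil))
  simpa using this

theorem Elt.comb_app (f : Elt (.arrow υ (.arrow σ τ))) (g : Elt (.arrow υ σ)) (a : Elt υ) :
    (Const.comb υ σ τ).elt ⬝ f ⬝ g ⬝ a = f ⬝ a ⬝ (g ⬝ a) := by
  have := eval_eq_of_axiom (.inl (.comb (v2 : Tm [υ, .arrow υ σ, .arrow υ (.arrow σ τ)] _)
    (v1 : Tm [υ, .arrow υ σ, .arrow υ (.arrow σ τ)] _) v0))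
    (Env.cons a (Env.cons g (Env.cons f Env.nil)))
  simpa using this

theorem Elt.ext {f g : Elt (.arrow σ τ)} (h : ∀ a, f ⬝ a = g ⬝ a) : f = g := by
  have h1 : Forces World.top (Formula.iff ((v0 : Tm [.arrow σ τ, .arrow σ τ] _) ≐ v1)
      (.all σ ((v0.weaken σ).app v0 ≐ (v1.weaken σ).app v0)))
      (Env.cons f (Env.cons g Env.nil)) := .of_mem (.inl (.extensionality _ _))
  have h2 := (forces_and.1 h1).2
  rw [forces_imp] at h2
  refine eqAt_top_iff.1 (h2 _ le_rfl ?_)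
  simp only [forces_all, forces_eq, eval_app, eval_weaken, eval_var, Env.cons_here,
    Env.cons_there]
  exact fun a => EqAt.of_eq (h a)

@[simp] theorem eval_lam (t : Tm (σ :: Γ) τ) (ρ : Env Γ) (d : Elt σ) :
    eval (lam t) ρ ⬝ d = eval t (Env.cons d ρ) := by
  suffices h : ∀ {Θ : Ctx} {τ : Ty} (t : Tm Θ τ) (e : Θ = σ :: Γ),
      eval (lam (e ▸ t : Tm (σ :: Γ) τ)) ρ ⬝ d = eval (e ▸ t : Tm (σ :: Γ) τ) (Env.cons d ρ) from
    h t rfl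
  intro Θ τ t e
  induction t with
  | var x =>
    subst e
    cases x with
    | here => simp [lam, Elt.comb_app, Elt.proj_app]
    | there x => simp [lam, Elt.proj_app]
  | const c => subst e; simp [lam, Elt.proj_app]
  | app f a hf ha =>
    subst e
    simp only [lam, eval_app, Elt.comb_app, eval_const]
    rw [hf, ha]

end Lam

/-! ### Arithmetic -/

section Arithmetic

variable {Γ : Ctx} {σ τ υ : Ty} {w v : World} {ρ : Env Γ}

namespace Elt

noncomputable def zero : Elt .nat := Const.zero.elt
noncomputable def succ (n : Elt .nat) : Elt .nat := Const.succ.elt ⬝ n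
noncomputable def nil (σ : Ty) : Elt (.seq σ) := (Const.nil σ).elt
noncomputable def cons (a : Elt σ) (s : Elt (.seq σ)) : Elt (.seq σ) := (Const.cons σ).elt ⬝ a ⬝ s
noncomputable def natRec (a : Elt σ) (f : Elt (.arrow σ (.arrow .nat σ))) (n : Elt .nat) :
    Elt σ := (Const.natRec σ).elt ⬝ a ⬝ f ⬝ n
noncomputable def listRec (a : Elt σ) (f : Elt (.arrow σ (.arrow τ σ))) (s : Elt (.seq τ)) :
    Elt σ := (Const.listRec σ τ).elt ⬝ a ⬝ f ⬝ s

@[simp] theorem natRec_zero (a : Elt σ) (f : Elt (.arrow σ (.arrow .nat σ))) :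
    natRec a f zero = a := by
  have := eval_eq_of_axiom (.inl (.natRec_zero (v0 : Tm [σ, .arrow σ (.arrow .nat σ)] _) v1))
    (Env.cons a (Env.cons f Env.nil))
  simpa [Tm.natRec, Tm.zero, natRec, zero] using this

@[simp] theorem natRec_succ (a : Elt σ) (f : Elt (.arrow σ (.arrow .nat σ))) (n : Elt .nat) :
    natRec a f (succ n) = f ⬝ natRec a f n ⬝ n := by
  have := eval_eq_of_axiom
    (.inl (.natRec_succ (v0 : Tm [σ, .arrow σ (.arrow .nat σ), .nat] _) v1 v2))
    (Env.cons a (Env.cons f (Env.cons n Env.nil)))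
  simpa [Tm.natRec, Tm.succ, natRec, succ] using this

@[simp] theorem listRec_nil (a : Elt σ) (f : Elt (.arrow σ (.arrow τ σ))) :
    listRec a f (nil τ) = a := by
  have := eval_eq_of_axiom (.inl (.listRec_nil (v0 : Tm [σ, .arrow σ (.arrow τ σ)] _) v1))
    (Env.cons a (Env.cons f Env.nil))
  simpa [Tm.listRec, Tm.nil, listRec, nil] using this

@[simp] theorem listRec_cons (a : Elt σ) (f : Elt (.arrow σ (.arrow τ σ))) (c : Elt τ)
    (s : Elt (.seq τ)) : listRec a f (cons c s) = f ⬝ listRec a f s ⬝ c := by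
  have := eval_eq_of_axiom (.inl (.listRec_cons
    (v0 : Tm [σ, .arrow σ (.arrow τ σ), τ, .seq τ] _) v1 v2
    (.var (.there (.there (.there .here))))))
    (Env.cons a (Env.cons f (Env.cons c (Env.cons s Env.nil))))
  simpa [Tm.listRec, Tm.cons, listRec, cons] using this

end Elt

@[simp] theorem eval_zero : eval Tm.zero ρ = Elt.zero := rfl
@[simp] theorem eval_succ (n : Tm Γ .nat) : eval (Tm.succ n) ρ = Elt.succ (eval n ρ) := by
  simp [Tm.succ, Elt.succ]
@[simp] theorem eval_nil : eval (Tm.nil σ) ρ = Elt.nil σ := rfl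
@[simp] theorem eval_cons (a : Tm Γ σ) (s : Tm Γ (.seq σ)) :
    eval (Tm.cons a s) ρ = Elt.cons (eval a ρ) (eval s ρ) := by
  simp [Tm.cons, Elt.cons]
@[simp] theorem eval_natRec (a : Tm Γ σ) (f : Tm Γ (.arrow σ (.arrow .nat σ))) (n : Tm Γ .nat) :
    eval (Tm.natRec a f n) ρ = Elt.natRec (eval a ρ) (eval f ρ) (eval n ρ) := by
  simp [Tm.natRec, Elt.natRec]
@[simp] theorem eval_listRec (a : Tm Γ σ) (f : Tm Γ (.arrow σ (.arrow τ σ)))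
    (s : Tm Γ (.seq τ)) :
    eval (Tm.listRec a f s) ρ = Elt.listRec (eval a ρ) (eval f ρ) (eval s ρ) := by
  simp [Tm.listRec, Elt.listRec]

theorem EqAt.succ_ne_zero {n : Elt .nat} (h : EqAt w (Elt.succ n) Elt.zero) {A : Formula Γ} :
    Forces w A ρ := by
  have h1 : Forces w (Tm.succ (v0 : Tm [.nat] .nat) ≐ Tm.zero).neg (Env.cons n Env.nil) :=
    .of_mem (.inl (.succ_ne_zero _))
  exact (forces_imp.1 h1 w le_rfl (by simpa using h)).bot_elim

theorem EqAt.succ_inj {m n : Elt .nat} (h : EqAt w (Elt.succ m) (Elt.succ n)) : EqAt w m n := by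
  have h1 : Forces w (Tm.succ (v0 : Tm [.nat, .nat] .nat) ≐ Tm.succ v1 →ᶠ v0 ≐ v1)
    (Env.cons m (Env.cons n Env.nil)) := .of_mem (.inl (.succ_inj _ _))
  simpa using forces_imp.1 h1 w le_rfl (by simpa using h)

@[simp] theorem Sub.val_succ (n : Elt .nat) :
    (Sub.succ Γ).val (Env.cons n ρ) = Env.cons (Elt.succ n) ρ :=
  Env.ext_cons (by simp [Sub.val, Sub.succ]) fun _ _ => eval_var _ _

@[simp] theorem Sub.val_choice (a : Elt σ) (f : Elt (.arrow σ τ)) :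
    (Sub.choice Γ σ τ).val (Env.cons a (Env.cons f ρ)) = Env.cons (f ⬝ a) (Env.cons a ρ) :=
  Env.ext_cons (by simp [Sub.val, Sub.choice]) fun σ x => by
    cases x <;> exact eval_var _ _

/-- Internal induction. -/
theorem Forces.nat_induction {φ : Formula (.nat :: Γ)} (hi : φ.Internal) (ho : φ.OrFree)
    (h0 : Forces w φ (Env.cons Elt.zero ρ))
    (h1 : ∀ v, v ≤ w → ∀ n, Forces v φ (Env.cons n ρ) → Forces v φ (Env.cons (Elt.succ n) ρ))
    (n : Elt .nat) : Forces w φ (Env.cons n ρ) := by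
  have h : Forces w (φ.inst Tm.zero ∧ᶠ .all .nat (φ →ᶠ φ.subst (Sub.succ Γ)) →ᶠ .all .nat φ) ρ :=
    .of_mem (.inl (.induction φ hi ho))
  refine forces_all.1 (forces_imp.1 h w le_rfl (forces_and.2 ⟨by simpa using h0, ?_⟩)) n
  simp only [forces_all, forces_imp, forces_subst_val, Sub.val_succ]
  exact fun n v hv => h1 v hv n

/-- Replaces the disjunction "zero or successor", which internal induction cannot prove because it
excludes `∨`. For this reason case distinctions on arbitrary numbers are confined to internal
`∨`-free goals. -/
theorem Forces.nat_cases {φ : Formula (.nat :: Γ)} (hi : φ.Internal) (ho : φ.OrFree)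
    (h0 : Forces w φ (Env.cons Elt.zero ρ)) (h1 : ∀ n, Forces w φ (Env.cons (Elt.succ n) ρ))
    (n : Elt .nat) : Forces w φ (Env.cons n ρ) :=
  Forces.nat_induction hi ho h0 (fun _ hv n _ => (h1 n).mono hv) n

/-- External induction. -/
theorem Forces.nat_induction_st {φ : Formula (.nat :: Γ)}
    (h0 : Forces w φ (Env.cons Elt.zero ρ))
    (h1 : ∀ v, v ≤ w → ∀ n, StAt v n → Forces v φ (Env.cons n ρ) →
      Forces v φ (Env.cons (Elt.succ n) ρ))
    {n : Elt .nat} (hn : StAt w n) : Forces w φ (Env.cons n ρ) := by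
  have h : Forces w (φ.inst Tm.zero ∧ᶠ .allSt .nat (φ →ᶠ φ.subst (Sub.succ Γ)) →ᶠ .allSt .nat φ)
      ρ := .of_mem (.inr (.inl (.induction φ)))
  refine forces_allSt.1 (forces_imp.1 h w le_rfl (forces_and.2 ⟨by simpa using h0, ?_⟩)) n w
    le_rfl hn
  simp only [forces_allSt, forces_imp, forces_subst_val, Sub.val_succ]
  exact fun n v hv hn v' hv' => h1 v' (hv'.trans hv) n (hn.mono hv')

theorem Forces.seq_cases {φ : Formula (.seq σ :: Γ)} (hi : φ.Internal) (ho : φ.OrFree)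
    (h0 : Forces w φ (Env.cons (Elt.nil σ) ρ))
    (h1 : ∀ a s, Forces w φ (Env.cons (Elt.cons a s) ρ)) (s : Elt (.seq σ)) :
    Forces w φ (Env.cons s ρ) := by
  have hs : Forces w _ (Env.cons s ρ) := .of_mem (.inl (.seq (v0 : Tm (.seq σ :: Γ) _)))
  refine hs.ex_elim fun v hv z hz => ?_
  -- The sequence axiom codes its disjunction by the number `z`, so distinguishing zero from
  -- successor on `z` separates the empty from the nonempty case.
  have h2 := Forces.nat_cases (w := v) (ρ := Env.cons s ρ) (n := z)
    (φ := (((v0 ≐ Tm.zero →ᶠ v0.weaken .nat ≐ Tm.nil σ) ∧ᶠ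
          ((v0 ≐ Tm.zero).neg →ᶠ .ex σ (.ex (.seq σ)
            (((v0.weaken .nat).weaken σ).weaken (.seq σ) ≐ Tm.cons v1 v0)))) →ᶠ φ.weaken .nat))
    ?_ ?_ ?_ ?_
  · exact forces_weaken.1 (forces_imp.1 h2 v le_rfl hz)
  · simp only [Formula.Internal, Formula.weaken, Formula.rename_eq_subst, and_true, true_and]
    exact hi.subst _
  · simp only [Formula.OrFree, Formula.weaken, Formula.rename_eq_subst, and_true, true_and]
    exact ho.subst _
  · rw [forces_imp]
    intro v' hv' h
    rw [forces_weaken]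
    have h3 := forces_imp.1 (forces_and.1 h).1 v' le_rfl (by simpa using EqAt.refl _)
    exact EqAt.forces (EqAt.symm (by simpa using h3)) (h0.mono (hv'.trans hv))
  · intro n
    rw [forces_imp]
    intro v' hv' h
    rw [forces_weaken]
    have h3 := forces_imp.1 (forces_and.1 h).2 v' le_rfl (by
      rw [forces_imp]
      exact fun u hu hz => EqAt.succ_ne_zero (by simpa using hz))
    refine h3.ex_elim fun v1 hv1 a ha => ha.ex_elim fun v2 hv2 l hl => ?_
    refine EqAt.forces (EqAt.symm (a := s) (b := Elt.cons a l) (by simpa using hl))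
      ((h1 a l).mono ?_)
    exact hv2.trans (hv1.trans (hv'.trans hv))

end Arithmetic

end UDN

/-! ### Order, finite sequences and pairing in the generic model. -/

namespace UDN
open Tm Filter

section Lists

variable {Γ Δ : Ctx} {σ τ υ : Ty} {w v : World} {ρ : Env Γ} {ρ' : Env Δ}

/-! ### Addition and order -/

namespace Elt

noncomputable def add (m n : Elt .nat) : Elt .nat :=
  eval (Tm.add v0 v1) (Env.cons m (Env.cons n Env.nil))

noncomputable def len (s : Elt (.seq σ)) : Elt .nat := eval (Tm.len v0) (Env.cons s Env.nil)

noncomputable def get (s : Elt (.seq σ)) (i : Elt .nat) : Elt σ :=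
  eval (Tm.get v0 v1) (Env.cons s (Env.cons i Env.nil))

theorem eval_lam_congr {t : Tm (σ :: Γ) τ} {t' : Tm (σ :: Δ) τ}
    (h : ∀ d, eval t (Env.cons d ρ) = eval t' (Env.cons d ρ')) :
    eval (lam t) ρ = eval (lam t') ρ' :=
  Elt.ext fun d => by simpa using h d

theorem eval_empty (ρ : Env Γ) (σ : Ty) : eval (Tm.empty σ) ρ = eval (Tm.empty σ) Env.nil := by
  rw [← Tm.empty_subst Sub.nil σ, eval_subst_val, Sub.val_nil]

theorem add_eq (m n : Elt .nat) :
    add m n = natRec m (eval (lam (lam (Tm.succ v1))) Env.nil) n := by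
  simp only [add, Tm.add, eval_natRec, eval_var, Env.cons_here, Env.cons_there]
  rfl

theorem len_eq (s : Elt (.seq σ)) :
    len s = listRec zero (eval (lam (lam (Tm.succ v1))) Env.nil) s := by
  simp only [len, Tm.len, eval_listRec, eval_var, Env.cons_here, eval_zero]
  rfl

theorem get_eq (s : Elt (.seq σ)) (i : Elt .nat) :
    get s i = listRec (eval (lam (Tm.empty σ)) Env.nil) (eval (lam (lam (lam (Tm.natRec v1
      (lam (lam (.app (.var (.there (.there (.there (.there .here))))) v0))) v0))))
      Env.nil) s ⬝ i := by
  simp only [get, Tm.get, eval_listRec, eval_var, eval_app, Env.cons_here, Env.cons_there]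
  congr 2
  exact eval_lam_congr fun d => by rw [eval_empty, ← eval_empty]

@[simp] theorem add_zero (m : Elt .nat) : add m zero = m := by
  simp [add_eq]

@[simp] theorem add_succ (m n : Elt .nat) : add m (succ n) = succ (add m n) := by
  simp [add_eq]

@[simp] theorem len_nil : len (nil σ) = zero := by
  simp [len_eq]

@[simp] theorem len_cons (a : Elt σ) (s : Elt (.seq σ)) : len (cons a s) = succ (len s) := by
  simp [len_eq]

@[simp] theorem get_cons_zero (a : Elt σ) (s : Elt (.seq σ)) : get (cons a s) zero = a := by
  simp [get_eq]

@[simp] theorem get_cons_succ (a : Elt σ) (s : Elt (.seq σ)) (i : Elt .nat) :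
    get (cons a s) (succ i) = get s i := by
  simp [get_eq]

end Elt

@[simp] theorem eval_add (m n : Tm Γ .nat) :
    eval (Tm.add m n) ρ = Elt.add (eval m ρ) (eval n ρ) := by
  have : Tm.add m n = (Tm.add v0 v1 : Tm [.nat, .nat] _).subst
      (Sub.cons m (Sub.cons n Sub.nil)) := rfl
  rw [this, eval_subst_val]
  simp only [Elt.add, Sub.val_cons, Sub.val_nil]

@[simp] theorem eval_len (s : Tm Γ (.seq σ)) : eval (Tm.len s) ρ = Elt.len (eval s ρ) := by
  have : Tm.len s = (Tm.len v0 : Tm [.seq σ] _).subst (Sub.cons s Sub.nil) := rfl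
  rw [this, eval_subst_val]
  simp only [Elt.len, Sub.val_cons, Sub.val_nil]

@[simp] theorem eval_get (s : Tm Γ (.seq σ)) (i : Tm Γ .nat) :
    eval (Tm.get s i) ρ = Elt.get (eval s ρ) (eval i ρ) := by
  have : Tm.get s i = (Tm.get v0 v1 : Tm [.seq σ, .nat] _).subst
      (Sub.cons s (Sub.cons i Sub.nil)) := by
    rw [Tm.get_subst]; rfl
  rw [this, eval_subst_val]
  simp only [Elt.get, Sub.val_cons, Sub.val_nil]

theorem Elt.zero_add (n : Elt .nat) : add zero n = n := by
  have := Forces.nat_induction (w := World.top) (ρ := Env.nil) (n := n)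
    (φ := (Tm.add Tm.zero v0 ≐ v0)) trivial trivial ?_ ?_
  · simpa [eqAt_top_iff] using this
  · simpa using EqAt.refl _
  · intro v hv n h
    simp only [forces_eq, eval_add, eval_zero, eval_var, Env.cons_here, add_succ] at h ⊢
    exact h.app_right Const.succ.elt

theorem Elt.succ_add (m n : Elt .nat) : add (succ m) n = succ (add m n) := by
  have := Forces.nat_induction (w := World.top) (ρ := Env.cons m Env.nil) (n := n)
    (φ := (Tm.add (Tm.succ v1) v0 ≐ Tm.succ (Tm.add v1 v0))) trivial trivial ?_ ?_
  · simpa [eqAt_top_iff] using this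
  · simpa using EqAt.refl _
  · intro v hv n h
    simp only [forces_eq, eval_add, eval_succ, eval_var, Env.cons_here, add_succ,
      Env.cons_there] at h ⊢
    exact h.app_right Const.succ.elt

theorem LtAt.elim {m n : Elt .nat} (h : LtAt w m n) {C : Formula Γ}
    (h' : ∀ v, v ≤ w → ∀ k, EqAt v (Elt.succ (Elt.add m k)) n → Forces v C ρ) :
    Forces w C ρ := by
  refine Forces.ex_elim h fun v hv k hk => h' v hv k ?_
  simpa using hk

theorem LtAt.intro {m n : Elt .nat} (k : Elt .nat) (h : EqAt w (Elt.succ (Elt.add m k)) n) :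
    LtAt w m n :=
  Forces.ex_intro k (by simpa using h)

theorem LtAt.zero_succ (n : Elt .nat) : LtAt w Elt.zero (Elt.succ n) :=
  .intro n (.of_eq (by rw [Elt.zero_add]))

theorem LtAt.not_zero {m : Elt .nat} (h : LtAt w m Elt.zero) {C : Formula Γ} : Forces w C ρ :=
  h.elim fun _ _ _ hk => hk.succ_ne_zero

theorem LtAt.succ_succ {m n : Elt .nat} (h : LtAt w m n) : LtAt w (Elt.succ m) (Elt.succ n) :=
  h.elim fun _ _ k hk => LtAt.intro k (by rw [Elt.succ_add]; exact hk.app_right Const.succ.elt)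

theorem LtAt.of_succ_succ {m n : Elt .nat} (h : LtAt w (Elt.succ m) (Elt.succ n)) :
    LtAt w m n :=
  h.elim fun _ _ k hk => LtAt.intro k (by rw [Elt.succ_add] at hk; exact hk.succ_inj)

/-! ### Induction on sequences -/

/-- Induction on the length: the formula `∀ s (|s| = n → φ(s))` is again internal and `∨`-free, and
in each step the shape of the wrong length contradicts `S n ≠ 0`. -/
theorem Forces.seq_induction {φ : Formula (.seq σ :: Γ)} (hi : φ.Internal) (ho : φ.OrFree)
    (h0 : Forces w φ (Env.cons (Elt.nil σ) ρ))
    (h1 : ∀ v, v ≤ w → ∀ a s, Forces v φ (Env.cons s ρ) → Forces v φ (Env.cons (Elt.cons a s) ρ))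
    (s : Elt (.seq σ)) : Forces w φ (Env.cons s ρ) := by
  have hφ : ∀ {w} {s : Elt (.seq σ)} {n : Elt .nat}, Forces w
      (φ.rename ((Ren.shift Γ .nat).lift (.seq σ))) (Env.cons s (Env.cons n ρ)) ↔
      Forces w φ (Env.cons s ρ) := by
    intro w s n
    rw [forces_rename_val]
    exact iff_of_eq (congrArg _ (Env.ext_cons rfl fun _ _ => rfl))
  have hi' : (φ.rename ((Ren.shift Γ .nat).lift (.seq σ))).Internal := by
    rw [Formula.rename_eq_subst]; exact hi.subst _
  have ho' : (φ.rename ((Ren.shift Γ .nat).lift (.seq σ))).OrFree := by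
    rw [Formula.rename_eq_subst]; exact ho.subst _
  have key := Forces.nat_induction (w := w) (ρ := ρ) (n := Elt.len s)
    (φ := .all (.seq σ) (Tm.len v0 ≐ v1 →ᶠ φ.rename ((Ren.shift Γ .nat).lift (.seq σ))))
    ⟨trivial, hi'⟩ ⟨trivial, ho'⟩ ?_ ?_
  · exact hφ.1 (forces_imp.1 (forces_all.1 key s) w le_rfl (by simpa using EqAt.refl _))
  · rw [forces_all]
    refine Forces.seq_cases (φ := (Tm.len v0 ≐ v1 →ᶠ _)) ⟨trivial, hi'⟩ ⟨trivial, ho'⟩ ?_ ?_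
    · exact forces_imp.2 fun v hv _ => hφ.2 (h0.mono hv)
    · refine fun a s => forces_imp.2 fun v hv h => ?_
      exact EqAt.succ_ne_zero (n := Elt.len s) (by simpa using h)
  · intro v hv n ih
    rw [forces_all] at ih ⊢
    refine Forces.seq_cases (φ := (Tm.len v0 ≐ v1 →ᶠ _)) ⟨trivial, hi'⟩ ⟨trivial, ho'⟩ ?_ ?_
    · refine forces_imp.2 fun v hv h => ?_
      exact EqAt.succ_ne_zero (n := n) (EqAt.symm (by simpa using h))
    · refine fun a s => forces_imp.2 fun v' hv' h => ?_
      have h2 : EqAt v' (Elt.len s) n := EqAt.succ_inj (by simpa using h)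
      refine hφ.2 (h1 v' (hv'.trans hv) a s (hφ.1 (forces_imp.1 (ih s) v' hv' ?_)))
      simpa using h2

/-! ### Membership -/

theorem MemAt.intro {a : Elt σ} {s : Elt (.seq σ)} (i : Elt .nat) (hi : LtAt w i (Elt.len s))
    (h : EqAt w a (Elt.get s i)) : MemAt w a s := by
  refine Forces.ex_intro i ?_
  simpa using And.intro hi h

theorem MemAt.elim {a : Elt σ} {s : Elt (.seq σ)} (h : MemAt w a s) {C : Formula Γ}
    (h' : ∀ v, v ≤ w → ∀ i, LtAt v i (Elt.len s) → EqAt v a (Elt.get s i) → Forces v C ρ) :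
    Forces w C ρ := by
  refine Forces.ex_elim h fun v hv i hi => ?_
  have h1 : LtAt v i (Elt.len s) ∧ EqAt v a (Elt.get s i) := by simpa using hi
  exact h' v hv i h1.1 h1.2

theorem MemAt.cons_self (a : Elt σ) (s : Elt (.seq σ)) : MemAt w a (Elt.cons a s) :=
  .intro Elt.zero (by simpa using LtAt.zero_succ _) (by simpa using EqAt.refl _)

theorem MemAt.cons_of_mem {a : Elt σ} (b : Elt σ) {s : Elt (.seq σ)} (h : MemAt w a s) :
    MemAt w a (Elt.cons b s) :=
  h.elim fun _ _ i hi ha => MemAt.intro (Elt.succ i) (by simpa using hi.succ_succ)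
    (by simpa using ha)

theorem MemAt.not_nil {a : Elt σ} (h : MemAt w a (Elt.nil σ)) {C : Formula Γ} : Forces w C ρ :=
  h.elim fun _ _ _ hi _ => LtAt.not_zero (by simpa using hi)

/-- A case distinction on the index: zero gives the head, a successor gives an index into the tail.
The restriction on `C` comes from `Forces.nat_cases`. -/
theorem MemAt.cons_elim {a b : Elt σ} {s : Elt (.seq σ)} (h : MemAt w a (Elt.cons b s))
    {C : Formula Γ} (hi : C.Internal) (ho : C.OrFree)
    (h1 : ∀ v, v ≤ w → EqAt v a b → Forces v C ρ)
    (h2 : ∀ v, v ≤ w → MemAt v a s → Forces v C ρ) : Forces w C ρ := by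
  refine h.elim fun v hv i hi1 ha => ?_
  let ρ1 : Env (σ :: .seq σ :: Γ) := Env.cons a (Env.cons (Elt.cons b s) ρ)
  let r : Ren Γ (.nat :: σ :: .seq σ :: Γ) := fun _ x => .there (.there (.there x))
  have hC : ∀ {w i}, Forces w (C.rename r) (Env.cons i ρ1) ↔ Forces w C ρ := by
    intro w i
    rw [forces_rename_val]
    rfl
  have key := Forces.nat_cases (w := v) (ρ := ρ1) (n := i)
    (φ := (Formula.lt v0 (Tm.len v2) →ᶠ v1 ≐ Tm.get v2 v0 →ᶠ C.rename r)) ?_ ?_ ?_ ?_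
  · refine hC.1 (forces_imp.1 (forces_imp.1 key v le_rfl ?_) v le_rfl ?_)
    · simpa [ρ1] using hi1
    · simpa [ρ1] using ha
  · rw [Formula.rename_eq_subst]
    exact ⟨trivial, trivial, hi.subst _⟩
  · rw [Formula.rename_eq_subst]
    exact ⟨trivial, trivial, ho.subst _⟩
  · refine forces_imp.2 fun u1 hu1 _ => forces_imp.2 fun u2 hu2 h4 => hC.2 ?_
    exact h1 u2 (hu2.trans (hu1.trans hv)) (by simpa [ρ1] using h4)
  · refine fun i => forces_imp.2 fun u1 hu1 h3 => forces_imp.2 fun u2 hu2 h4 => hC.2 ?_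
    have h5 : LtAt u1 (Elt.succ i) (Elt.succ (Elt.len s)) := by simpa [ρ1] using h3
    refine h2 u2 (hu2.trans (hu1.trans hv)) (.intro i (h5.of_succ_succ.mono hu2) ?_)
    simpa [ρ1] using h4

/-! ### Operations on finite sequences -/

/-- Builds `⟨f 0, …, f (n - 1)⟩` by recursion on `n`, shifting `f` by one at each step. -/
def Tm.mkT (σ : Ty) : Tm [] (.arrow .nat (.arrow (.arrow .nat σ) (.seq σ))) :=
  .app (.app (.const (.natRec _)) (lam (Tm.nil σ)))
    (lam (lam (lam (Tm.cons (.app v0 Tm.zero)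
      (.app v2 (lam (.app v1 (Tm.succ v0))))))))

def Tm.appendT (σ : Ty) : Tm [] (.arrow (.seq σ) (.arrow (.seq σ) (.seq σ))) :=
  lam (lam (listRec v0 ((lam (lam (Tm.cons v0 v1)) : Tm [] _).ofClosed _) v1))

def Tm.append (s t : Tm Γ (.seq σ)) : Tm Γ (.seq σ) :=
  .app (.app ((appendT σ).ofClosed Γ) s) t

def Tm.bindT (σ τ : Ty) : Tm [] (.arrow (.seq σ) (.arrow (.arrow σ (.seq τ)) (.seq τ))) :=
  lam (lam (listRec (Tm.nil τ)
    (.app ((lam (lam (lam (Tm.append (.app v2 v0) v1))) : Tm [] _).ofClosed _) v0) v1))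

def Tm.bind (s : Tm Γ (.seq σ)) (f : Tm Γ (.arrow σ (.seq τ))) : Tm Γ (.seq τ) :=
  .app (.app ((bindT σ τ).ofClosed Γ) s) f

/-- The image of a finite sequence under a function. -/
def Tm.map (f : Tm Γ (.arrow σ τ)) (s : Tm Γ (.seq σ)) : Tm Γ (.seq τ) :=
  Tm.bind s (lam (Tm.cons (.app (f.weaken σ) v0) (Tm.nil τ)))

def Tm.singleton (a : Tm Γ σ) : Tm Γ (.seq σ) := Tm.cons a (Tm.nil σ)

namespace Elt

noncomputable def mk (n : Elt .nat) (f : Elt (.arrow .nat σ)) : Elt (.seq σ) :=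
  eval (Tm.mkT σ) Env.nil ⬝ n ⬝ f

noncomputable def append (s t : Elt (.seq σ)) : Elt (.seq σ) :=
  eval (Tm.appendT σ) Env.nil ⬝ s ⬝ t

noncomputable def bind (s : Elt (.seq σ)) (f : Elt (.arrow σ (.seq τ))) : Elt (.seq τ) :=
  eval (Tm.bindT σ τ) Env.nil ⬝ s ⬝ f

noncomputable def singleton (a : Elt σ) : Elt (.seq σ) := cons a (nil σ)

theorem mk_eq (n : Elt .nat) (f : Elt (.arrow .nat σ)) : mk n f = natRec (eval (lam (Tm.nil σ))
    Env.nil) (eval (lam (lam (lam (Tm.cons (.app v0 Tm.zero)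
      (.app v2 (lam (.app v1 (Tm.succ v0)))))))) Env.nil) n ⬝ f := by
  simp only [mk, Tm.mkT, eval_app, natRec, eval_const]

@[simp] theorem mk_zero (f : Elt (.arrow .nat σ)) : mk zero f = nil σ := by
  simp [mk_eq]

/-- By extensionality any `g` with the values of the shifted function can stand for it, so the shift
need not be mentioned as a term. -/
theorem mk_succ (n : Elt .nat) (f g : Elt (.arrow .nat σ)) (h : ∀ i, g ⬝ i = f ⬝ succ i) :
    mk (succ n) f = cons (f ⬝ zero) (mk n g) := by
  obtain rfl : g = eval (lam (.app v1 (Tm.succ v0))) (Env.cons f (Env.cons n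
    (Env.cons (natRec (eval (lam (Tm.nil σ))
    Env.nil) (eval (lam (lam (lam (Tm.cons (.app v0 Tm.zero)
      (.app v2 (lam (.app v1 (Tm.succ v0)))))))) Env.nil) n) Env.nil))) :=
    Elt.ext fun i => by simp [h]
  rw [mk_eq, mk_eq, natRec_succ]
  simp

@[simp] theorem append_nil (t : Elt (.seq σ)) : append (nil σ) t = t := by
  simp [append, Tm.appendT]

@[simp] theorem append_cons (a : Elt σ) (s t : Elt (.seq σ)) :
    append (cons a s) t = cons a (append s t) := by
  simp [append, Tm.appendT]

end Elt

@[simp] theorem eval_append (s t : Tm Γ (.seq σ)) :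
    eval (Tm.append s t) ρ = Elt.append (eval s ρ) (eval t ρ) := by
  simp [Tm.append, Elt.append]

@[simp] theorem eval_bind (s : Tm Γ (.seq σ)) (f : Tm Γ (.arrow σ (.seq τ))) :
    eval (Tm.bind s f) ρ = Elt.bind (eval s ρ) (eval f ρ) := by
  simp [Tm.bind, Elt.bind]

@[simp] theorem eval_singleton (a : Tm Γ σ) :
    eval (Tm.singleton a) ρ = Elt.singleton (eval a ρ) := by
  simp [Tm.singleton, Elt.singleton]

namespace Elt

@[simp] theorem bind_nil (f : Elt (.arrow σ (.seq τ))) : bind (nil σ) f = nil τ := by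
  simp [bind, Tm.bindT]

@[simp] theorem bind_cons (a : Elt σ) (s : Elt (.seq σ)) (f : Elt (.arrow σ (.seq τ))) :
    bind (cons a s) f = append (f ⬝ a) (bind s f) := by
  simp [bind, Tm.bindT]

theorem mk_len (s : Elt (.seq σ)) (f : Elt (.arrow .nat σ)) (h : ∀ i, f ⬝ i = get s i) :
    mk (len s) f = s := by
  have := Forces.seq_induction (w := World.top) (ρ := Env.nil) (s := s)
    (φ := (.app (.app ((Tm.mkT σ).ofClosed _) (Tm.len v0)) (lam (Tm.get v1 v0)) ≐ v0))
    trivial trivial ?_ ?_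
  · obtain rfl : f = eval (lam (Tm.get v1 v0)) (Env.cons s Env.nil) :=
      Elt.ext fun i => by simp [h]
    simpa [eqAt_top_iff, mk] using this
  · simp only [forces_eq, eval_app, eval_ofClosed, eval_len, eval_var, Env.cons_here, len_nil]
    exact .of_eq (mk_zero _)
  · intro v hv a s h
    simp only [forces_eq, eval_app, eval_ofClosed, eval_len, eval_var, Env.cons_here,
      len_cons] at h ⊢
    have h1 := mk_succ (len s) (eval (lam (Tm.get v1 v0)) (Env.cons (cons a s) Env.nil))
      (eval (lam (Tm.get v1 v0)) (Env.cons s Env.nil)) (fun i => by simp)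
    refine (EqAt.of_eq h1).trans ?_
    rw [show eval (lam (Tm.get v1 v0)) (Env.cons (cons a s) Env.nil) ⬝ zero = a by simp]
    exact h.app_right ((Const.cons σ).elt ⬝ a)

end Elt

theorem MemAt.singleton (a : Elt σ) : MemAt w a (Elt.singleton a) := .cons_self _ _

theorem internal_mem (a : Tm Γ σ) (s : Tm Γ (.seq σ)) : (Formula.mem a s).Internal :=
  ⟨trivial, trivial⟩

theorem orFree_mem (a : Tm Γ σ) (s : Tm Γ (.seq σ)) : (Formula.mem a s).OrFree :=
  ⟨trivial, trivial⟩

theorem MemAt.append_right {a : Elt σ} (s : Elt (.seq σ)) {t : Elt (.seq σ)} (h : MemAt w a t) :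
    MemAt w a (Elt.append s t) := by
  have := Forces.seq_induction (w := w) (ρ := Env.cons a (Env.cons t Env.nil)) (s := s)
    (φ := .mem v1 (Tm.append v0 v2)) (internal_mem _ _) (orFree_mem _ _) ?_ ?_
  · simpa using this
  · simpa using h
  · intro v hv b s h
    simp only [forces_mem, eval_append, eval_var, Env.cons_here, Env.cons_there,
      Elt.append_cons] at h ⊢
    exact h.cons_of_mem b

theorem MemAt.append_left {a : Elt σ} {s : Elt (.seq σ)} (t : Elt (.seq σ)) (h : MemAt w a s) :
    MemAt w a (Elt.append s t) := by
  have := Forces.seq_induction (w := w) (ρ := Env.cons a (Env.cons t Env.nil)) (s := s)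
    (φ := (.mem v1 v0 →ᶠ .mem v1 (Tm.append v0 v2))) ⟨internal_mem _ _, internal_mem _ _⟩
    ⟨orFree_mem _ _, orFree_mem _ _⟩ ?_ ?_
  · simp only [forces_imp, forces_mem, eval_append, eval_var, Env.cons_here,
      Env.cons_there] at this
    exact this w le_rfl h
  · refine forces_imp.2 fun v hv h => MemAt.not_nil (by simpa using h)
  · intro v hv b s h
    simp only [forces_imp, forces_mem, eval_append, eval_var, Env.cons_here, Env.cons_there,
      Elt.append_cons] at h ⊢
    intro u1 hu1 h1
    refine MemAt.cons_elim (C := .mem v0 v1)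
      (ρ := Env.cons a (Env.cons (Elt.cons b (Elt.append s t)) Env.nil)) h1 (internal_mem _ _)
      (orFree_mem _ _) ?_ ?_
    · exact fun u2 hu2 h2 => h2.symm.memAt (.cons_self _ _)
    · exact fun u2 hu2 h2 => (h u2 (hu2.trans hu1) h2).cons_of_mem b

theorem MemAt.bind {a : Elt σ} {s : Elt (.seq σ)} {f : Elt (.arrow σ (.seq τ))} {b : Elt τ}
    (ha : MemAt w a s) (hb : MemAt w b (f ⬝ a)) : MemAt w b (Elt.bind s f) := by
  have := Forces.seq_induction (w := w)
    (ρ := Env.cons a (Env.cons f (Env.cons b Env.nil))) (s := s)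
    (φ := (.mem v1 v0 →ᶠ .mem (.var (.there (.there (.there .here)))) (Tm.bind v0 v2)))
    ⟨internal_mem _ _, internal_mem _ _⟩
    ⟨orFree_mem _ _, orFree_mem _ _⟩ ?_ ?_
  · simp only [forces_imp, forces_mem, eval_bind, eval_var, Env.cons_here,
      Env.cons_there] at this
    exact this w le_rfl ha
  · refine forces_imp.2 fun v hv h => MemAt.not_nil (by simpa using h)
  · intro v hv c s h
    simp only [forces_imp, forces_mem, eval_bind, eval_var, Env.cons_here, Env.cons_there,
      Elt.bind_cons] at h ⊢
    intro u1 hu1 h1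
    refine MemAt.cons_elim (C := .mem v0 v1)
      (ρ := Env.cons b (Env.cons (Elt.append (f ⬝ c) (Elt.bind s f)) Env.nil))
      h1 (internal_mem _ _)
      (orFree_mem _ _) ?_ ?_
    · intro u2 hu2 h2
      have h3 := h2.forces (A := .mem v2 (.app v1 v0)) (ρ := Env.cons f (Env.cons b Env.nil))
        (by simpa using hb.mono (hu2.trans (hu1.trans hv)))
      exact MemAt.append_left (a := b) _ (by simpa using h3)
    · exact fun u2 hu2 h2 => MemAt.append_right (a := b) _ (h u2 (hu2.trans hu1) h2)

theorem MemAt.map {t : Tm Γ (.arrow σ τ)} {s : Tm Γ (.seq σ)} {l : Elt (.seq σ)} {a : Elt σ}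
    {b : Elt τ} (ha : MemAt w a l) (hl : eval s ρ = l) (hb : eval t ρ ⬝ a = b) :
    MemAt w b (eval (Tm.map t s) ρ) := by
  subst hl
  rw [Tm.map, eval_bind]
  refine ha.bind ?_
  simpa [Tm.weaken, hb] using MemAt.cons_self _ _

/-! ### Pairs -/

/-- A type coding the product of two types. -/
abbrev Ty.prod (σ τ : Ty) : Ty := .arrow (.arrow σ (.arrow τ .nat)) .nat

/-- The term recovering `a` from `λ k. k a`. -/
def Tm.extractT : (σ : Ty) → Tm [] (.arrow (.arrow (.arrow σ .nat) .nat) σ)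
  | .nat => lam (.app v0 (lam v0))
  | .arrow _ τ => lam (lam (.app ((extractT τ).ofClosed _)
      (lam (.app v2 (lam (.app v1 (.app v0 (.var (.there (.there .here))))))))))
  | .seq σ => lam (.app (.app ((mkT _).ofClosed _) (.app v0 (lam (Tm.len v0))))
      (lam (.app ((extractT σ).ofClosed _)
        (lam (.app v2 (lam (.app v1 (Tm.get v0 v2))))))))

/-- Continuations return only numbers, so `a` is recovered by recursion on its type: at `0` use the
identity; at an arrow type recover each value `a b`; at a sequence type read off the length, recover
each entry, and rebuild by `mk`. This makes the functional `λ k. k a b` a faithful code of a pair in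
a language without products. -/
theorem eval_extractT (P : Elt (.arrow (.arrow σ .nat) .nat)) (a : Elt σ)
    (h : ∀ k, P ⬝ k = k ⬝ a) : eval (Tm.extractT σ) Env.nil ⬝ P = a := by
  induction σ with
  | nat => simp [Tm.extractT, h]
  | arrow _ _ _ ih =>
    refine Elt.ext fun b => ?_
    simp only [Tm.extractT, eval_lam, eval_app, eval_ofClosed]
    exact ih _ _ fun k => by simp [h]
  | seq σ ih =>
    simp only [Tm.extractT, eval_lam, eval_app, eval_ofClosed]
    simp only [eval_var, Env.cons_here, h, eval_lam, eval_len]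
    refine Elt.mk_len _ _ fun i => ?_
    simp only [eval_lam, eval_app, eval_ofClosed]
    exact ih _ _ fun k => by simp [h]

/-- Pairing and projections are closed terms applied to arguments. Closed terms are fixed by
substitution, whereas defined abstractions with parameters are not stable under it, and matrices
must commute with substitution on the nose. -/
def Tm.pairT (σ τ : Ty) : Tm [] (.arrow σ (.arrow τ (.prod σ τ))) :=
  lam (lam (lam (.app (.app v0 v2) v1)))

def Tm.fstT (σ τ : Ty) : Tm [] (.arrow (.prod σ τ) σ) :=
  lam (.app ((extractT σ).ofClosed _) (lam (.app v1 (lam (lam (.app v2 v1))))))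

def Tm.sndT (σ τ : Ty) : Tm [] (.arrow (.prod σ τ) τ) :=
  lam (.app ((extractT τ).ofClosed _) (lam (.app v1 (lam (lam (.app v2 v0))))))

def Tm.pair (a : Tm Γ σ) (b : Tm Γ τ) : Tm Γ (.prod σ τ) :=
  .app (.app ((pairT σ τ).ofClosed Γ) a) b

def Tm.fst (p : Tm Γ (.prod σ τ)) : Tm Γ σ := .app ((fstT σ τ).ofClosed Γ) p

def Tm.snd (p : Tm Γ (.prod σ τ)) : Tm Γ τ := .app ((sndT σ τ).ofClosed Γ) p

namespace Elt

noncomputable def pair (a : Elt σ) (b : Elt τ) : Elt (.prod σ τ) :=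
  eval (Tm.pairT σ τ) Env.nil ⬝ a ⬝ b

noncomputable def fst (p : Elt (.prod σ τ)) : Elt σ := eval (Tm.fstT σ τ) Env.nil ⬝ p

noncomputable def snd (p : Elt (.prod σ τ)) : Elt τ := eval (Tm.sndT σ τ) Env.nil ⬝ p

@[simp] theorem fst_pair (a : Elt σ) (b : Elt τ) : fst (pair a b) = a := by
  simp only [fst, Tm.fstT, eval_lam, eval_app, eval_ofClosed]
  exact eval_extractT _ _ fun k => by simp [pair, Tm.pairT]

@[simp] theorem snd_pair (a : Elt σ) (b : Elt τ) : snd (pair a b) = b := by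
  simp only [snd, Tm.sndT, eval_lam, eval_app, eval_ofClosed]
  exact eval_extractT _ _ fun k => by simp [pair, Tm.pairT]

end Elt

@[simp] theorem eval_pair (a : Tm Γ σ) (b : Tm Γ τ) :
    eval (Tm.pair a b) ρ = Elt.pair (eval a ρ) (eval b ρ) := by
  simp [Tm.pair, Elt.pair]

@[simp] theorem eval_fst (p : Tm Γ (.prod σ τ)) : eval (Tm.fst p) ρ = Elt.fst (eval p ρ) := by
  simp [Tm.fst, Elt.fst]

@[simp] theorem eval_snd (p : Tm Γ (.prod σ τ)) : eval (Tm.snd p) ρ = Elt.snd (eval p ρ) := by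
  simp [Tm.snd, Elt.snd]

theorem StAt.pair {a : Elt σ} {b : Elt τ} (ha : StAt w a) (hb : StAt w b) :
    StAt w (Elt.pair a b) := ((StAt.closed _).app ha).app hb

theorem StAt.fst {p : Elt (.prod σ τ)} (h : StAt w p) : StAt w (Elt.fst p) :=
  (StAt.closed _).app h

theorem StAt.snd {p : Elt (.prod σ τ)} (h : StAt w p) : StAt w (Elt.snd p) :=
  (StAt.closed _).app h

end Lists

end UDN

/-! ### The uniform Diller–Nahm interpretation and its stability under substitution. -/

namespace UDN
open Tm Filter

/-! ### Interpretations -/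

/-- An interpretation `∃ˢᵗ x : W ∀ˢᵗ y : C φ(x, y)`, given by the type `W` of witnesses, the type
`C` of counterexamples, and the matrix `φ`. -/
structure Interp (Γ : Ctx) where
  W : Ty
  C : Ty
  φ : Formula (C :: W :: Γ)

section

variable {Γ Δ : Ctx} {σ τ υ : Ty} {w v : World} {ρ : Env Γ}

def Ren.shift₂ (Γ : Ctx) (σ τ : Ty) : Ren Γ (σ :: τ :: Γ) := fun _ x => .there (.there x)
def Ren.shift₃ (Γ : Ctx) (σ τ υ : Ty) : Ren Γ (σ :: τ :: υ :: Γ) :=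
  fun _ x => .there (.there (.there x))
def Ren.shift₄ (Γ : Ctx) (σ τ υ κ : Ty) : Ren Γ (σ :: τ :: υ :: κ :: Γ) :=
  fun _ x => .there (.there (.there (.there x)))

@[simp] theorem Ren.val_shift₂ (a : Elt σ) (b : Elt τ) :
    (Ren.shift₂ Γ σ τ).val (Env.cons a (Env.cons b ρ)) = ρ := rfl
@[simp] theorem Ren.val_shift₃ (a : Elt σ) (b : Elt τ) (c : Elt υ) :
    (Ren.shift₃ Γ σ τ υ).val (Env.cons a (Env.cons b (Env.cons c ρ))) = ρ := rfl
@[simp] theorem Ren.val_shift₄ {κ : Ty} (a : Elt σ) (b : Elt τ) (c : Elt υ) (d : Elt κ) :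
    (Ren.shift₄ Γ σ τ υ κ).val (Env.cons a (Env.cons b (Env.cons c (Env.cons d ρ)))) = ρ := rfl

namespace Interp

/-- `x` and `y` satisfy the matrix. -/
def Holds (I : Interp Γ) (w : World) (ρ : Env Γ) (x : Elt I.W) (y : Elt I.C) : Prop :=
  Forces w I.φ (Env.cons y (Env.cons x ρ))

theorem Holds.mono {I : Interp Γ} {x : Elt I.W} {y : Elt I.C} (h : I.Holds w ρ x y)
    (hv : v ≤ w) : I.Holds v ρ x y := Forces.mono h hv

/-- `I` has a closed witness. -/
def Realized (I : Interp Γ) : Prop :=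
  ∃ t : Tm [] I.W, ∀ (w : World) (ρ : Env Γ) (y : Elt I.C), I.Holds w ρ (eval t Env.nil) y

/-- The matrix is internal and `∨`-free. -/
def IsInternal (I : Interp Γ) : Prop := I.φ.Internal ∧ I.φ.OrFree

@[reducible] def subst (I : Interp Γ) (s : Sub Γ Δ) : Interp Δ :=
  ⟨I.W, I.C, I.φ.subst ((s.lift _).lift _)⟩

-- Neither side carries information; the types `0` are dummies.
@[reducible] def atom (A : Formula Γ) : Interp Γ := ⟨.nat, .nat, A.subst (.ofRen (.shift₂ _ _ _))⟩

-- The witness of standardness is the element itself.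
@[reducible] def st (a : Tm Γ σ) : Interp Γ := ⟨σ, .nat, v1 ≐ a.subst (.ofRen (.shift₂ _ _ _))⟩

@[reducible] def and (I J : Interp Γ) : Interp Γ :=
  ⟨.prod I.W J.W, .prod I.C J.C,
    I.φ.subst (.cons (fst v0) (.cons (fst v1) (.ofRen (.shift₂ _ _ _)))) ∧ᶠ
      J.φ.subst (.cons (snd v0) (.cons (snd v1) (.ofRen (.shift₂ _ _ _))))⟩

-- A number flags the disjunct, zero meaning the left one. Two implications express the choice,
-- which keeps the matrix free of `∨`.
@[reducible] def or (I J : Interp Γ) : Interp Γ :=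
  ⟨.prod .nat (.prod I.W J.W), .prod I.C J.C,
    (fst v1 ≐ zero →ᶠ
      I.φ.subst (.cons (fst v0) (.cons (fst (snd v1)) (.ofRen (.shift₂ _ _ _))))) ∧ᶠ
    ((fst v1 ≐ zero).neg →ᶠ
      J.φ.subst (.cons (snd v0) (.cons (snd (snd v1)) (.ofRen (.shift₂ _ _ _)))))⟩

-- The second component of a witness returns a finite sequence of counterexamples to the premise, of
-- which one must succeed if the conclusion fails. With a single counterexample, contraction would
-- require decidable matrices.
@[reducible] def imp (I J : Interp Γ) : Interp Γ :=
  ⟨.prod (.arrow I.W J.W) (.arrow I.W (.arrow J.C (.seq I.C))), .prod I.W J.C,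
    .all I.C (.mem v0 (.app (.app (snd v2) (fst v1)) (snd v1)) →ᶠ
      I.φ.subst (.cons v0 (.cons (fst v1) (.ofRen (.shift₃ _ _ _ _))))) →ᶠ
    J.φ.subst (.cons (snd v0) (.cons (.app (fst v1) (fst v0)) (.ofRen (.shift₂ _ _ _))))⟩

-- Uniformity: witness and counterexample may not depend on the quantified element.
@[reducible] def all (σ : Ty) (I : Interp (σ :: Γ)) : Interp Γ :=
  ⟨I.W, I.C, .all σ (I.φ.subst (.cons v1 (.cons v2 (.cons v0 (.ofRen (.shift₃ _ _ _ _))))))⟩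

-- No witness is recorded, so an element must withstand a whole finite sequence of counterexamples
-- at once. Overspill later supplies one that withstands all standard counterexamples.
@[reducible] def ex (σ : Ty) (I : Interp (σ :: Γ)) : Interp Γ :=
  ⟨I.W, .seq I.C, .ex σ (.all I.C (.mem v0 v2 →ᶠ I.φ.subst
    (.cons v0 (.cons (.var (.there (.there (.there .here)))) (.cons v1
      (.ofRen (.shift₄ _ _ _ _ _)))))))⟩

@[reducible] def allSt (σ : Ty) (I : Interp (σ :: Γ)) : Interp Γ :=
  ⟨.arrow σ I.W, .prod σ I.C, I.φ.subst
    (.cons (snd v0) (.cons (.app v1 (fst v0)) (.cons (fst v0) (.ofRen (.shift₂ _ _ _)))))⟩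

@[reducible] def exSt (σ : Ty) (I : Interp (σ :: Γ)) : Interp Γ :=
  ⟨.prod σ I.W, I.C, I.φ.subst
    (.cons v0 (.cons (snd v1) (.cons (fst v1) (.ofRen (.shift₂ _ _ _)))))⟩

/-! The meaning of the matrices -/

section Meaning

variable {A : Formula Γ} {I J : Interp Γ} {K : Interp (σ :: Γ)}

@[simp] theorem holds_subst {s : Sub Γ Δ} {ρ : Env Δ} {x : Elt I.W} {y : Elt I.C} :
    (I.subst s).Holds w ρ x y ↔ I.Holds w (s.val ρ) x y := by
  simp only [Holds, subst, forces_subst_val, Sub.val_lift]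

@[simp] theorem holds_atom {x y : Elt .nat} : (atom A).Holds w ρ x y ↔ Forces w A ρ := by
  simp [Holds, atom]

@[simp] theorem holds_st {a : Tm Γ σ} {x : Elt σ} {y : Elt .nat} :
    (st a).Holds w ρ x y ↔ EqAt w x (eval a ρ) := by
  simp [Holds, st]

@[simp] theorem holds_and {x : Elt (.prod I.W J.W)} {y : Elt (.prod I.C J.C)} :
    (I.and J).Holds w ρ x y ↔
      I.Holds w ρ (Elt.fst x) (Elt.fst y) ∧ J.Holds w ρ (Elt.snd x) (Elt.snd y) := by
  simp [Holds, and]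

theorem holds_or {x : Elt (.prod .nat (.prod I.W J.W))} {y : Elt (.prod I.C J.C)} :
    (I.or J).Holds w ρ x y ↔
      (∀ v, v ≤ w → EqAt v (Elt.fst x) Elt.zero →
        I.Holds v ρ (Elt.fst (Elt.snd x)) (Elt.fst y)) ∧
      (∀ v, v ≤ w → (∀ u, u ≤ v → EqAt u (Elt.fst x) Elt.zero →
        Forces u (.bot : Formula []) Env.nil) →
        J.Holds v ρ (Elt.snd (Elt.snd x)) (Elt.snd y)) := by
  have hb : ∀ {Δ : Ctx} {ρ : Env Δ} {u}, Forces u .bot ρ ↔ Forces u (.bot : Formula []) Env.nil :=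
    ⟨Forces.bot_elim, Forces.bot_elim⟩
  simp only [Holds, or, forces_and, forces_imp, hb]
  simp

@[simp] theorem holds_imp {x : Elt (.prod (.arrow I.W J.W) (.arrow I.W (.arrow J.C (.seq I.C))))}
    {y : Elt (.prod I.W J.C)} :
    (I.imp J).Holds w ρ x y ↔ ∀ v, v ≤ w →
      (∀ z u, u ≤ v → MemAt u z (Elt.snd x ⬝ Elt.fst y ⬝ Elt.snd y) →
        I.Holds u ρ (Elt.fst y) z) →
      J.Holds v ρ (Elt.fst x ⬝ Elt.fst y) (Elt.snd y) := by
  simp [Holds, imp]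

@[simp] theorem holds_all {x : Elt K.W} {y : Elt K.C} :
    (all σ K).Holds w ρ x y ↔ ∀ d, K.Holds w (Env.cons d ρ) x y := by
  simp [Holds, all]

theorem Holds.ex_intro {x : Elt K.W} {y : Elt (.seq K.C)} (d : Elt σ)
    (h : ∀ z v, v ≤ w → MemAt v z y → K.Holds v (Env.cons d ρ) x z) :
    (ex σ K).Holds w ρ x y := by
  refine Forces.ex_intro d ?_
  change Forces w (.all K.C _) (.cons (Γ := .seq K.C :: K.W :: Γ) d
    (.cons (τ := .seq K.C) (Γ := K.W :: Γ) y (.cons (τ := K.W) x ρ)))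
  simpa [Holds] using h

theorem Holds.ex_elim {x : Elt K.W} {y : Elt (.seq K.C)} (h : (ex σ K).Holds w ρ x y)
    {C : Formula Δ} {ρ' : Env Δ}
    (h' : ∀ v, v ≤ w → ∀ d, (∀ z u, u ≤ v → MemAt u z y → K.Holds u (Env.cons d ρ) x z) →
      Forces v C ρ') : Forces w C ρ' := by
  refine Forces.ex_elim h fun v hv d hd => h' v hv d ?_
  change Forces v (.all K.C _) (.cons (Γ := .seq K.C :: K.W :: Γ) d
    (.cons (τ := .seq K.C) (Γ := K.W :: Γ) y (.cons (τ := K.W) x ρ))) at hd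
  simpa [Holds] using hd

@[simp] theorem holds_allSt {x : Elt (.arrow σ K.W)} {y : Elt (.prod σ K.C)} :
    (allSt σ K).Holds w ρ x y ↔
      K.Holds w (Env.cons (Elt.fst y) ρ) (x ⬝ Elt.fst y) (Elt.snd y) := by
  simp [Holds, allSt]

@[simp] theorem holds_exSt {x : Elt (.prod σ K.W)} {y : Elt K.C} :
    (exSt σ K).Holds w ρ x y ↔ K.Holds w (Env.cons (Elt.fst x) ρ) (Elt.snd x) y := by
  simp [Holds, exSt]

end Meaning

/-! Substitution -/

section Subst

variable (s : Sub Γ Δ) (I J : Interp Γ) (K : Interp (σ :: Γ))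

theorem _root_.UDN.Tm.app_subst (f : Tm Γ (.arrow σ τ)) (a : Tm Γ σ) :
    (Tm.app f a).subst s = .app (f.subst s) (a.subst s) := rfl

theorem _root_.UDN.Tm.fst_subst (p : Tm Γ (.prod σ τ)) : (fst p).subst s = fst (p.subst s) := by
  simp only [fst, Tm.subst, Tm.ofClosed_subst]

theorem _root_.UDN.Tm.snd_subst (p : Tm Γ (.prod σ τ)) : (snd p).subst s = snd (p.subst s) := by
  simp only [snd, Tm.subst, Tm.ofClosed_subst]

theorem _root_.UDN.Sub.cons_comp {Θ : Ctx} (a : Tm Δ τ) (t : Sub Δ Θ) :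
    (Sub.cons a s).comp t = Sub.cons (a.subst t) (s.comp t) :=
  Sub.ext_cons rfl fun _ _ => rfl

theorem _root_.UDN.Sub.lift_comp_cons {Θ : Ctx} (a : Tm Θ τ) (t : Sub Δ Θ) :
    (s.lift τ).comp (Sub.cons a t) = Sub.cons a (s.comp t) :=
  Sub.ext_cons rfl fun _ _ => Tm.weaken_subst_cons _ _ _

theorem _root_.UDN.Sub.shift_lift_comp₂ : (Sub.ofRen (.shift₂ Γ σ τ)).comp ((s.lift τ).lift σ) =
    s.comp (.ofRen (.shift₂ Δ σ τ)) := by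
  funext υ x
  simp only [Sub.comp, Sub.ofRen, Ren.shift₂, Tm.subst, Sub.lift, Tm.weaken, Tm.rename_eq_subst,
    Tm.subst_subst]
  rfl

theorem _root_.UDN.Sub.shift_lift_comp₃ :
    (Sub.ofRen (.shift₃ Γ σ τ υ)).comp (((s.lift υ).lift τ).lift σ) =
      s.comp (.ofRen (.shift₃ Δ σ τ υ)) := by
  funext υ x
  simp only [Sub.comp, Sub.ofRen, Ren.shift₃, Tm.subst, Sub.lift, Tm.weaken, Tm.rename_eq_subst,
    Tm.subst_subst]
  rfl

theorem _root_.UDN.Sub.shift_lift_comp₄ {κ : Ty} :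
    (Sub.ofRen (.shift₄ Γ σ τ υ κ)).comp ((((s.lift κ).lift υ).lift τ).lift σ) =
      s.comp (.ofRen (.shift₄ Δ σ τ υ κ)) := by
  funext υ x
  simp only [Sub.comp, Sub.ofRen, Ren.shift₄, Tm.subst, Sub.lift, Tm.weaken, Tm.rename_eq_subst,
    Tm.subst_subst]
  rfl

theorem _root_.UDN.Tm.v0_subst_lift : (v0 : Tm (σ :: Γ) σ).subst (s.lift σ) = v0 := rfl
theorem _root_.UDN.Tm.v1_subst_lift :
    (v1 : Tm (τ :: σ :: Γ) σ).subst ((s.lift σ).lift τ) = v1 := rfl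
theorem _root_.UDN.Tm.v2_subst_lift :
    (v2 : Tm (υ :: τ :: σ :: Γ) σ).subst (((s.lift σ).lift τ).lift υ) = v2 := rfl
theorem _root_.UDN.Tm.v3_subst_lift {κ : Ty} :
    (.var (.there (.there (.there .here))) : Tm (κ :: υ :: τ :: σ :: Γ) σ).subst
      ((((s.lift σ).lift τ).lift υ).lift κ) = .var (.there (.there (.there .here))) := rfl
theorem _root_.UDN.Tm.zero_subst : (Tm.zero : Tm Γ _).subst s = Tm.zero := rfl

theorem atom_subst (A : Formula Γ) : (atom A).subst s = atom (A.subst s) := by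
  simp only [atom, subst, Formula.subst_subst, Sub.shift_lift_comp₂]

theorem st_subst (a : Tm Γ σ) : (st a).subst s = st (a.subst s) := by
  simp only [st, subst, Formula.subst, Tm.subst_subst, Sub.shift_lift_comp₂, Tm.v1_subst_lift]

theorem and_subst : (I.and J).subst s = (I.subst s).and (J.subst s) := by
  simp only [and, subst, Formula.subst, Formula.subst_subst, Sub.cons_comp, Sub.shift_lift_comp₂,
    Sub.lift_comp_cons, Tm.v0_subst_lift, Tm.v1_subst_lift, Tm.fst_subst, Tm.snd_subst]

theorem or_subst : (I.or J).subst s = (I.subst s).or (J.subst s) := by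
  simp only [or, subst, Formula.subst, Formula.subst_subst, Sub.cons_comp, Sub.shift_lift_comp₂,
    Sub.lift_comp_cons, Tm.v0_subst_lift, Tm.v1_subst_lift, Tm.fst_subst, Tm.snd_subst,
    Tm.zero_subst]

theorem imp_subst : (I.imp J).subst s = (I.subst s).imp (J.subst s) := by
  simp only [imp, subst, Formula.subst, Formula.subst_subst, Sub.cons_comp, Sub.shift_lift_comp₂,
    Sub.shift_lift_comp₃, Formula.mem_subst, Tm.app_subst, Tm.v2_subst_lift,
    Sub.lift_comp_cons, Tm.v0_subst_lift, Tm.v1_subst_lift, Tm.fst_subst, Tm.snd_subst]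

theorem all_subst : (all σ K).subst s = all σ (K.subst (s.lift σ)) := by
  simp only [all, subst, Formula.subst, Formula.subst_subst, Sub.cons_comp,
    Sub.shift_lift_comp₃, Tm.v2_subst_lift,
    Sub.lift_comp_cons, Tm.v0_subst_lift, Tm.v1_subst_lift]

theorem ex_subst : (ex σ K).subst s = ex σ (K.subst (s.lift σ)) := by
  simp only [ex, subst, Formula.subst, Formula.subst_subst, Sub.cons_comp, Formula.mem_subst,
    Sub.shift_lift_comp₄, Tm.v2_subst_lift, Tm.v3_subst_lift,
    Sub.lift_comp_cons, Tm.v0_subst_lift, Tm.v1_subst_lift]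

theorem allSt_subst : (allSt σ K).subst s = allSt σ (K.subst (s.lift σ)) := by
  simp only [allSt, subst, Formula.subst_subst, Sub.cons_comp, Sub.shift_lift_comp₂, Tm.app_subst,
    Sub.lift_comp_cons, Tm.v0_subst_lift, Tm.v1_subst_lift, Tm.fst_subst, Tm.snd_subst]

theorem exSt_subst : (exSt σ K).subst s = exSt σ (K.subst (s.lift σ)) := by
  simp only [exSt, subst, Formula.subst_subst, Sub.cons_comp, Sub.shift_lift_comp₂,
    Sub.lift_comp_cons, Tm.v0_subst_lift, Tm.v1_subst_lift, Tm.fst_subst, Tm.snd_subst]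

end Subst

section IsInternal

variable {I J : Interp Γ} {K : Interp (σ :: Γ)}

theorem IsInternal.atom {A : Formula Γ} (hi : A.Internal) (ho : A.OrFree) :
    (atom A).IsInternal := ⟨hi.subst _, ho.subst _⟩

theorem IsInternal.st (a : Tm Γ σ) : (st a).IsInternal := ⟨trivial, trivial⟩

theorem IsInternal.and (hI : I.IsInternal) (hJ : J.IsInternal) : (I.and J).IsInternal :=
  ⟨⟨hI.1.subst _, hJ.1.subst _⟩, ⟨hI.2.subst _, hJ.2.subst _⟩⟩

theorem IsInternal.or (hI : I.IsInternal) (hJ : J.IsInternal) : (I.or J).IsInternal :=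
  ⟨⟨⟨trivial, hI.1.subst _⟩, ⟨trivial, trivial⟩, hJ.1.subst _⟩,
    ⟨⟨trivial, hI.2.subst _⟩, ⟨trivial, trivial⟩, hJ.2.subst _⟩⟩

theorem IsInternal.imp (hI : I.IsInternal) (hJ : J.IsInternal) : (I.imp J).IsInternal :=
  ⟨⟨⟨internal_mem _ _, hI.1.subst _⟩, hJ.1.subst _⟩,
    ⟨⟨orFree_mem _ _, hI.2.subst _⟩, hJ.2.subst _⟩⟩

theorem IsInternal.all (hK : K.IsInternal) : (all σ K).IsInternal :=
  ⟨hK.1.subst _, hK.2.subst _⟩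

theorem IsInternal.ex (hK : K.IsInternal) : (ex σ K).IsInternal :=
  ⟨⟨internal_mem _ _, hK.1.subst _⟩, ⟨orFree_mem _ _, hK.2.subst _⟩⟩

theorem IsInternal.allSt (hK : K.IsInternal) : (allSt σ K).IsInternal :=
  ⟨hK.1.subst _, hK.2.subst _⟩

theorem IsInternal.exSt (hK : K.IsInternal) : (exSt σ K).IsInternal :=
  ⟨hK.1.subst _, hK.2.subst _⟩

end IsInternal

end Interp

/-- The uniform Diller-Nahm interpretation of a formula. -/
def Formula.interp : {Γ : Ctx} → Formula Γ → Interp Γ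
  | _, .bot => .atom .bot
  | _, .eq a b => .atom (.eq a b)
  | _, .st a => .st a
  | _, .and A B => A.interp.and B.interp
  | _, .or A B => A.interp.or B.interp
  | _, .imp A B => A.interp.imp B.interp
  | _, .all σ A => .all σ A.interp
  | _, .ex σ A => .ex σ A.interp
  | _, .allSt σ A => .allSt σ A.interp
  | _, .exSt σ A => .exSt σ A.interp

/-- A syntactic identity, so realizers for instances and weakenings in axioms and rules need no
transport between different witness types. -/
theorem Formula.interp_subst (s : Sub Γ Δ) (A : Formula Γ) :
    (A.subst s).interp = A.interp.subst s := by
  induction A generalizing Δ with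
  | bot => simp only [Formula.subst, Formula.interp, Interp.atom_subst]
  | eq a b => simp only [Formula.subst, Formula.interp, Interp.atom_subst]
  | st a => simp only [Formula.subst, Formula.interp, Interp.st_subst]
  | and A B hA hB => simp only [Formula.subst, Formula.interp, Interp.and_subst, hA, hB]
  | or A B hA hB => simp only [Formula.subst, Formula.interp, Interp.or_subst, hA, hB]
  | imp A B hA hB => simp only [Formula.subst, Formula.interp, Interp.imp_subst, hA, hB]
  | all σ A hA => simp only [Formula.subst, Formula.interp, Interp.all_subst, hA]
  | ex σ A hA => simp only [Formula.subst, Formula.interp, Interp.ex_subst, hA]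
  | allSt σ A hA => simp only [Formula.subst, Formula.interp, Interp.allSt_subst, hA]
  | exSt σ A hA => simp only [Formula.subst, Formula.interp, Interp.exSt_subst, hA]

theorem Formula.interp_rename (r : Ren Γ Δ) (A : Formula Γ) :
    (A.rename r).interp = A.interp.subst (.ofRen r) := by
  rw [Formula.rename_eq_subst, Formula.interp_subst]

theorem Formula.isInternal_interp (A : Formula Γ) : A.interp.IsInternal := by
  induction A with
  | bot => exact .atom trivial trivial
  | eq a b => exact .atom trivial trivial
  | st a => exact .st a
  | and A B hA hB => exact hA.and hB
  | or A B hA hB => exact hA.or hB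
  | imp A B hA hB => exact hA.imp hB
  | all σ A hA => exact hA.all
  | ex σ A hA => exact hA.ex
  | allSt σ A hA => exact hA.allSt
  | exSt σ A hA => exact hA.exSt

end

end UDN

/-! ### Soundness for logic and for internal axioms. -/

namespace UDN
open Tm Filter

namespace Tm

abbrev v3 {Γ : Ctx} {σ τ υ κ : Ty} : Tm (κ :: υ :: τ :: σ :: Γ) σ :=
  .var (.there (.there (.there .here)))
abbrev v4 {Γ : Ctx} {σ τ υ κ ι : Ty} : Tm (ι :: κ :: υ :: τ :: σ :: Γ) σ :=
  .var (.there (.there (.there (.there .here))))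

end Tm

attribute [local irreducible] eval Forces Elt.app Elt.pair Elt.fst Elt.snd

namespace Interp

variable {Γ Δ : Ctx} {σ τ υ : Ty} {w v : World} {ρ : Env Γ} {I J K : Interp Γ}

/-- `X` computes the new witness from the old one, and `Y` computes the counterexamples to the
premise; in the context of `Y` the counterexample to the conclusion is innermost. -/
theorem Realized.imp_of (X : Tm [I.W] J.W) (Y : Tm [J.C, I.W] (.seq I.C))
    (h : ∀ (w : World) (ρ : Env Γ) (x : Elt I.W) (y : Elt J.C),
      (∀ z u, u ≤ w → MemAt u z (eval Y (.cons y (.cons x .nil))) → I.Holds u ρ x z) →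
      J.Holds w ρ (eval X (.cons x .nil)) y) : (I.imp J).Realized := by
  refine ⟨pair (lam X) (lam (lam Y)), fun w ρ y => ?_⟩
  rw [eval_pair, holds_imp]
  simp only [Elt.fst_pair, Elt.snd_pair, eval_lam]
  exact fun v _ hv => h v ρ _ _ hv

theorem Realized.mp (h : (I.imp J).Realized) (h' : I.Realized) : J.Realized := by
  obtain ⟨t, ht⟩ := h
  obtain ⟨a, ha⟩ := h'
  refine ⟨.app (fst t) a, fun w ρ y => ?_⟩
  have h1 := ht w ρ (Elt.pair (eval a Env.nil) y)
  rw [holds_imp] at h1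
  simp only [Elt.fst_pair, Elt.snd_pair] at h1
  rw [eval_app, eval_fst]
  exact h1 w le_rfl fun z u _ _ => ha u ρ z

theorem Realized.imp_k : (I.imp (J.imp I)).Realized := by
  refine .imp_of (pair (lam v1) (lam (lam (nil _)))) (singleton (snd v0)) fun w ρ x y h => ?_
  simp only [holds_imp, eval_pair, Elt.fst_pair, eval_lam, eval_var, Env.cons_there,
    Env.cons_here]
  exact fun v hv _ => h _ v hv (by simpa using MemAt.singleton _)

/-- Contraction: the premise `I` is used directly and again to obtain `J`. Its counterexamples are
therefore a concatenation: those requested by the first implication, and, for every counterexample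
to `J`, those requested by the second. -/
theorem Realized.imp_s : ((I.imp (J.imp K)).imp ((I.imp J).imp (I.imp K))).Realized := by
  refine .imp_of (pair
      (lam (pair (lam (.app (fst (.app (fst v2) v0)) (.app (fst v1) v0)))
        (lam (lam (append (.app (.app (snd v3) v1) (pair (.app (fst v2) v1) v0))
          (bind (.app (.app (snd (.app (fst v3) v1)) (.app (fst v2) v1)) v0)
            (.app (snd v2) v1)))))))
      (lam (lam (map (lam (pair (fst v1) v0))
        (.app (.app (snd (.app (fst v2) (fst v0))) (.app (fst v1) (fst v0))) (snd v0))))))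
    (singleton (pair (fst (snd v0)) (pair (.app (fst (fst v0)) (fst (snd v0))) (snd (snd v0)))))
    fun w ρ f y h => ?_
  simp only [holds_imp, eval_pair, Elt.fst_pair, Elt.snd_pair, eval_lam, eval_var, eval_app,
    eval_fst,
    eval_snd, eval_append, eval_bind, eval_singleton, Env.cons_there, Env.cons_here] at h ⊢
  intro v hv hG u hu hI
  have h1 := h _ v hv (.singleton _)
  simp only [Elt.fst_pair, Elt.snd_pair] at h1
  refine h1 u hu (fun z u' hu' hz => hI z u' hu' (.append_left _ hz)) u le_rfl
    fun z u' hu' hz => ?_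
  have h2 := hG (Elt.pair (Elt.fst (Elt.snd y)) z) u' (hu'.trans hu) (.map hz (by simp) (by simp))
  simp only [Elt.fst_pair, Elt.snd_pair] at h2
  exact h2 u' le_rfl fun z' u'' hu'' hz' =>
    hI z' u'' (hu''.trans hu') (.append_right _ ((hz.mono hu'').bind hz'))

theorem Realized.bot_elim : ((atom .bot).imp I).Realized :=
  .imp_of (Tm.empty _) (singleton zero) fun w ρ x y h => by
    have h1 := h Elt.zero w le_rfl (by simpa using MemAt.singleton _)
    exact Forces.bot_elim (holds_atom.1 h1)

theorem Realized.and_intro : (I.imp (J.imp (I.and J))).Realized := by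
  refine .imp_of (pair (lam (pair v1 v0)) (lam (lam (singleton (snd v0)))))
    (singleton (fst (snd v0))) fun w ρ x y h => ?_
  simp only [holds_imp, holds_and, eval_pair, Elt.fst_pair, Elt.snd_pair, eval_lam, eval_var,
    eval_fst, eval_snd, eval_singleton, Env.cons_there, Env.cons_here] at h ⊢
  exact fun v hv hJ => ⟨h _ v hv (.singleton _), hJ _ v le_rfl (.singleton _)⟩

theorem Realized.and_left : ((I.and J).imp I).Realized := by
  refine .imp_of (fst v0) (singleton (pair v0 (Tm.empty _))) fun w ρ x y h => ?_
  simp only [holds_and, eval_pair, eval_var, eval_fst, eval_singleton,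
    Env.cons_here] at h ⊢
  simpa using (h _ w le_rfl (.singleton _)).1

theorem Realized.and_right : ((I.and J).imp J).Realized := by
  refine .imp_of (snd v0) (singleton (pair (Tm.empty _) v0)) fun w ρ x y h => ?_
  simp only [holds_and, eval_pair, eval_var, eval_snd, eval_singleton,
    Env.cons_here] at h ⊢
  simpa using (h _ w le_rfl (.singleton _)).2

theorem Realized.or_left : (I.imp (I.or J)).Realized := by
  refine .imp_of (pair zero (pair v0 (Tm.empty _))) (singleton (fst v0)) fun w ρ x y h => ?_
  simp only [holds_or, eval_pair, eval_var, eval_fst, eval_singleton, eval_zero,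
    Env.cons_here, Elt.fst_pair, Elt.snd_pair] at h ⊢
  exact ⟨fun v hv _ => h _ v hv (.singleton _),
    fun v hv h0 => Forces.bot_elim (h0 v le_rfl (.refl _))⟩

theorem Realized.or_right : (J.imp (I.or J)).Realized := by
  refine .imp_of (pair (succ zero) (pair (Tm.empty _) v0)) (singleton (snd v0)) fun w ρ x y h => ?_
  simp only [holds_or, eval_pair, eval_var, eval_snd, eval_singleton, eval_zero,
    Env.cons_here, Elt.fst_pair, Elt.snd_pair, eval_succ] at h ⊢
  exact ⟨fun v hv h0 => h0.succ_ne_zero, fun v hv _ => h _ v hv (.singleton _)⟩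

/-- Definition by cases. -/
theorem IsInternal.holds_natRec (hK : K.IsInternal) {n : Elt .nat} {a b : Elt K.W}
    {f : Elt (.arrow K.W (.arrow .nat K.W))} (hf : ∀ c m, f ⬝ c ⬝ m = b) {y : Elt K.C}
    (h0 : ∀ v, v ≤ w → EqAt v n Elt.zero → K.Holds v ρ a y)
    (h1 : ∀ v, v ≤ w → (∀ u, u ≤ v → EqAt u n Elt.zero →
        Forces u (.bot : Formula []) Env.nil) → K.Holds v ρ b y) :
    K.Holds w ρ (Elt.natRec a f n) y := by
  let ρ' := Env.cons n (.cons a (.cons f (.cons y ρ)))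
  let r : Ren Γ (.nat :: .nat :: K.W :: .arrow K.W (.arrow .nat K.W) :: K.C :: Γ) :=
    fun _ x => .there (.there (.there (.there (.there x))))
  have hr : ∀ m, r.val (Env.cons m ρ') = ρ := fun m => rfl
  -- The induction variable is kept apart from `n` and tied to it by an equation, because `h0` and
  -- `h1` speak of `n` itself.
  have key := Forces.nat_cases (w := w) (ρ := ρ') (n := n)
    (φ := (v0 ≐ v1 →ᶠ K.φ.subst (.cons v4 (.cons (Tm.natRec v2 v3 v0) (.ofRen r)))))
    ⟨trivial, hK.1.subst _⟩ ⟨trivial, hK.2.subst _⟩ ?_ ?_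
  · simp only [forces_imp, forces_eq, forces_subst_val, Sub.val_cons, Sub.val_ofRen, hr] at key
    simpa [ρ', Holds] using key w le_rfl (by simpa [ρ'] using EqAt.refl _)
  · simp only [forces_imp, forces_eq, forces_subst_val, Sub.val_cons, Sub.val_ofRen, hr]
    intro v hv h
    simp only [ρ', eval_var, Env.cons_here, Env.cons_there, eval_natRec, Elt.natRec_zero] at h ⊢
    exact h0 v hv h.symm
  · simp only [forces_imp, forces_eq, forces_subst_val, Sub.val_cons, Sub.val_ofRen, hr]
    intro m v hv h
    simp only [ρ', eval_var, Env.cons_here, Env.cons_there, eval_natRec, Elt.natRec_succ,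
      hf] at h ⊢
    exact h1 v hv fun u hu hn => ((h.mono hu).trans hn).succ_ne_zero

/-- The witness is chosen by recursion on the flag, and the counterexamples of both branches are
concatenated, each padded by a dummy on the other side. This is the one logical axiom whose
soundness needs an internal `∨`-free matrix: the flag may be nonstandard, so it is analysed by
internal induction. -/
theorem Realized.or_elim (hK : K.IsInternal) :
    ((I.imp K).imp ((J.imp K).imp ((I.or J).imp K))).Realized := by
  refine .imp_of (pair
      (lam (pair
        (lam (Tm.natRec (.app (fst v2) (fst (snd v0)))
          (lam (lam (.app (fst v3) (snd (snd v2))))) (fst v0)))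
        (lam (lam (append
          (map (lam (pair v0 (Tm.empty _))) (.app (.app (snd v3) (fst (snd v1))) v0))
          (map (lam (pair (Tm.empty _) v0)) (.app (.app (snd v2) (snd (snd v1))) v0)))))))
      (lam (lam (singleton (pair (snd (snd (fst v0))) (snd v0))))))
    (singleton (pair (fst (snd (fst (snd v0)))) (snd (snd v0)))) fun w ρ f y h => ?_
  simp only [holds_imp, holds_or, eval_pair, Elt.fst_pair, Elt.snd_pair, eval_lam, eval_var,
    eval_app, eval_fst, eval_snd, eval_append, eval_singleton, Env.cons_there, Env.cons_here,
    eval_natRec] at h ⊢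
  intro v hv hJ u hu hIJ
  refine hK.holds_natRec (b := Elt.fst (Elt.fst y) ⬝ Elt.snd (Elt.snd (Elt.fst (Elt.snd y))))
    (fun c m => by simp) ?_ ?_
  · intro u' hu' h0
    have h1 := h _ u' (hu'.trans (hu.trans hv)) (.singleton _)
    simp only [Elt.fst_pair, Elt.snd_pair] at h1
    refine h1 u' le_rfl fun z u'' hu'' hz => ?_
    have h2 := (hIJ (Elt.pair z (eval (Tm.empty _) Env.nil)) u'' (hu''.trans hu')
      (.append_left _ (.map hz (by simp) (by simp [Elt.eval_empty])))).1 u'' le_rfl (h0.mono hu'')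
    simpa using h2
  · intro u' hu' h0
    have h1 := hJ _ u' (hu'.trans hu) (.singleton _)
    simp only [Elt.fst_pair, Elt.snd_pair] at h1
    refine h1 u' le_rfl fun z u'' hu'' hz => ?_
    have h2 := (hIJ (Elt.pair (eval (Tm.empty _) Env.nil) z) u'' (hu''.trans hu')
      (.append_right _ (.map hz (by simp) (by simp [Elt.eval_empty])))).2 u'' le_rfl
        fun u3 hu3 => h0 u3 (hu3.trans hu'')
    simpa using h2

section Quantifiers

variable {K : Interp (σ :: Γ)}

theorem Realized.all_elim (a : Tm Γ σ) : ((all σ K).imp (K.subst (.single a))).Realized := by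
  refine .imp_of v0 (singleton v0) fun w ρ x y h => ?_
  simp only [holds_all, holds_subst, eval_var, eval_singleton, Env.cons_here,
    Sub.val_single] at h ⊢
  exact h _ w le_rfl (.singleton _) _

theorem Realized.ex_intro (a : Tm Γ σ) : ((K.subst (.single a)).imp (ex σ K)).Realized := by
  refine .imp_of v0 v0 fun w ρ x y h => ?_
  simp only [holds_subst, eval_var, Env.cons_here, Sub.val_single] at h ⊢
  exact Holds.ex_intro _ h

/-- A closed realizer of the premise cannot depend on the eigenvariable, so it serves unchanged. -/
theorem Realized.all_rule (h : ((I.subst (.ofRen (.shift Γ σ))).imp K).Realized) :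
    (I.imp (all σ K)).Realized := by
  obtain ⟨t, ht⟩ := h
  refine ⟨t, fun w ρ y => ?_⟩
  simp only [holds_imp, holds_all, holds_subst] at ht ⊢
  exact fun v hv h d => ht w (Env.cons d ρ) y v hv (by simpa using h)

theorem Realized.ex_rule (h : (K.imp (I.subst (.ofRen (.shift Γ σ)))).Realized) :
    ((ex σ K).imp I).Realized := by
  obtain ⟨t, ht⟩ := h
  -- The entire sequence requested for `K` is one counterexample to the existential formula, hence
  -- the singleton.
  refine .imp_of (.app (fst (t.ofClosed _)) v0)
    (singleton (.app (.app (snd (t.ofClosed _)) v1) v0)) fun w ρ x y h => ?_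
  simp only [eval_app, eval_fst, eval_snd, eval_ofClosed, eval_var, Env.cons_here,
    Env.cons_there, eval_singleton] at h ⊢
  refine Holds.ex_elim (h _ w le_rfl (.singleton _)) fun v hv d hd => ?_
  have h1 := ht v (Env.cons d ρ) (Elt.pair x y)
  simp only [holds_imp, holds_subst, Elt.fst_pair, Elt.snd_pair, Sub.val_ofRen,
    Ren.val_shift] at h1
  exact h1 v le_rfl hd

end Quantifiers

/-! ### Internal formulas -/

/-- `x` and `y` are closed terms that make the interpretation `I` equivalent to `A`. -/
structure Trivializes (A : Formula Γ) (I : Interp Γ) (x : Tm [] I.W) (y : Tm [] I.C) : Prop where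
  holds : ∀ {w : World} {ρ : Env Γ} (z : Elt I.C), Forces w A ρ → I.Holds w ρ (eval x .nil) z
  forces : ∀ {w : World} {ρ : Env Γ} {z : Elt I.W}, I.Holds w ρ z (eval y .nil) → Forces w A ρ

namespace Trivializes

variable {A B : Formula Γ} {a : Tm [] I.W} {a' : Tm [] I.C} {b : Tm [] J.W} {b' : Tm [] J.C}
  {A' : Formula (σ :: Γ)} {K : Interp (σ :: Γ)} {c : Tm [] K.W} {c' : Tm [] K.C}

theorem atom (A : Formula Γ) : Trivializes A (.atom A) zero zero :=
  ⟨fun _ => holds_atom.2, holds_atom.1⟩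

theorem and (ha : Trivializes A I a a') (hb : Trivializes B J b b') :
    Trivializes (A ∧ᶠ B) (I.and J) (pair a b) (pair a' b') := by
  refine ⟨fun z h => ?_, fun {w ρ z} h => ?_⟩
  · simp only [holds_and, eval_pair, Elt.fst_pair, Elt.snd_pair]
    exact ⟨ha.holds _ (forces_and.1 h).1, hb.holds _ (forces_and.1 h).2⟩
  · simp only [holds_and, eval_pair, Elt.fst_pair, Elt.snd_pair] at h
    exact forces_and.2 ⟨ha.forces h.1, hb.forces h.2⟩

theorem imp (ha : Trivializes A I a a') (hb : Trivializes B J b b') :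
    Trivializes (A →ᶠ B) (I.imp J)
      (pair (lam (b.ofClosed _)) (lam (lam (singleton (a'.ofClosed _))))) (pair a b') := by
  refine ⟨fun z h => ?_, fun {w ρ z} h => ?_⟩
  · simp only [holds_imp, eval_pair, Elt.fst_pair, Elt.snd_pair, eval_lam, eval_singleton,
      eval_ofClosed]
    exact fun v hv h' => hb.holds _ (forces_imp.1 h v hv
      (ha.forces (h' _ v le_rfl (.singleton _))))
  · simp only [holds_imp, eval_pair, Elt.fst_pair, Elt.snd_pair] at h
    exact forces_imp.2 fun v hv h' => hb.forces (h v hv fun z u hu _ => ha.holds z (h'.mono hu))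

theorem all (hc : Trivializes A' K c c') : Trivializes (.all σ A') (.all σ K) c c' :=
  ⟨fun z h => holds_all.2 fun d => hc.holds z (forces_all.1 h d),
    fun h => forces_all.2 fun d => hc.forces (holds_all.1 h d)⟩

theorem ex (hc : Trivializes A' K c c') : Trivializes (.ex σ A') (.ex σ K) c (singleton c') := by
  refine ⟨fun z h => ?_, fun {w ρ z} h => ?_⟩
  · exact Forces.ex_elim (C := (Interp.ex σ K).φ) h fun v hv d hd =>
      Holds.ex_intro d fun z u hu _ => hc.holds z (hd.mono hu)
  · refine Holds.ex_elim h fun v hv d hd => Forces.ex_intro d (hc.forces (hd _ v le_rfl ?_))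
    rw [eval_singleton]
    exact .singleton _

end Trivializes

/-- Without `st`, external quantifiers and `∨`, witnesses carry no information: one closed witness
works whenever `A` holds, and one closed counterexample works whenever `A` is to be recovered. A
disjunction would break this, since its flag would have to be fixed in advance. -/
theorem exists_trivializes {A : Formula Γ} (hi : A.Internal) (ho : A.OrFree) :
    ∃ x y, Trivializes A A.interp x y := by
  induction A with
  | bot => exact ⟨_, _, .atom _⟩
  | eq a b => exact ⟨_, _, .atom _⟩
  | st a => exact hi.elim
  | and A B hA hB =>
    obtain ⟨a, a', ha⟩ := hA hi.1 ho.1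
    obtain ⟨b, b', hb⟩ := hB hi.2 ho.2
    exact ⟨_, _, ha.and hb⟩
  | or A B hA hB => exact ho.elim
  | imp A B hA hB =>
    obtain ⟨a, a', ha⟩ := hA hi.1 ho.1
    obtain ⟨b, b', hb⟩ := hB hi.2 ho.2
    exact ⟨_, _, ha.imp hb⟩
  | all σ A hA =>
    obtain ⟨a, a', ha⟩ := hA hi ho
    exact ⟨_, _, ha.all⟩
  | ex σ A hA =>
    obtain ⟨a, a', ha⟩ := hA hi ho
    exact ⟨_, _, ha.ex⟩
  | allSt σ A hA => exact hi.elim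
  | exSt σ A hA => exact hi.elim

theorem Realized.of_internal {A : Formula Γ} (hi : A.Internal) (ho : A.OrFree)
    (h : ∀ w ρ, Forces w A ρ) : A.interp.Realized := by
  obtain ⟨x, y, hxy⟩ := exists_trivializes hi ho
  exact ⟨x, fun w ρ z => hxy.holds z (h w ρ)⟩

theorem _root_.UDN.AxEHA.internal {A : Formula Γ} (h : AxEHA A) : A.Internal := by
  cases h with
  | induction φ hi ho => exact ⟨⟨hi.subst _, hi, hi.subst _⟩, hi⟩
  | _ => simp [Formula.Internal]

theorem _root_.UDN.AxEHA.orFree {A : Formula Γ} (h : AxEHA A) : A.OrFree := by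
  cases h with
  | induction φ hi ho => exact ⟨⟨ho.subst _, ho, ho.subst _⟩, ho⟩
  | _ => simp [Formula.OrFree]

theorem Realized.of_axEHA {A : Formula Γ} (h : AxEHA A) : A.interp.Realized :=
  .of_internal h.internal h.orFree fun _ _ => .of_mem (.inl h)

end Interp
end UDN

/-! ### Soundness for standardness, external induction and the characteristic principles. -/

namespace UDN
open Tm Filter

attribute [local irreducible] eval Forces Elt.app Elt.pair Elt.fst Elt.snd

namespace Interp

variable {Γ Δ : Ctx} {σ τ υ : Ty} {w v : World} {ρ : Env Γ} {I J : Interp Γ}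

/-! ### Standardness and external quantifiers -/

theorem Realized.pair (h : I.Realized) (h' : J.Realized) : (I.and J).Realized := by
  obtain ⟨t, ht⟩ := h
  obtain ⟨u, hu⟩ := h'
  refine ⟨Tm.pair t u, fun w ρ y => ?_⟩
  simp only [holds_and, eval_pair, Elt.fst_pair, Elt.snd_pair]
  exact ⟨ht w ρ _, hu w ρ _⟩

section

variable {K : Interp (σ :: Γ)}

theorem Holds.congr_head {a b : Elt σ} (h : EqAt w a b) {x : Elt K.W} {y : Elt K.C}
    (hK : K.Holds w (Env.cons a ρ) x y) : K.Holds w (Env.cons b ρ) x y := by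
  refine Forces.congr (fun σ x => ?_) hK
  match σ, x with
  | _, .here => exact EqAt.refl _
  | _, .there .here => exact EqAt.refl _
  | _, .there (.there .here) => exact h
  | _, .there (.there (.there x)) => exact EqAt.refl _

/-- The types of witnesses match up to the counterexamples to `st`. The witness of `st(d)` is an
element equal to `d`, so what remains is to replace equals by equals. -/
theorem Realized.allSt_mp : ((allSt σ K).imp (all σ ((st v0).imp K))).Realized := by
  refine .imp_of (Tm.pair v0 (lam (lam (singleton zero)))) (singleton v0) fun w ρ x y h => ?_
  simp only [holds_all, holds_imp, holds_st, holds_allSt, eval_pair, eval_var, Env.cons_here,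
    Elt.fst_pair, Elt.snd_pair, eval_lam, eval_singleton] at h ⊢
  exact fun d v hv hd => (h _ v hv (.singleton _)).congr_head (hd _ v le_rfl (.singleton _))

theorem Realized.allSt_mpr : ((all σ ((st v0).imp K)).imp (allSt σ K)).Realized := by
  refine .imp_of (fst v0) (singleton v0) fun w ρ x y h => ?_
  simp only [holds_all, holds_imp, holds_st, holds_allSt, eval_var, Env.cons_here, eval_fst,
    eval_singleton] at h ⊢
  exact h _ w le_rfl (.singleton _) _ w le_rfl fun _ _ _ _ => .refl _

theorem Realized.exSt_mp : ((exSt σ K).imp (ex σ ((st v0).and K))).Realized := by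
  refine .imp_of v0 (map (lam (snd v0)) v0) fun w ρ x y h => ?_
  simp only [holds_exSt, eval_var, Env.cons_here] at h ⊢
  refine Holds.ex_intro (Elt.fst x) fun z v hv hz => ?_
  simp only [holds_and, holds_st, eval_var, Env.cons_here]
  exact ⟨.refl _, h _ v hv (.map hz (by simp) (by simp))⟩

theorem Realized.exSt_mpr : ((ex σ ((st v0).and K)).imp (exSt σ K)).Realized := by
  refine .imp_of v0 (singleton (singleton (Tm.pair zero v0))) fun w ρ x y h => ?_
  simp only [eval_var, Env.cons_here, eval_singleton, eval_pair] at h ⊢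
  refine Holds.ex_elim (h _ w le_rfl (.singleton _)) fun v hv d hd => ?_
  have h1 := hd _ v le_rfl (.singleton _)
  simp only [holds_and, holds_st, eval_var, Env.cons_here, Elt.snd_pair] at h1
  exact (holds_exSt (σ := σ)).2 (h1.2.congr_head h1.1.symm)

end

theorem Realized.st_eq (a b : Tm Γ σ) : (((st a).and (atom (a ≐ b))).imp (st b)).Realized := by
  refine .imp_of (fst v0) (singleton (Tm.pair zero zero)) fun w ρ x y h => ?_
  simp only [holds_and, holds_st, holds_atom, forces_eq, eval_singleton, eval_fst, eval_var,
    Env.cons_here] at h ⊢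
  have h1 := h _ w le_rfl (.singleton _)
  exact h1.1.trans h1.2

theorem Realized.st_closed (a : Tm [] σ) : (st (a.ofClosed Γ)).Realized :=
  ⟨a, fun w ρ y => by simpa using EqAt.refl _⟩

theorem Realized.st_app (f : Tm Γ (.arrow σ τ)) (a : Tm Γ σ) :
    (((st f).and (st a)).imp (st (.app f a))).Realized := by
  refine .imp_of (.app (fst v0) (snd v0)) (singleton (Tm.pair zero zero)) fun w ρ x y h => ?_
  simp only [holds_and, holds_st, eval_app, eval_singleton, eval_fst, eval_snd, eval_var,
    Env.cons_here] at h ⊢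
  have h1 := h _ w le_rfl (.singleton _)
  exact (h1.1.app_left _).trans (h1.2.app_right _)

/-! ### External induction -/

/-- The type of witnesses of the premise of external induction. -/
abbrev IndW (α γ : Ty) : Ty :=
  .prod α (.arrow .nat (.prod (.arrow α α) (.arrow α (.arrow γ (.seq γ)))))

/-- The type of counterexamples of the premise of external induction. -/
abbrev IndC (α γ : Ty) : Ty := .prod γ (.prod .nat (.prod α γ))

/-- The witness of the conclusion of external induction. -/
def indT (α γ : Ty) : Tm [] (.arrow (IndW α γ) (.arrow .nat α)) :=
  lam (lam (Tm.natRec (fst v1)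
    (.app ((lam (lam (lam (.app (fst (.app (snd v2) v0)) v1))) :
      Tm [] (.arrow (IndW α γ) _)).ofClosed _) v1) v0))

/-- The instances of the premise needed for a finite set of counterexamples at a number. -/
def indSetT (α γ : Ty) :
    Tm [] (.arrow (IndW α γ) (.arrow .nat (.arrow (.seq γ) (.seq (IndC α γ))))) :=
  lam (lam (Tm.natRec
    ((lam (map (lam (Tm.pair v0 (Tm.empty _))) v0) : Tm [] (.arrow (.seq γ) _)).ofClosed _)
    (.app ((lam (lam (lam (lam (append
        (map (lam (Tm.pair (Tm.empty _)
          (Tm.pair v2 (Tm.pair (.app (.app ((indT α γ).ofClosed _) v4) v2) v0)))) v0)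
        (.app v2 (bind v0
          (.app (snd (.app (snd v3) v1)) (.app (.app ((indT α γ).ofClosed _) v3) v1)))))))) :
      Tm [] (.arrow (IndW α γ) _)).ofClosed _) v1) v0))

section

variable {α γ : Ty}

noncomputable def ind (p : Elt (IndW α γ)) (n : Elt .nat) : Elt α := eval (indT α γ) .nil ⬝ p ⬝ n

noncomputable def indSet (p : Elt (IndW α γ)) (n : Elt .nat) (l : Elt (.seq γ)) :
    Elt (.seq (IndC α γ)) := eval (indSetT α γ) .nil ⬝ p ⬝ n ⬝ l

theorem ind_zero (p : Elt (IndW α γ)) : ind p Elt.zero = Elt.fst p := by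
  simp [ind, indT]

theorem ind_succ (p : Elt (IndW α γ)) (n : Elt .nat) :
    ind p (Elt.succ n) = Elt.fst (Elt.snd p ⬝ n) ⬝ ind p n := by
  simp [ind, indT]

theorem mem_indSet_zero (p : Elt (IndW α γ)) {l : Elt (.seq γ)} {a : Elt γ} (h : MemAt w a l) :
    ∃ b, MemAt w (Elt.pair a b) (indSet p Elt.zero l) := by
  refine ⟨eval (Tm.empty _) .nil, ?_⟩
  simp only [indSet, indSetT, eval_lam, eval_natRec, eval_var, Env.cons_here, Elt.natRec_zero,
    eval_ofClosed]
  exact .map h (by simp) (by simp [Elt.eval_empty])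

theorem mem_indSet_succ (p : Elt (IndW α γ)) (n : Elt .nat) {l : Elt (.seq γ)} {a : Elt γ}
    (h : MemAt w a l) :
    ∃ b, MemAt w (Elt.pair b (Elt.pair n (Elt.pair (ind p n) a))) (indSet p (Elt.succ n) l) := by
  refine ⟨eval (Tm.empty _) .nil, ?_⟩
  simp only [indSet, indSetT, eval_lam, eval_natRec, eval_var, Env.cons_here, Elt.natRec_succ,
    eval_ofClosed, eval_app, eval_append, Env.cons_there]
  exact .append_left _ (.map h (by simp) (by simp [Elt.eval_empty, ind]))

theorem mem_indSet_succ_of_mem (p : Elt (IndW α γ)) (n : Elt .nat) {l : Elt (.seq γ)}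
    {a : Elt (IndC α γ)}
    (h : MemAt w a (indSet p n (Elt.bind l (Elt.snd (Elt.snd p ⬝ n) ⬝ ind p n)))) :
    MemAt w a (indSet p (Elt.succ n) l) := by
  simp only [indSet, indSetT, eval_lam, eval_natRec, eval_var, Env.cons_here, Elt.natRec_succ,
    eval_ofClosed, eval_app, eval_append, eval_bind, eval_snd, Env.cons_there] at h ⊢
  exact .append_right _ h

/-- The realizer must work at nonstandard `n` too, so the induction is internal and needs an
internal `∨`-free matrix. The finite set `l` of counterexamples is universally quantified: going
from `S n` to `n` replaces it by all counterexamples that the step requests for members of `l`. -/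
theorem holds_ind {K : Interp (.nat :: Γ)} (hK : K.IsInternal) (p : Elt (IndW K.W K.C))
    (n : Elt .nat) (l : Elt (.seq K.C))
    (h : ∀ z u, u ≤ w → MemAt u z (indSet p n l) → ((K.subst (.single zero)).and
      (allSt .nat (K.imp (K.subst (.succ Γ))))).Holds u ρ p z) {y : Elt K.C} (hy : MemAt w y l) :
    K.Holds w (Env.cons n ρ) (ind p n) y := by
  set P := (K.subst (.single zero)).and (allSt .nat (K.imp (K.subst (.succ Γ))))
  have hPi : P.IsInternal := IsInternal.and ⟨hK.1.subst _, hK.2.subst _⟩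
    (IsInternal.allSt (hK.imp ⟨hK.1.subst _, hK.2.subst _⟩))
  obtain ⟨B, hB⟩ : ∃ B : Formula (.seq K.C :: .nat :: IndW K.W K.C :: Γ),
      B = Formula.imp
        (.all P.C (.mem v0 (.app (.app (.app ((indSetT K.W K.C).ofClosed _) v3) v2) v1) →ᶠ
          P.φ.subst (.cons v0 (.cons v3 (.ofRen (.shift₄ Γ _ _ _ _))))))
        (.all K.C (.mem v0 v1 →ᶠ K.φ.subst
          (.cons v0 (.cons (.app (.app ((indT K.W K.C).ofClosed _) v3) v2) (.cons v2
            (.ofRen (.shift₄ Γ _ _ _ _))))))) := ⟨_, rfl⟩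
  have hr : ∀ {w l n p}, Forces w B (Env.cons l (Env.cons n (Env.cons p ρ))) ↔
      ∀ v, v ≤ w → (∀ z u, u ≤ v → MemAt u z (indSet p n l) → P.Holds u ρ p z) →
        ∀ y u, u ≤ v → MemAt u y l → K.Holds u (Env.cons n ρ) (ind p n) y := by
    intro w l n p
    simp [hB, indSet, ind, Holds]
    rfl
  have key : Forces w (.all (.seq K.C) B) (Env.cons n (Env.cons p ρ)) := by
    refine Forces.nat_induction ?_ ?_ ?_ ?_ n
    · rw [hB]; exact ⟨⟨internal_mem _ _, hPi.1.subst _⟩, internal_mem _ _, hK.1.subst _⟩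
    · rw [hB]; exact ⟨⟨orFree_mem _ _, hPi.2.subst _⟩, orFree_mem _ _, hK.2.subst _⟩
    · refine forces_all.2 fun l => hr.2 fun v hv h y u hu hy => ?_
      obtain ⟨b, hb⟩ := mem_indSet_zero p hy
      have h1 : ((K.subst (.single zero)).and
        (allSt .nat (K.imp (K.subst (.succ Γ))))).Holds u ρ p _ := h _ u hu hb
      simp only [holds_and, holds_subst, Sub.val_single, eval_zero, Elt.fst_pair] at h1
      rw [ind_zero]
      exact h1.1
    · refine fun v hv n ih => forces_all.2 fun l => hr.2 fun v' hv' h y u hu hy => ?_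
      obtain ⟨b, hb⟩ := mem_indSet_succ p n hy
      have h1 : ((K.subst (.single zero)).and
        (allSt .nat (K.imp (K.subst (.succ Γ))))).Holds u ρ p _ := h _ u hu hb
      simp only [holds_and, holds_subst, holds_allSt, holds_imp, Elt.fst_pair, Elt.snd_pair,
        Sub.val_succ] at h1
      rw [ind_succ]
      refine h1.2 u le_rfl fun z u' hu' hz => ?_
      exact hr.1 (forces_all.1 ih (Elt.bind l (Elt.snd (Elt.snd p ⬝ n) ⬝ ind p n))) u'
        (hu'.trans (hu.trans hv'))
        (fun z' u'' hu'' hz' => h z' u'' (hu''.trans (hu'.trans hu))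
          (mem_indSet_succ_of_mem p n hz'))
        z u' le_rfl ((hy.mono hu').bind hz)
  exact hr.1 (forces_all.1 key l) w le_rfl h y w le_rfl hy

end

theorem Realized.st_induction {K : Interp (.nat :: Γ)} (hK : K.IsInternal) :
    (((K.subst (.single zero)).and (allSt .nat (K.imp (K.subst (.succ Γ))))).imp
      (allSt .nat K)).Realized := by
  refine .imp_of (.app ((indT K.W K.C).ofClosed _) v0)
    (.app (.app (.app ((indSetT K.W K.C).ofClosed _) v1) (fst v0)) (singleton (snd v0)))
    fun w ρ p y h => ?_
  simp only [eval_app, eval_ofClosed, eval_var, eval_fst, eval_snd, eval_singleton, Env.cons_here,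
    Env.cons_there] at h
  simp only [holds_allSt, eval_app, eval_ofClosed, eval_var, Env.cons_here]
  exact holds_ind hK p _ _ h (.singleton _)

theorem Realized.of_axSt {A : Formula Γ} (h : AxSt A) : A.interp.Realized := by
  cases h with
  | allSt_def Φ => exact .pair .allSt_mp .allSt_mpr
  | exSt_def Φ => exact .pair .exSt_mp .exSt_mpr
  | st_eq a b => exact .st_eq a b
  | st_closed a => exact .st_closed a
  | st_app f a => exact .st_app f a
  | induction Φ =>
    have := Realized.st_induction Φ.isInternal_interp
    rw [← Formula.interp_subst, ← Formula.interp_subst] at this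
    exact this

/-! ### The characteristic principles -/

/-- A counterexample is a finite sequence, and it mentions only finitely many elements `x`; the
sequence of exactly these elements is the required `s`. -/
theorem Realized.overspill {φ : Formula (.seq σ :: Γ)} {K : Interp (.seq σ :: Γ)} {c : Tm [] K.W}
    {c' : Tm [] K.C} (hK : Trivializes φ K c c') {M : Interp (σ :: .seq σ :: Γ)} {m : Tm [] M.W}
    {m' : Tm [] M.C} (hM : Trivializes (.mem v0 v1) M m m') :
    ((allSt (.seq σ) K).imp (ex (.seq σ) ((allSt σ M).and K))).Realized := by
  refine .imp_of (Tm.pair (lam (m.ofClosed _)) (c.ofClosed _))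
    (singleton (Tm.pair (map (lam (fst (fst v0))) v0) (c'.ofClosed _))) fun w ρ x y h => ?_
  simp only [holds_allSt, eval_singleton, eval_pair, eval_ofClosed] at h ⊢
  have h1 := h _ w le_rfl (.singleton _)
  simp only [Elt.fst_pair, Elt.snd_pair] at h1
  refine Holds.ex_intro (eval (map (lam (fst (fst v0))) v0) (Env.cons y (Env.cons x Env.nil)))
    fun z v hv hz => ?_
  simp only [holds_and, holds_allSt, Elt.fst_pair, Elt.snd_pair, eval_lam, eval_ofClosed]
  refine ⟨hM.holds _ ?_, hK.holds _ (hK.forces (h1.mono hv))⟩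
  simp only [forces_mem, eval_var, Env.cons_here, Env.cons_there]
  exact .map hz (by simp) (by simp)

/-- The premise `∀ˢᵗ x (x ∈ s)` is realized by the constant `e` whatever `s` is. The realizer of the
implication then answers with finitely many `x` to be tested, and the sequence of these is the
witness. -/
theorem Realized.underspill {φ : Formula (.seq σ :: Γ)} {K : Interp (.seq σ :: Γ)} {c : Tm [] K.W}
    {c' : Tm [] K.C} (hK : Trivializes φ K c c') {M : Interp (σ :: .seq σ :: Γ)} {m : Tm [] M.W}
    {m' : Tm [] M.C} (hM : Trivializes (.mem v0 v1) M m m') :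
    ((all (.seq σ) ((allSt σ M).imp K)).imp (exSt (.seq σ) K)).Realized := by
  let e : Tm [] (.arrow σ M.W) := lam (m.ofClosed _)
  refine .imp_of (Tm.pair (map (lam (fst v0)) (.app (.app (snd v0) (e.ofClosed _)) (c'.ofClosed _)))
      (c.ofClosed _))
    (singleton (Tm.pair (e.ofClosed _) (c'.ofClosed _))) fun w ρ x y h => ?_
  simp only [holds_all, holds_imp, holds_allSt, eval_singleton, eval_pair, eval_ofClosed] at h
  simp only [holds_exSt, eval_pair, Elt.fst_pair, Elt.snd_pair, eval_ofClosed]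
  have h1 := h _ w le_rfl (.singleton _)
  simp only [Elt.fst_pair, Elt.snd_pair] at h1
  refine hK.holds _ (hK.forces (h1 _ w le_rfl fun z v hv hz => ?_))
  simp only [e, eval_lam, eval_ofClosed]
  refine hM.holds _ ?_
  simp only [forces_mem, eval_var, Env.cons_here, Env.cons_there]
  exact .map hz (by simp [e]) (by simp)

theorem Realized.uniformity {K : Interp (σ :: τ :: Γ)} :
    ((all τ (exSt σ K)).imp (exSt σ (all τ (K.subst (.ofRen (.swap Γ σ τ)))))).Realized := by
  refine .imp_of v0 (singleton v0) fun w ρ x y h => ?_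
  simp only [holds_all, holds_exSt, holds_subst, eval_singleton, eval_var, Env.cons_here,
    Sub.val_ofRen, Ren.val_swap] at h ⊢
  exact h _ w le_rfl (.singleton _)

/-- The hypothesis already provides a functional with values in a product; splitting it
componentwise gives the choice function and the remaining witness. -/
theorem Realized.choice {K : Interp (τ :: σ :: Γ)} : ((allSt σ (exSt τ K)).imp
    (exSt (.arrow σ τ) (allSt σ (K.subst (.choice Γ σ τ))))).Realized := by
  refine .imp_of (Tm.pair (lam (fst (.app v1 v0))) (lam (snd (.app v1 v0)))) (singleton v0)
    fun w ρ x y h => ?_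
  simp only [holds_allSt, holds_exSt, holds_subst, eval_singleton, eval_var, Env.cons_here,
    Env.cons_there, eval_pair, Elt.fst_pair, Elt.snd_pair, eval_lam, eval_app, eval_fst, eval_snd,
    Sub.val_choice] at h ⊢
  exact h _ w le_rfl (.singleton _)

/-- The premise has internal matrix, so its witness may be taken to be the fixed constant `e`.
Evaluating at `e` yields `y` before the premise is known. -/
theorem Realized.independence {φ : Formula (σ :: Γ)} {K : Interp (σ :: Γ)} {c : Tm [] K.W}
    {c' : Tm [] K.C} (hK : Trivializes φ K c c') {L : Interp (τ :: Γ)} :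
    (((allSt σ K).imp (exSt τ L)).imp
      (exSt τ (((allSt σ K).subst (.ofRen (.shift Γ τ))).imp L))).Realized := by
  let e : Tm [] (.arrow σ K.W) := lam (c.ofClosed _)
  refine .imp_of (Tm.pair (fst (.app (fst v0) (e.ofClosed _)))
      (Tm.pair (lam (snd (.app (fst v1) (e.ofClosed _))))
        (lam (lam (map (lam (Tm.pair (fst v0) (c'.ofClosed _)))
          (.app (.app (snd v2) (e.ofClosed _)) v0))))))
    (singleton (Tm.pair (e.ofClosed _) (snd v0))) fun w ρ x y h => ?_
  simp only [holds_imp, holds_allSt, holds_exSt, eval_singleton, eval_pair, eval_ofClosed,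
    eval_snd, eval_var, Env.cons_here] at h
  simp only [holds_imp, holds_allSt, holds_exSt, holds_subst, eval_pair, eval_ofClosed, eval_lam,
    eval_app, eval_fst, eval_snd, eval_var, Env.cons_here, Env.cons_there, Elt.fst_pair,
    Elt.snd_pair, Sub.val_ofRen, Ren.val_shift]
  intro v hv hφ
  have h1 := h _ v hv (.singleton _) v le_rfl
  simp only [Elt.fst_pair, Elt.snd_pair] at h1
  refine h1 fun z u hu hz => ?_
  have h2 := hφ (Elt.pair (Elt.fst z) (eval c' .nil)) u hu (.map hz (by simp) (by simp))
  simp only [Elt.fst_pair, Elt.snd_pair] at h2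
  simp only [e, eval_lam, eval_ofClosed]
  exact hK.holds _ (hK.forces h2)

theorem Realized.of_axChar {A : Formula Γ} (h : AxChar A) : A.interp.Realized := by
  have hM := fun {Γ : Ctx} {σ : Ty} => exists_trivializes
    (internal_mem (v0 : Tm (σ :: .seq σ :: Γ) σ) v1) (orFree_mem _ _)
  cases h with
  | overspill φ hi ho =>
    obtain ⟨c, c', hc⟩ := exists_trivializes hi ho
    obtain ⟨m, m', hm⟩ := hM
    exact Realized.overspill hc hm
  | underspill φ hi ho =>
    obtain ⟨c, c', hc⟩ := exists_trivializes hi ho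
    obtain ⟨m, m', hm⟩ := hM
    exact Realized.underspill hc hm
  | uniformity Φ =>
    have := Realized.uniformity (K := Φ.interp)
    rw [← Formula.interp_rename] at this
    exact this
  | choice Φ =>
    have := Realized.choice (K := Φ.interp)
    rw [← Formula.interp_subst] at this
    exact this
  | @independence σ τ φ hi ho Ψ =>
    obtain ⟨c, c', hc⟩ := exists_trivializes hi ho
    have := Realized.independence hc (L := Ψ.interp)
    have h1 : ((Formula.allSt σ φ).weaken τ).interp =
      (allSt σ φ.interp).subst (.ofRen (.shift Γ τ)) := Formula.interp_rename _ (.allSt _ φ)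
    rw [← h1] at this
    exact this

/-- Soundness of the interpretation. -/
theorem _root_.UDN.Provable.realized {A : Formula Γ} (h : Provable H A) : A.interp.Realized := by
  induction h with
  | ax h => exact h.elim .of_axEHA fun h => h.elim .of_axSt .of_axChar
  | mp _ _ ih ih' => exact .mp ih ih'
  | imp_k A B => exact .imp_k
  | imp_s A B C => exact .imp_s
  | bot_elim A => exact .bot_elim
  | and_intro A B => exact .and_intro
  | and_left A B => exact .and_left
  | and_right A B => exact .and_right
  | or_left A B => exact .or_left
  | or_right A B => exact .or_right
  | or_elim A B C => exact .or_elim C.isInternal_interp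
  | all_elim A a =>
    have := Realized.all_elim (K := A.interp) a
    rw [← Formula.interp_subst] at this
    exact this
  | ex_intro A a =>
    have := Realized.ex_intro (K := A.interp) a
    rw [← Formula.interp_subst] at this
    exact this
  | @all_rule Γ σ A B _ ih =>
    refine Realized.all_rule ?_
    rw [← Formula.interp_rename]
    exact ih
  | @ex_rule Γ σ A B _ ih =>
    refine Realized.ex_rule ?_
    rw [← Formula.interp_rename]
    exact ih

end Interp
end UDN

/-! ### The characterisation theorem and the two metatheorems. -/

namespace UDN
open Tm Filter

section Principles

variable {Γ Δ : Ctx} {σ τ υ : Ty} {w v : World} {ρ : Env Γ} {ρ' : Env Δ} {C : Formula Δ}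

/-! ### The characteristic principles in the generic model -/

theorem EqAt.stAt {a b : Elt σ} (h : EqAt w a b) (ha : StAt w a) : StAt w b :=
  h.forces (A := .st v0) (ρ := Env.nil) ha

theorem Forces.overspill {φ : Formula (.seq σ :: Γ)} (hi : φ.Internal) (ho : φ.OrFree)
    (h : ∀ s v, v ≤ w → StAt v s → Forces v φ (Env.cons s ρ))
    (h' : ∀ v, v ≤ w → ∀ s, (∀ x u, u ≤ v → StAt u x → MemAt u x s) →
      Forces v φ (Env.cons s ρ) → Forces v C ρ') : Forces w C ρ' := by
  have h1 := (of_mem (w := w) (ρ := ρ) (.inr (.inr (.overspill φ hi ho)))).mp (forces_allSt.2 h)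
  refine h1.ex_elim fun v hv s hs => h' v hv s ?_ (forces_and.1 hs).2
  simpa using forces_allSt.1 (forces_and.1 hs).1

theorem Forces.underspill {φ : Formula (.seq σ :: Γ)} (hi : φ.Internal) (ho : φ.OrFree)
    (h : ∀ s v, v ≤ w → (∀ x u, u ≤ v → StAt u x → MemAt u x s) → Forces v φ (Env.cons s ρ)) :
    Forces w (.exSt (.seq σ) φ) ρ := by
  refine (of_mem (w := w) (ρ := ρ) (.inr (.inr (.underspill φ hi ho)))).mp (forces_all.2 fun s =>
    forces_imp.2 fun v hv hs => h s v hv ?_)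
  simpa using forces_allSt.1 hs

theorem Forces.uniformity {Φ : Formula (σ :: τ :: Γ)}
    (h : ∀ y, Forces w (.exSt σ Φ) (Env.cons y ρ))
    (h' : ∀ v, v ≤ w → ∀ x, StAt v x → (∀ y, Forces v Φ (Env.cons x (Env.cons y ρ))) →
      Forces v C ρ') : Forces w C ρ' := by
  have h1 := (of_mem (w := w) (ρ := ρ) (.inr (.inr (.uniformity Φ)))).mp (forces_all.2 h)
  refine h1.exSt_elim' fun v hv x hx hx' => h' v hv x hx ?_
  simpa using forces_all.1 hx'

theorem Forces.choice {Φ : Formula (τ :: σ :: Γ)}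
    (h : ∀ x v, v ≤ w → StAt v x → Forces v (.exSt τ Φ) (Env.cons x ρ))
    (h' : ∀ v, v ≤ w → ∀ f, StAt v f → (∀ x u, u ≤ v → StAt u x →
      Forces u Φ (Env.cons (f ⬝ x) (Env.cons x ρ))) → Forces v C ρ') : Forces w C ρ' := by
  have h1 := (of_mem (w := w) (ρ := ρ) (.inr (.inr (.choice Φ)))).mp (forces_allSt.2 h)
  refine h1.exSt_elim' fun v hv f hf hf' => h' v hv f hf ?_
  simpa using forces_allSt.1 hf'

theorem Forces.independence {φ : Formula (σ :: Γ)} (hi : φ.Internal) (ho : φ.OrFree)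
    {Ψ : Formula (τ :: Γ)}
    (h : ∀ v, v ≤ w → (∀ x u, u ≤ v → StAt u x → Forces u φ (Env.cons x ρ)) →
      Forces v (.exSt τ Ψ) ρ)
    (h' : ∀ v, v ≤ w → ∀ y, StAt v y → (∀ u, u ≤ v →
      (∀ x u', u' ≤ u → StAt u' x → Forces u' φ (Env.cons x ρ)) → Forces u Ψ (Env.cons y ρ)) →
      Forces v C ρ') : Forces w C ρ' := by
  have h1 := (of_mem (w := w) (ρ := ρ) (.inr (.inr (.independence φ hi ho Ψ)))).mp
    (forces_imp.2 fun v hv hφ => h v hv (forces_allSt.1 hφ))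
  refine h1.exSt_elim' fun v hv y hy hy' => h' v hv y hy fun u hu hφ => ?_
  refine forces_imp.1 hy' u hu ?_
  rw [forces_weaken]
  exact forces_allSt.2 hφ

/-! ### Elements of standard sequences -/

theorem StAt.eval (t : Tm Γ σ) (h : ∀ τ x, StAt w (ρ τ x)) : StAt w (eval t ρ) := by
  induction t with
  | var x => rw [eval_var]; exact h _ x
  | const c => exact .const c
  | app f a hf ha => rw [eval_app]; exact hf.app ha

theorem StAt.env_cons {a : Elt σ} (ha : StAt w a) (h : ∀ τ x, StAt w (ρ τ x)) (τ : Ty)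
    (x : Var (σ :: Γ) τ) : StAt w (Env.cons a ρ τ x) := by
  cases x with
  | here => exact ha
  | there x => exact h _ x

theorem StAt.len {s : Elt (.seq σ)} (hs : StAt w s) : StAt w (Elt.len s) :=
  .eval _ (hs.env_cons nofun)

theorem StAt.get {s : Elt (.seq σ)} {i : Elt .nat} (hs : StAt w s) (hi : StAt w i) :
    StAt w (Elt.get s i) :=
  .eval _ (hs.env_cons (hi.env_cons nofun))

theorem LtAt.succ_elim {i n : Elt .nat} (h : LtAt w i (Elt.succ n)) (hi : C.Internal)
    (ho : C.OrFree) (h1 : ∀ v, v ≤ w → EqAt v i n → Forces v C ρ')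
    (h2 : ∀ v, v ≤ w → LtAt v i n → Forces v C ρ') : Forces w C ρ' := by
  refine h.elim fun v hv k hk => ?_
  have h3 : Forces v (Tm.add v1 v0 ≐ v2 →ᶠ
      C.subst (.ofRen (.shift₃ Δ .nat .nat .nat))) (Env.cons k (Env.cons i (Env.cons n ρ'))) := by
    refine Forces.nat_cases 
      (φ := Tm.add v1 v0 ≐ v2 →ᶠ C.subst (.ofRen (.shift₃ Δ .nat .nat .nat))) ⟨trivial, hi.subst _⟩
      ⟨trivial, ho.subst _⟩ ?_ (fun k => ?_) k
    · simp only [forces_imp, forces_eq, forces_subst_val, Sub.val_ofRen, Ren.val_shift₃, eval_add,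
        eval_var, Env.cons_here, Env.cons_there, Elt.add_zero]
      exact fun u hu => h1 u (hu.trans hv)
    · simp only [forces_imp, forces_eq, forces_subst_val, Sub.val_ofRen, Ren.val_shift₃, eval_add,
        eval_var, Env.cons_here, Env.cons_there, Elt.add_succ]
      exact fun u hu hk => h2 u (hu.trans hv) (.intro k hk)
  simp only [forces_imp, forces_eq, forces_subst_val, Sub.val_ofRen, Ren.val_shift₃, eval_add,
    eval_var, Env.cons_here, Env.cons_there] at h3
  exact h3 v le_rfl hk.succ_inj

/-- An internal property of all standard elements holds for the entries of standard sequences. -/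
theorem MemAt.forces_of_st {φ : Formula (σ :: Γ)} (hi : φ.Internal) (ho : φ.OrFree)
    {s : Elt (.seq σ)} (hs : StAt w s)
    (h : ∀ d v, v ≤ w → StAt v d → Forces v φ (Env.cons d ρ)) {a : Elt σ} (ha : MemAt w a s) :
    Forces w φ (Env.cons a ρ) := by
  -- External induction on the bound `n`, applied to the standard length of `s`. An index below `S
  -- n` either is below `n` or equals the standard number `n`; in the latter case `s_n` is standard
  -- and its property is transferred along the equality, so indices need not be shown standard.
  have key : ∀ {n : Elt .nat}, StAt w n → Forces w (.all .nat (.lt v0 v1 →ᶠ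
      φ.subst (.cons (Tm.get v2 v0) (.ofRen (.shift₃ Γ _ _ _))))) (Env.cons n (Env.cons s ρ)) := by
    intro n hn
    refine Forces.nat_induction_st ?_ (fun v hv n hn ih => ?_) hn
    · simp only [forces_all, forces_imp, forces_lt, eval_var, Env.cons_here, Env.cons_there]
      exact fun i v hv hi => hi.not_zero
    · simp only [forces_all, forces_imp, forces_lt, forces_subst_val, Sub.val_cons, Sub.val_ofRen,
        Ren.val_shift₃, eval_get, eval_var, Env.cons_here, Env.cons_there] at ih ⊢
      intro i u hu hlt
      have := hlt.succ_elim (C := φ.subst (.cons (Tm.get v1 v0) (.ofRen (.shift₂ Γ _ _))))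
        (ρ' := Env.cons i (Env.cons s ρ)) (hi.subst _) (ho.subst _) (fun u' hu' hin => ?_)
        fun u' hu' hin => ?_
      · simpa using this
      · have h1 := h (Elt.get s n) u' ((hu'.trans hu).trans hv)
          (.get (hs.mono ((hu'.trans hu).trans hv)) (hn.mono (hu'.trans hu)))
        have h2 := hin.symm.forces (A := φ.subst (.cons (Tm.get v1 v0) (.ofRen (.shift₂ Γ _ _))))
          (ρ := Env.cons s ρ) (by simpa using h1)
        exact h2
      · simpa using ih i u' (hu'.trans hu) hin
  refine ha.elim fun v hv i hlt ha => ?_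
  have h1 := key hs.len
  simp only [forces_all, forces_imp, forces_lt, forces_subst_val, Sub.val_cons, Sub.val_ofRen,
    Ren.val_shift₃, eval_get, eval_var, Env.cons_here, Env.cons_there] at h1
  exact ha.symm.forces (h1 i v hv hlt)

end Principles

/-! ### The interpretation of a formula is equivalent to the formula -/

namespace Interp

variable {Γ Δ : Ctx} {σ τ υ : Ty} {w v : World} {ρ : Env Γ} {ρ' : Env Δ} {C : Formula Δ}
  {I J : Interp Γ} {K : Interp (σ :: Γ)}

/-- The formula `∃ˢᵗ x ∀ˢᵗ y φ(x, y)`. -/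
@[reducible] def formula (I : Interp Γ) : Formula Γ := .exSt I.W (.allSt I.C I.φ)

theorem formula_intro {x : Elt I.W} (hx : StAt w x)
    (h : ∀ y v, v ≤ w → StAt v y → I.Holds v ρ x y) : Forces w I.formula ρ :=
  .exSt_intro' x hx (forces_allSt.2 h)

theorem formula_elim (h : Forces w I.formula ρ)
    (h' : ∀ v, v ≤ w → ∀ x, StAt v x → (∀ y u, u ≤ v → StAt u y → I.Holds u ρ x y) →
      Forces v C ρ') : Forces w C ρ' :=
  h.exSt_elim' fun v hv x hx hx' => h' v hv x hx (forces_allSt.1 hx')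

theorem exists_stAt (σ : Ty) : ∃ a : Elt σ, ∀ w, StAt w a :=
  ⟨_, fun _ => .closed (Tm.empty σ)⟩

theorem formula_atom {A : Formula Γ} : Forces w (atom A).formula ρ ↔ Forces w A ρ := by
  refine ⟨fun h => formula_elim h fun v hv x hx h' => ?_, fun h => ?_⟩
  · exact holds_atom.1 (h' Elt.zero v le_rfl (.const _))
  · exact formula_intro (.const .zero) fun y v hv _ => holds_atom.2 (h.mono hv)

theorem formula_st {a : Tm Γ σ} : Forces w (st a).formula ρ ↔ StAt w (eval a ρ) := by
  refine ⟨fun h => ?_, fun h => formula_intro h fun y v hv _ => holds_st.2 (.refl _)⟩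
  have : Forces w (.st a) ρ := formula_elim h fun v hv x hx h' =>
    forces_st.2 ((holds_st.1 (h' Elt.zero v le_rfl (.const _))).stAt hx)
  exact forces_st.1 this

theorem formula_and : Forces w (I.and J).formula ρ ↔ Forces w (I.formula ∧ᶠ J.formula) ρ := by
  obtain ⟨a, ha⟩ := exists_stAt I.C
  obtain ⟨b, hb⟩ := exists_stAt J.C
  refine ⟨fun h => formula_elim h fun v hv x hx h' => forces_and.2 ⟨?_, ?_⟩, fun h => ?_⟩
  · refine formula_intro hx.fst fun y u hu hy => ?_
    simpa using (holds_and.1 (h' _ u hu (hy.pair (hb u)))).1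
  · refine formula_intro hx.snd fun y u hu hy => ?_
    simpa using (holds_and.1 (h' _ u hu ((ha u).pair hy))).2
  · refine formula_elim (forces_and.1 h).1 fun v hv x hx hx' =>
      formula_elim ((forces_and.1 h).2.mono hv) fun v' hv' x' hx'' h' =>
        formula_intro ((hx.mono hv').pair hx'') fun y u hu hy => ?_
    simp only [holds_and, Elt.fst_pair, Elt.snd_pair]
    exact ⟨hx' _ u (hu.trans hv') hy.fst, h' _ u hu hy.snd⟩

/-- External induction admits every formula, so for standard numbers the disjunction itself is
available. -/
theorem forces_zero_or (n : Elt .nat) (hn : StAt w n) :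
    Forces w ((v0 ≐ zero : Formula [.nat]).or (v0 ≐ zero).neg) (Env.cons n Env.nil) := by
  refine Forces.nat_induction_st ?_ (fun v hv n hn _ => ?_) hn
  · exact .or_left _ (by simpa using EqAt.refl _)
  · refine .or_right _ ?_
    simp only [forces_imp, forces_eq, eval_var, Env.cons_here, eval_zero]
    exact fun u hu h => h.succ_ne_zero

/-- The flag is standard, hence decided by `forces_zero_or`; conversely the flags `0` and `S 0` are
used, with dummies for the unused side. -/
theorem formula_or : Forces w (I.or J).formula ρ ↔ Forces w (I.formula.or J.formula) ρ := by
  obtain ⟨a, ha⟩ := exists_stAt I.C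
  obtain ⟨b, hb⟩ := exists_stAt J.C
  obtain ⟨c, hc⟩ := exists_stAt I.W
  obtain ⟨d, hd⟩ := exists_stAt J.W
  refine ⟨fun h => formula_elim h fun v hv x hx h' => ?_, fun h => ?_⟩
  · refine (forces_zero_or _ hx.fst).or_elim (fun u hu h0 => ?_) fun u hu h0 => ?_
    · refine .or_left _ (formula_intro (hx.mono hu).snd.fst fun y u' hu' hy => ?_)
      have h1 := (holds_or.1 (h' _ u' (hu'.trans hu) (hy.pair (hb u')))).1 u' le_rfl
      simp only [Elt.fst_pair] at h1
      exact h1 (by simpa using h0.mono hu')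
    · refine .or_right _ (formula_intro (hx.mono hu).snd.snd fun y u' hu' hy => ?_)
      have h1 := (holds_or.1 (h' _ u' (hu'.trans hu) ((ha u').pair hy))).2 u' le_rfl
      simp only [Elt.snd_pair] at h1
      refine h1 fun u'' hu'' h2 => ?_
      exact (forces_imp.1 h0 u'' (hu''.trans hu') (by simpa using h2)).bot_elim
  · refine h.or_elim (fun v hv h => ?_) fun v hv h => ?_
    · refine formula_elim h fun u hu x hx h' =>
        formula_intro (StAt.pair (.const .zero) (hx.pair (hd u))) fun y u' hu' hy => ?_
      simp only [holds_or, Elt.fst_pair, Elt.snd_pair]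
      refine ⟨fun u'' hu'' _ => h' _ u'' (hu''.trans hu') (hy.fst.mono hu''), fun u'' hu'' h0 => ?_⟩
      exact (h0 u'' le_rfl (.refl _)).bot_elim
    · refine formula_elim h fun u hu x hx h' => formula_intro
        (StAt.pair (StAt.app (.const .succ) (.const .zero)) ((hc u).pair hx)) fun y u' hu' hy => ?_
      simp only [holds_or, Elt.fst_pair, Elt.snd_pair]
      exact ⟨fun u'' hu'' h0 => EqAt.succ_ne_zero h0,
        fun u'' hu'' _ => h' _ u'' (hu''.trans hu') (hy.snd.mono hu'')⟩

/-- The counterexamples requested at standard arguments form a standard sequence, whose entries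
satisfy every internal `∨`-free property of all standard elements. -/
theorem formula_imp_mp (hI : I.IsInternal) (h : Forces w (I.imp J).formula ρ) :
    Forces w (I.formula →ᶠ J.formula) ρ := by
  refine formula_elim h fun v hv p hp h' => forces_imp.2 fun u hu hA =>
    formula_elim hA fun u' hu' x hx hx' => ?_
  have hp' := hp.mono (hu'.trans hu)
  refine formula_intro (hp'.fst.app hx) fun y u'' hu'' hy => ?_
  have hx'' := hx.mono hu''
  have h1 := holds_imp.1 (h' _ u'' (hu''.trans (hu'.trans hu)) (hx''.pair hy)) u'' le_rfl
  simp only [Elt.fst_pair, Elt.snd_pair] at h1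
  refine h1 fun z t ht hz => ?_
  exact hz.forces_of_st hI.1 hI.2 ((((hp'.mono hu'').snd.app hx'').app hy).mono ht)
    fun d t' ht' hd => hx' d t' (ht'.trans (ht.trans hu'')) hd

/-- Independence of premise pulls out the witness of the conclusion, underspill replaces the premise
for all standard `z` by its instances in one standard finite sequence, and two uses of choice make
the data functions of `x` and `y`. -/
theorem formula_imp_mpr (hI : I.IsInternal) (hJ : J.IsInternal)
    (h : Forces w (I.formula →ᶠ J.formula) ρ) : Forces w (I.imp J).formula ρ := by
  let B : Formula (.seq I.C :: J.C :: J.W :: I.W :: Γ) :=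
    .all I.C (.mem v0 v1 →ᶠ
      I.φ.subst (.cons v0 (.cons v4 (.ofRen fun _ x =>
        .there (.there (.there (.there (.there x)))))))) →ᶠ
    J.φ.subst (.cons v1 (.cons v2 (.ofRen (.shift₄ _ _ _ _ _))))
  have hBi : B.Internal := ⟨⟨internal_mem _ _, hI.1.subst _⟩, hJ.1.subst _⟩
  have hBo : B.OrFree := ⟨⟨orFree_mem _ _, hI.2.subst _⟩, hJ.2.subst _⟩
  have hB : ∀ {w s y u x}, Forces w B (Env.cons s (Env.cons y (Env.cons u (Env.cons x ρ)))) ↔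
      ∀ v, v ≤ w → (∀ z v', v' ≤ v → MemAt v' z s → I.Holds v' ρ x z) → J.Holds v ρ u y := by
    intro w s y u x
    simp [B, Holds]
    rfl
  have h1 : ∀ x v, v ≤ w → StAt v x → Forces v (.exSt (.prod J.W (.arrow J.C (.seq I.C)))
      (.allSt J.C (B.subst (.cons (.app (snd v1) v0) (.cons v0 (.cons (fst v1)
        (.cons v2 (.ofRen (.shift₃ _ _ _ _)))))))))
      (Env.cons x ρ) := by
    intro x v hv hx
    refine Forces.independence (φ := I.φ) (ρ := Env.cons x ρ)
      (Ψ := .allSt J.C (J.φ.subst (.cons v0 (.cons v1 (.ofRen (.shift₃ _ _ _ _)))))) hI.1 hI.2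
      (fun u hu hA => ?_) fun u hu a ha ha' => ?_
    · have h2 := forces_imp.1 h u (hu.trans hv) (formula_intro (hx.mono hu) hA)
      refine formula_elim h2 fun u' hu' a ha ha' => .exSt_intro' a ha (forces_allSt.2 ?_)
      simpa [Holds] using ha'
    · refine Forces.choice (Φ := B.subst (.cons v0 (.cons v1 (.cons v2 (.cons v3
        (.ofRen (.shift₄ _ _ _ _ _))))))) (σ := J.C) (τ := .seq I.C)
        (ρ := Env.cons a (Env.cons x ρ)) (fun y u' hu' hy => ?_) fun u' hu' g hg hg' => ?_
      -- If `s` contains all standard elements, then `∀ z ∈ s I(x, z)` implies the external premise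
      -- and hence `J`. This implication is internal in `s`, so some standard `s` satisfies it.
      · refine Forces.underspill (hBi.subst _) (hBo.subst _) fun s t ht hs => ?_
        simp only [forces_subst_val, Sub.val_cons, Sub.val_ofRen, Ren.val_shift₄, eval_var,
          Env.cons_here, Env.cons_there]
        refine hB.2 fun t' ht' hz => ?_
        have h3 := forces_allSt.1 (ha' t' (ht'.trans (ht.trans hu')) fun z t'' ht'' hz' =>
          hz z t'' ht'' (hs z t'' (ht''.trans ht') hz')) y t' le_rfl (hy.mono (ht'.trans ht))
        simpa [Holds] using h3
      · refine .exSt_intro' (Elt.pair a g) ((ha.mono hu').pair hg) (forces_allSt.2 ?_)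
        simpa using hg'
  refine Forces.choice h1 fun v hv F hF h2 => formula_intro
    (x := Elt.pair (eval (lam (fst (.app v1 v0))) (Env.cons F Env.nil))
      (eval (lam (snd (.app v1 v0))) (Env.cons F Env.nil))) ?_ fun y u hu hy => ?_
  · exact .pair (.eval _ (hF.env_cons nofun)) (.eval _ (hF.env_cons nofun))
  · have h3 := forces_allSt.1 (h2 _ u hu hy.fst) _ u le_rfl hy.snd
    simp only [forces_subst_val, Sub.val_cons, Sub.val_ofRen, Ren.val_shift₃, eval_var, eval_fst,
      eval_snd, eval_app, Env.cons_here, Env.cons_there, hB] at h3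
    simp only [holds_imp, Elt.fst_pair, Elt.snd_pair, eval_lam, eval_fst, eval_snd, eval_app,
      eval_var, Env.cons_here, Env.cons_there]
    exact fun t ht hz => h3 t ht hz

/-- Uniformity is exactly what makes one standard witness serve all elements. -/
theorem formula_all :
    Forces w (all σ K).formula ρ ↔ Forces w (.all σ K.formula) ρ := by
  refine ⟨fun h => formula_elim h fun v hv x hx h' => forces_all.2 fun d =>
    formula_intro hx fun y u hu hy => holds_all.1 (h' y u hu hy) d, fun h => ?_⟩
  refine Forces.uniformity (Φ := .allSt K.C K.φ) (forces_all.1 h) fun v hv x hx h' =>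
    formula_intro hx fun y u hu hy => holds_all.2 fun d => ?_
  exact forces_allSt.1 (h' d) y u hu hy

/-- From left to right, overspill replaces the standard test sequences by one that contains all
standard counterexamples. The converse uses that entries of standard sequences inherit internal
`∨`-free properties. -/
theorem formula_ex (hK : K.IsInternal) :
    Forces w (ex σ K).formula ρ ↔ Forces w (.ex σ K.formula) ρ := by
  refine ⟨fun h => formula_elim h fun v hv x hx h' => ?_, fun h => h.ex_elim fun v hv d hd =>
    formula_elim hd fun u hu x hx h' => formula_intro hx fun s u' hu' hs =>
      Holds.ex_intro d fun z t ht hz => ?_⟩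
  · refine Forces.overspill (φ := (ex σ K).φ) hK.ex.1 hK.ex.2 h' fun u hu s hs hs' => ?_
    refine Holds.ex_elim hs' fun u' hu' d hd => Forces.ex_intro d ?_
    exact formula_intro (hx.mono (hu'.trans hu)) fun y t ht hy =>
      hd y t ht (hs y t (ht.trans hu') hy)
  · exact hz.forces_of_st hK.1 hK.2 (hs.mono ht) fun d t' ht' hd =>
      h' d t' (ht'.trans (ht.trans hu')) hd

theorem formula_allSt : Forces w (allSt σ K).formula ρ ↔ Forces w (.allSt σ K.formula) ρ := by
  refine ⟨fun h => formula_elim h fun v hv f hf h' => forces_allSt.2 fun d u hu hd =>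
    formula_intro ((hf.mono hu).app hd) fun y t ht hy => ?_, fun h => ?_⟩
  · have := h' _ t (ht.trans hu) ((hd.mono ht).pair hy)
    simpa using this
  · refine Forces.choice (Φ := .allSt K.C K.φ) (forces_allSt.1 h) fun v hv f hf h' =>
      formula_intro hf fun y u hu hy => holds_allSt.2 ?_
    exact forces_allSt.1 (h' _ u hu hy.fst) _ u le_rfl hy.snd

theorem formula_exSt : Forces w (exSt σ K).formula ρ ↔ Forces w (.exSt σ K.formula) ρ := by
  refine ⟨fun h => formula_elim h fun v hv p hp h' => ?_, fun h => ?_⟩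
  · exact .exSt_intro' _ hp.fst (formula_intro hp.snd fun y u hu hy => holds_exSt.1 (h' y u hu hy))
  · refine h.exSt_elim' fun v hv d hd h' => formula_elim h' fun u hu x hx h' =>
      formula_intro ((hd.mono hu).pair hx) fun y t ht hy => ?_
    simpa using h' y t ht hy

/-- Every formula is equivalent to its interpretation. -/
theorem formula_interp {A : Formula Γ} :
    Forces w A.interp.formula ρ ↔ Forces w A ρ := by
  induction A generalizing w with
  | bot => exact formula_atom
  | eq a b => exact formula_atom
  | st a => exact formula_st.trans forces_st.symm
  | and A B hA hB => exact formula_and.trans (by simp only [forces_and, hA, hB])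
  | or A B hA hB =>
    refine formula_or.trans ⟨fun h => ?_, fun h => ?_⟩
    · exact h.or_elim (fun v _ h => .or_left _ (hA.1 h)) fun v _ h => .or_right _ (hB.1 h)
    · exact h.or_elim (fun v _ h => .or_left _ (hA.2 h)) fun v _ h => .or_right _ (hB.2 h)
  | imp A B hA hB =>
    refine Iff.trans ⟨formula_imp_mp A.isInternal_interp,
      formula_imp_mpr A.isInternal_interp B.isInternal_interp⟩ ?_
    simp only [forces_imp, hA, hB]
  | all σ A hA => exact formula_all.trans (by simp only [forces_all, hA])
  | ex σ A hA =>
    refine (formula_ex A.isInternal_interp).trans ⟨fun h => ?_, fun h => ?_⟩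
    · exact h.ex_elim fun v _ d hd => .ex_intro d (hA.1 hd)
    · exact h.ex_elim fun v _ d hd => .ex_intro d (hA.2 hd)
  | allSt σ A hA => exact formula_allSt.trans (by simp only [forces_allSt, hA])
  | exSt σ A hA =>
    refine formula_exSt.trans ⟨fun h => ?_, fun h => ?_⟩
    · exact h.exSt_elim' fun v _ d hd h => .exSt_intro' d hd (hA.1 h)
    · exact h.exSt_elim' fun v _ d hd h => .exSt_intro' d hd (hA.2 h)

end Interp

/-! ### Closed terms of type `0` -/

inductive IsNumeral : Elt .nat → Prop
  | zero : IsNumeral Elt.zero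
  | succ {n : Elt .nat} : IsNumeral n → IsNumeral (Elt.succ n)

theorem IsNumeral.eq_zero_or {n : Elt .nat} (h : IsNumeral n) :
    n = Elt.zero ∨ ∃ m, n = Elt.succ m := by
  cases h with
  | zero => exact .inl rfl
  | succ h => exact .inr ⟨_, rfl⟩

inductive IsListOf {σ : Ty} (P : Elt σ → Prop) : Elt (.seq σ) → Prop
  | nil : IsListOf P (Elt.nil σ)
  | cons {a : Elt σ} {s : Elt (.seq σ)} : P a → IsListOf P s → IsListOf P (Elt.cons a s)

/-- The hereditarily canonical elements. -/
def IsCanonical : (σ : Ty) → Elt σ → Prop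
  | .nat => IsNumeral
  | .arrow σ τ => fun f => ∀ a, IsCanonical σ a → IsCanonical τ (f ⬝ a)
  | .seq σ => IsListOf (IsCanonical σ)

/-- The computability argument of Tait. Defining equations hold as equalities of elements, so no
reduction relation is needed: recursors are treated by induction on numerals and on canonical lists.
-/
theorem isCanonical_const {σ : Ty} (c : Const σ) : IsCanonical σ c.elt := by
  cases c with
  | zero => exact .zero
  | succ => exact fun n hn => .succ hn
  | proj σ τ =>
    intro a ha b _
    rw [Elt.proj_app]
    exact ha
  | comb ρ σ τ =>
    intro f hf g hg a ha
    rw [Elt.comb_app]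
    exact hf a ha _ (hg a ha)
  | natRec σ =>
    intro a ha f hf n hn
    change IsCanonical σ (Elt.natRec a f n)
    induction hn with
    | zero => rw [Elt.natRec_zero]; exact ha
    | succ hn ih => rw [Elt.natRec_succ]; exact hf _ ih _ hn
  | nil σ => exact .nil
  | cons σ => exact fun a ha s hs => .cons ha hs
  | listRec σ τ =>
    intro a ha f hf s hs
    change IsCanonical σ (Elt.listRec a f s)
    induction hs with
    | nil => rw [Elt.listRec_nil]; exact ha
    | cons hb _ ih => rw [Elt.listRec_cons]; exact hf _ ih _ hb

theorem isCanonical_eval {σ : Ty} (t : Tm [] σ) : IsCanonical σ (eval t Env.nil) := by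
  induction t with
  | var x => cases x
  | const c => exact isCanonical_const c
  | app f a hf ha => rw [eval_app]; exact hf _ ha

/-! ### The existence and disjunction properties -/

/-- A realizer of the existential formula is a pair of term and witness. Soundness validates the
matrix for all `y`, and the characterisation turns this back into the formula. -/
theorem Provable.exists_closed {Γ : Ctx} {σ : Ty} {Φ : Formula (σ :: Γ)}
    (h : Provable H (.exSt σ Φ)) : ∃ t : Tm [] σ, Provable H (Φ.inst (t.ofClosed Γ)) := by
  obtain ⟨t, ht⟩ : (Interp.exSt σ Φ.interp).Realized := h.realized
  refine ⟨fst t, provable_of_forces fun ρ => ?_⟩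
  rw [forces_inst, eval_ofClosed, eval_fst]
  exact Interp.formula_interp.1 (Interp.formula_intro (StAt.closed t).snd fun y v _ _ =>
    Interp.holds_exSt.1 (ht v ρ y))

/-- The flag of the realizer is a closed term, hence a numeral independent of world and assignment;
so one and the same disjunct is valid everywhere, even with free variables present. -/
theorem Provable.or_cases {Γ : Ctx} {Φ Ψ : Formula Γ} (h : Provable H (Φ.or Ψ)) :
    Provable H Φ ∨ Provable H Ψ := by
  obtain ⟨t, ht⟩ : (Φ.interp.or Ψ.interp).Realized := h.realized
  replace ht := fun w ρ y => Interp.holds_or.1 (ht w ρ y)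
  obtain ⟨a, -⟩ := Interp.exists_stAt Φ.interp.C
  obtain ⟨b, -⟩ := Interp.exists_stAt Ψ.interp.C
  have hn : IsNumeral (Elt.fst (eval t Env.nil)) := by
    rw [← eval_fst]
    exact isCanonical_eval (fst t)
  rcases hn.eq_zero_or with h0 | ⟨n, h0⟩
  · refine .inl (provable_of_forces fun ρ => Interp.formula_interp.1
      (Interp.formula_intro (StAt.closed t).snd.fst fun y v _ _ => ?_))
    have h1 := (ht v ρ (Elt.pair y b)).1 v le_rfl (.of_eq h0)
    rwa [Elt.fst_pair] at h1
  · refine .inr (provable_of_forces fun ρ => Interp.formula_interp.1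
      (Interp.formula_intro (StAt.closed t).snd.snd fun y v _ _ => ?_))
    have h1 := (ht v ρ (Elt.pair a y)).2 v le_rfl fun u _ h => by
      rw [h0] at h
      exact h.succ_ne_zero
    rwa [Elt.snd_pair] at h1

end UDN

theorem mainTheorem3 :
    (∀ (Γ : UDN.Ctx) (σ : UDN.Ty) (Φ : UDN.Formula (σ :: Γ)),
      UDN.Provable UDN.H (UDN.Formula.exSt σ Φ) →
        ∃ t : UDN.Tm [] σ, UDN.Provable UDN.H (Φ.inst (t.ofClosed Γ))) ∧
    (∀ (Γ : UDN.Ctx) (Φ Ψ : UDN.Formula Γ),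
      UDN.Provable UDN.H (Φ.or Ψ) → UDN.Provable UDN.H Φ ∨ UDN.Provable UDN.H Ψ) :=
  ⟨fun _ _ _ h => h.exists_closed, fun _ _ _ h => h.or_cases⟩
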